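/- Let $(\Sigma_1,g_1)$ and $(\Sigma_2,g_2)$ be oriented smooth Lorentzian surfaces with Gauss curvatures $\kappa_1,\kappa_2$. Let $j_k$ be the paracomplex structure of $\Sigma_k$, given by $j_k s=t$, $j_k t=s$ for every positively oriented orthogonal frame $(s,t)$ with $g_k(s,s)=-g_k(t,t)>0$, and put $\omega_k=g_k(j_k\cdot,\cdot)$. For $\epsilon\in\{-1,1\}$ equip $\Sigma_1\times\Sigma_2$ with the metric $G^\epsilon=\pi_1^*g_1+\epsilon\,\pi_2^*g_2$ and the two-form $\Omega^\epsilon=\pi_1^*\omega_1+\epsilon\,\pi_2^*\omega_2$, where $\pi_1,\pi_2$ are the projections. Assume that one of the following holds: (i) $g_1$ and $g_2$ are both non-flat almost everywhere (the zero set of each $\kappa_k$ has measure zero), and $\epsilon\,\kappa_1(x)\kappa_2(y)<0$ for all $x\in\Sigma_1$, $y\in\Sigma_2$ with $\kappa_1(x)\neq0$ and $\kappa_2(y)\neq 0$; (ii) one of $g_1,g_2$ is flat and the other one is non-flat almost everywhere. Let $\Phi:S\to\Sigma_1\times\Sigma_2$ be a smooth immersion of a surface with $\Phi^*\Omega^\epsilon=0$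 such that the induced metric $\Phi^*G^\epsilon$ is nondegenerate and the mean curvature vector $H$ of $\Phi$ with respect to $G^\epsilon$ is parallel in the normal bundle, $\nabla^\perp H=0$. Then $\Phi$ is locally a product $\gamma_1\times\gamma_2$ of curves of constant curvature: every point of $S$ has a neighbourhood with smooth coordinates $(s,t)$ in which $\Phi(s,t)=(\gamma_1(s),\gamma_2(t))$, where each $\gamma_k$ is a smooth non-null curve in $\Sigma_k$, parametrized by arclength ($g_k(\gamma_k',\gamma_k')=\pm1$), whose curvature, defined by $D_{\gamma_k'}\gamma_k'=c_k\,j_k\gamma_k'$ with the Levi-Civita connection $D$ of $g_k$, is a constant $c_k$. -/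

import Mathlib

open scoped Manifold ContDiff Topology Matrix

noncomputable section

/-! ## Pseudo-Riemannian geometry in local coordinates -/

namespace CoordGeom

variable {ι : Type*} [Fintype ι] [DecidableEq ι]

/-- The partial derivative `∂ᵢ f` of a scalar function of the coordinates. -/
def pd (i : ι) (f : (ι → ℝ) → ℝ) (u : ι → ℝ) : ℝ :=
  fderiv ℝ f u (Pi.single i 1)

/-- The Christoffel symbol `Γᵏᵢⱼ` of the Levi-Civita connection of the metric with coefficient
matrix `g`. -/
def christoffel (g : (ι → ℝ) → Matrix ι ι ℝ) (k i j : ι) (u : ι → ℝ) : ℝ :=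
  (1 / 2) * ∑ l, (g u)⁻¹ k l *
    (pd i (fun x => g x j l) u + pd j (fun x => g x i l) u - pd l (fun x => g x i j) u)

/-- The coefficient of `∂ₗ` in `R(∂ᵢ, ∂ⱼ)∂ₖ`, where `R(X, Y)Z = ∇_X ∇_Y Z - ∇_Y ∇_X Z - ∇_[X,Y] Z`. -/
def riemann (g : (ι → ℝ) → Matrix ι ι ℝ) (l i j k : ι) (u : ι → ℝ) : ℝ :=
  pd i (christoffel g l j k) u - pd j (christoffel g l i k) u
    + ∑ m, (christoffel g l i m u * christoffel g m j k u
        - christoffel g l j m u * christoffel g m i k u)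

/-- The Gauss curvature `g(R(∂₁, ∂₂)∂₂, ∂₁) / (g₁₁ g₂₂ - g₁₂²)` of a metric in two variables. -/
def gaussCurvature (g : (Fin 2 → ℝ) → Matrix (Fin 2) (Fin 2) ℝ) (u : Fin 2 → ℝ) : ℝ :=
  (∑ l, riemann g l 0 1 1 u * g u l 0) / (g u).det

/-- For a symmetric matrix `G` with `det G < 0` (a Lorentzian scalar product on the oriented plane
`ℝ²`), the matrix of the paracomplex structure `j`: if `(s, t)` is a positively oriented
orthogonal basis with `G(s, s) = -G(t, t) > 0`, then `j s = t` and `j t = s`. -/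
def paracomplex (G : Matrix (Fin 2) (Fin 2) ℝ) : Matrix (Fin 2) (Fin 2) ℝ :=
  (Real.sqrt (-G.det))⁻¹ • !![-G 0 1, -G 1 1; G 0 0, G 0 1]

/-- The matrix of `ω(X, Y) = G(jX, Y)`. -/
def kaehlerForm (G : Matrix (Fin 2) (Fin 2) ℝ) : Matrix (Fin 2) (Fin 2) ℝ :=
  (paracomplex G)ᵀ * G

/-- The product metric `G^ε = g₁ + ε g₂` in product coordinates. -/
def prodMetric (ε : ℝ) (g₁ g₂ : (Fin 2 → ℝ) → Matrix (Fin 2) (Fin 2) ℝ)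
    (x : Fin 2 ⊕ Fin 2 → ℝ) : Matrix (Fin 2 ⊕ Fin 2) (Fin 2 ⊕ Fin 2) ℝ :=
  Matrix.fromBlocks (g₁ (x ∘ Sum.inl)) 0 0 (ε • g₂ (x ∘ Sum.inr))

/-- The two-form `Ω^ε = π₁^* ω₁ + ε π₂^* ω₂` in product coordinates. -/
def prodForm (ε : ℝ) (g₁ g₂ : (Fin 2 → ℝ) → Matrix (Fin 2) (Fin 2) ℝ)
    (x : Fin 2 ⊕ Fin 2 → ℝ) : Matrix (Fin 2 ⊕ Fin 2) (Fin 2 ⊕ Fin 2) ℝ :=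
  Matrix.fromBlocks (kaehlerForm (g₁ (x ∘ Sum.inl))) 0 0 (ε • kaehlerForm (g₂ (x ∘ Sum.inr)))

/-- The coordinate tangent vector `∂ₐF` of a parametrized surface `F`. -/
def tangent (F : (Fin 2 → ℝ) → ι → ℝ) (a : Fin 2) (u : Fin 2 → ℝ) : ι → ℝ :=
  fun k => pd a (fun w => F w k) u

/-- The pull-back by `F` of a field `B` of bilinear forms: the matrix `B(∂ₐF, ∂_bF)`. For a metric
this is the first fundamental form. -/
def pullback (B : (ι → ℝ) → Matrix ι ι ℝ) (F : (Fin 2 → ℝ) → ι → ℝ) (u : Fin 2 → ℝ) :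
    Matrix (Fin 2) (Fin 2) ℝ :=
  Matrix.of fun a b => tangent F a u ⬝ᵥ (B (F u) *ᵥ tangent F b u)

/-- The ambient covariant derivative `∇_{∂ₐF} V` of a vector field `V` along `F`. -/
def covDeriv (g : (ι → ℝ) → Matrix ι ι ℝ) (F V : (Fin 2 → ℝ) → ι → ℝ) (a : Fin 2)
    (u : Fin 2 → ℝ) : ι → ℝ :=
  fun k => pd a (fun w => V w k) u
    + ∑ i, ∑ j, christoffel g k i j (F u) * tangent F a u i * V u j

/-- The component of a vector `v` at `F u` normal to a surface with nondegenerate first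
fundamental form. -/
def normalPart (g : (ι → ℝ) → Matrix ι ι ℝ) (F : (Fin 2 → ℝ) → ι → ℝ) (u : Fin 2 → ℝ)
    (v : ι → ℝ) : ι → ℝ :=
  v - ∑ a, ∑ b, ((pullback g F u)⁻¹ a b * (v ⬝ᵥ (g (F u) *ᵥ tangent F b u))) • tangent F a u

/-- The second fundamental form `h(∂ₐ, ∂_b) = (∇_{∂ₐF} ∂_bF)^⊥`. -/
def secondFundamentalForm (g : (ι → ℝ) → Matrix ι ι ℝ) (F : (Fin 2 → ℝ) → ι → ℝ) (a b : Fin 2)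
    (u : Fin 2 → ℝ) : ι → ℝ :=
  normalPart g F u (covDeriv g F (tangent F b) a u)

/-- The mean curvature vector, half of the trace of the second fundamental form. -/
def meanCurvature (g : (ι → ℝ) → Matrix ι ι ℝ) (F : (Fin 2 → ℝ) → ι → ℝ) (u : Fin 2 → ℝ) :
    ι → ℝ :=
  (1 / 2 : ℝ) • ∑ a, ∑ b, (pullback g F u)⁻¹ a b • secondFundamentalForm g F a b u

/-- `∇^⊥ H = 0` at the point with coordinates `u`. -/
def ParallelMeanCurvatureAt (g : (ι → ℝ) → Matrix ι ι ℝ) (F : (Fin 2 → ℝ) → ι → ℝ)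
    (u : Fin 2 → ℝ) : Prop :=
  ∀ a, normalPart g F u (covDeriv g F (meanCurvature g F) a u) = 0

/-- The covariant acceleration `D_{c'} c'` of a curve. -/
def acceleration (g : (ι → ℝ) → Matrix ι ι ℝ) (c : ℝ → ι → ℝ) (s : ℝ) : ι → ℝ :=
  fun k => deriv (deriv c) s k
    + ∑ i, ∑ j, christoffel g k i j (c s) * deriv c s i * deriv c s j

end CoordGeom

/-! ## Lorentzian surfaces -/

namespace LorentzSurface

/-- The model plane of surfaces. -/
abbrev Plane : Type := EuclideanSpace ℝ (Fin 2)

variable {M : Type*} [TopologicalSpace M]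

/-- The coordinates of a point in the chart `e`. -/
def coord (e : OpenPartialHomeomorph M Plane) (x : M) : Fin 2 → ℝ := (e x).ofLp

/-- The point with given coordinates in the chart `e`. -/
def point (e : OpenPartialHomeomorph M Plane) (u : Fin 2 → ℝ) : M := e.symm (WithLp.toLp 2 u)

/-- The set of coordinate values of the chart `e`. -/
def coordDomain (e : OpenPartialHomeomorph M Plane) : Set (Fin 2 → ℝ) :=
  {u | WithLp.toLp 2 u ∈ e.target}

variable [ChartedSpace Plane M]

/-- The coordinate vector field `∂ᵢ` of the chart `e`, at the point with coordinates `u`. -/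
def coordVector (e : OpenPartialHomeomorph M Plane) (i : Fin 2) (u : Fin 2 → ℝ) :
    TangentSpace (𝓡 2) (point e u) :=
  mfderiv (𝓡 2) (𝓡 2) e.symm (WithLp.toLp 2 u) (EuclideanSpace.single i (1 : ℝ))

variable (M) in
/-- The charts that make up the atlas of `M` induce the same orientation on overlaps: a surface
with such an atlas is an oriented surface. -/
def IsOrientedAtlas : Prop :=
  ∀ e ∈ atlas Plane M, ∀ e' ∈ atlas Plane M, ∀ y ∈ (e.symm.trans e').source,
    0 < (fderiv ℝ (e' ∘ e.symm) y).det

variable (M) in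
/-- A smooth Lorentzian metric on a surface: smooth in the sense that its components are smooth
in every chart, and of signature `(1, 1)` at every point. -/
structure LorentzMetric where
  /-- The scalar product on each tangent plane. -/
  inner : ∀ x : M, LinearMap.BilinForm ℝ (TangentSpace (𝓡 2) x)
  symm : ∀ (x : M) (v w : TangentSpace (𝓡 2) x), inner x v w = inner x w v
  exists_pos : ∀ x : M, ∃ v : TangentSpace (𝓡 2) x, 0 < inner x v v
  exists_neg : ∀ x : M, ∃ v : TangentSpace (𝓡 2) x, inner x v v < 0
  smooth : ∀ e ∈ atlas Plane M, ∀ i j : Fin 2,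
    ContDiffOn ℝ ∞ (fun u => inner (point e u) (coordVector e i u) (coordVector e j u))
      (coordDomain e)

/-- The matrix of components of the metric in the chart `e`. -/
def LorentzMetric.components (g : LorentzMetric M) (e : OpenPartialHomeomorph M Plane)
    (u : Fin 2 → ℝ) : Matrix (Fin 2) (Fin 2) ℝ :=
  Matrix.of fun i j => g.inner (point e u) (coordVector e i u) (coordVector e j u)

/-- The Gauss curvature at the point `x` (it does not depend on the chart used to compute it). -/
def LorentzMetric.curvature (g : LorentzMetric M) (x : M) : ℝ :=
  CoordGeom.gaussCurvature (g.components (chartAt Plane x)) (coord (chartAt Plane x) x)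

/-- The metric is flat. -/
def LorentzMetric.IsFlat (g : LorentzMetric M) : Prop := ∀ x, g.curvature x = 0

/-- The metric is non-flat almost everywhere: the set of flat points has measure zero
in every chart. -/
def LorentzMetric.NonFlatAE (g : LorentzMetric M) : Prop :=
  ∀ e ∈ atlas Plane M,
    MeasureTheory.volume (coord e '' {x | x ∈ e.source ∧ g.curvature x = 0}) = 0

/-- The restriction of `γ` to the open set `I` is a smooth non-null curve in the oriented
Lorentzian surface `M`, parametrized by arclength (`g(γ', γ') = ±1`), whose curvature `k`,
given by `D_{γ'} γ' = k j γ'`, is constant. -/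
def LorentzMetric.IsConstantCurvatureCurve (g : LorentzMetric M) (γ : ℝ → M) (I : Set ℝ) : Prop :=
  ContMDiffOn 𝓘(ℝ, ℝ) (𝓡 2) ∞ γ I ∧
    ∃ η k : ℝ, (η = 1 ∨ η = -1) ∧
      ∀ s ∈ I, ∀ e ∈ atlas Plane M, γ s ∈ e.source →
        deriv (coord e ∘ γ) s ⬝ᵥ
            (g.components e (coord e (γ s)) *ᵥ deriv (coord e ∘ γ) s) = η ∧
          CoordGeom.acceleration (g.components e) (coord e ∘ γ) s =
            k • (CoordGeom.paracomplex (g.components e (coord e (γ s)))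
              *ᵥ deriv (coord e ∘ γ) s)

/-! ## Surfaces in the product of two Lorentzian surfaces -/

variable {M₁ M₂ S : Type*} [TopologicalSpace M₁] [ChartedSpace Plane M₁]
  [TopologicalSpace M₂] [ChartedSpace Plane M₂] [TopologicalSpace S] [ChartedSpace Plane S]

/-- The expression of `Φ` in the charts `e` of `S`, `e₁` of `M₁` and `e₂` of `M₂`. -/
def localExpr (Φ : S → M₁ × M₂) (e : OpenPartialHomeomorph S Plane)
    (e₁ : OpenPartialHomeomorph M₁ Plane) (e₂ : OpenPartialHomeomorph M₂ Plane)
    (u : Fin 2 → ℝ) : Fin 2 ⊕ Fin 2 → ℝ :=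
  Sum.elim (coord e₁ (Φ (point e u)).1) (coord e₂ (Φ (point e u)).2)

/-- The (tensorial) condition `P`, on the metric components of `M₁` and `M₂`, the local expression
of `Φ` and a coordinate value, holds at every point of `S` in all local coordinates: any
smooth chart of `S` and any charts of the oriented atlases of `M₁` and `M₂`. -/
def HoldsInCharts (g₁ : LorentzMetric M₁) (g₂ : LorentzMetric M₂) (Φ : S → M₁ × M₂)
    (P : ((Fin 2 → ℝ) → Matrix (Fin 2) (Fin 2) ℝ) → ((Fin 2 → ℝ) → Matrix (Fin 2) (Fin 2) ℝ) →
      ((Fin 2 → ℝ) → Fin 2 ⊕ Fin 2 → ℝ) → (Fin 2 → ℝ) → Prop) : Prop :=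
  ∀ e ∈ IsManifold.maximalAtlas (𝓡 2) ∞ S, ∀ e₁ ∈ atlas Plane M₁, ∀ e₂ ∈ atlas Plane M₂,
    ∀ p ∈ e.source, (Φ p).1 ∈ e₁.source → (Φ p).2 ∈ e₂.source →
      P (g₁.components e₁) (g₂.components e₂) (localExpr Φ e e₁ e₂) (coord e p)

/-- `Φ` is `Ω^ε`-Lagrangian: `Φ^* Ω^ε = 0`. -/
def IsLagrangian (ε : ℝ) (g₁ : LorentzMetric M₁) (g₂ : LorentzMetric M₂) (Φ : S → M₁ × M₂) :
    Prop :=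
  HoldsInCharts g₁ g₂ Φ fun a₁ a₂ F u =>
    CoordGeom.pullback (CoordGeom.prodForm ε a₁ a₂) F u = 0

/-- The induced metric `Φ^* G^ε` is nondegenerate. -/
def IsNondegenerate (ε : ℝ) (g₁ : LorentzMetric M₁) (g₂ : LorentzMetric M₂) (Φ : S → M₁ × M₂) :
    Prop :=
  HoldsInCharts g₁ g₂ Φ fun a₁ a₂ F u =>
    (CoordGeom.pullback (CoordGeom.prodMetric ε a₁ a₂) F u).det ≠ 0

/-- The mean curvature vector of `Φ` with respect to `G^ε` is parallel in the normal bundle. -/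
def HasParallelMeanCurvature (ε : ℝ) (g₁ : LorentzMetric M₁) (g₂ : LorentzMetric M₂)
    (Φ : S → M₁ × M₂) : Prop :=
  HoldsInCharts g₁ g₂ Φ fun a₁ a₂ F u =>
    CoordGeom.ParallelMeanCurvatureAt (CoordGeom.prodMetric ε a₁ a₂) F u

/-- `Φ` is locally a product of curves of constant curvature: around every point of `S` there are
smooth coordinates `(s, t)`, ranging over a square, in which `Φ (s, t) = (γ₁ s, γ₂ t)`, where
`γ₁` and `γ₂` are curves of constant curvature parametrized by arclength. -/
def IsLocallyProductOfCurves (g₁ : LorentzMetric M₁) (g₂ : LorentzMetric M₂) (Φ : S → M₁ × M₂) :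
    Prop :=
  ∀ p : S, ∃ δ > 0, ∃ (P : PartialDiffeomorph 𝓘(ℝ, ℝ × ℝ) (𝓡 2) (ℝ × ℝ) S ∞)
      (γ₁ : ℝ → M₁) (γ₂ : ℝ → M₂),
    P.source = Set.Ioo (-δ) δ ×ˢ Set.Ioo (-δ) δ ∧ P (0, 0) = p ∧
      g₁.IsConstantCurvatureCurve γ₁ (Set.Ioo (-δ) δ) ∧
      g₂.IsConstantCurvatureCurve γ₂ (Set.Ioo (-δ) δ) ∧
      ∀ s ∈ Set.Ioo (-δ) δ, ∀ t ∈ Set.Ioo (-δ) δ, Φ (P (s, t)) = (γ₁ s, γ₂ t)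

end LorentzSurface

end

/-!
The proof has two halves, both of which rest on the Maslov form `θ = 2 G(H, J·)` of the surface,
where `G = G^ε` and `J = j₁ ⊕ j₂`.

The projections of the surface to the two factors degenerate everywhere. Since `J` is parallel and
exchanges the tangent planes and the normal planes of a Lagrangian surface, the cubic form
`G(∇_X Y, JZ)` is totally symmetric, and `θ` is minus the trace of the connection form that `∇`
induces between the frames `∂ₐF` and `J∂ₐF`. Hence `dθ` is minus the corresponding trace of the
ambient curvature. Each factor has curvature operator `κ_k ω_k j_k`, and by the Lagrangian condition
the two factors contribute equally to the trace of the induced metric, so this trace is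
`κ₁ π₁^*ω₁ + κ₂ π₂^*ω₂`. If `H` is parallel, then `dθ = 0` because `θ(∇_X Y)` is symmetric in `X`
and `Y`; this is `IsParallelLagrangian.curvature_relation`. Together with `π₁^*ω₁ + ε π₂^*ω₂ = 0`
it gives `κ₂ = ε κ₁` wherever `π₁^*ω₁ ≠ 0`, and there both projections are local diffeomorphisms.
Under either assumption on the curvatures, `κ₁ = κ₂ = 0` at such points, so both factors would be
flat on nonempty open sets, while one of them is non-flat almost everywhere
(`jacobian_fst_localExpr_eq_zero`).

Two maps of rank one with transversal kernels depend, in suitable coordinates, on one variable each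
(`exists_product_coordinates`), so the surface is locally a product of two curves. As the induced
metric is nondegenerate, the curves are not null, and they can be parametrized by arclength
(`IsLorentzOn.exists_arclength_parameter`). The coordinate vector fields of the resulting product
coordinates are parallel along each other, so `∇_{∂ₐ} ∂ₐF = k J∂ₐF`, where the curvature `k` of the
curve is `-θ(∂ₐ)`. Its derivatives are `-2 G(H, J∇_{∂_b} ∂ₐF)`, which vanishes for `b ≠ a` and is
a multiple of `G(H, ∂ₐF) = 0` for `b = a`; this is `IsParallelLagrangian.exists_acceleration_eq`.

The definitions refer to coordinates. The computations take place in coordinates too, and the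
results are carried to the manifolds by means of the transition maps, which are orientation
preserving isometries (`LorentzMetric.isLocalIsometry_transition`, `transition_det_pos`).
-/

noncomputable section

/-! ### Partial derivatives -/

namespace CoordGeom

variable {ι : Type*} [DecidableEq ι]

theorem pd_congr {i : ι} {f h : (ι → ℝ) → ℝ} {u : ι → ℝ} (hfh : f =ᶠ[𝓝 u] h) :
    pd i f u = pd i h u := by
  unfold pd; rw [hfh.fderiv_eq]

theorem pd_congr_of_isOpen {i : ι} {f h : (ι → ℝ) → ℝ} {U : Set (ι → ℝ)} (hU : IsOpen U)
    (hfh : ∀ u ∈ U, f u = h u) {u : ι → ℝ} (hu : u ∈ U) : pd i f u = pd i h u :=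
  pd_congr (Filter.eventuallyEq_of_mem (hU.mem_nhds hu) hfh)

theorem pd_const (i : ι) (c : ℝ) (u : ι → ℝ) : pd i (fun _ => c) u = 0 := by
  simp [pd]

theorem pd_add [Fintype ι] {i : ι} {f h : (ι → ℝ) → ℝ} {u : ι → ℝ} (hf : DifferentiableAt ℝ f u)
    (hh : DifferentiableAt ℝ h u) : pd i (fun w => f w + h w) u = pd i f u + pd i h u := by
  unfold pd; rw [fderiv_fun_add hf hh]; rfl

theorem pd_sub [Fintype ι] {i : ι} {f h : (ι → ℝ) → ℝ} {u : ι → ℝ} (hf : DifferentiableAt ℝ f u)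
    (hh : DifferentiableAt ℝ h u) : pd i (fun w => f w - h w) u = pd i f u - pd i h u := by
  unfold pd; rw [fderiv_fun_sub hf hh]; rfl

theorem pd_neg [Fintype ι] {i : ι} {f : (ι → ℝ) → ℝ} {u : ι → ℝ} :
    pd i (fun w => - f w) u = - pd i f u := by
  unfold pd; rw [fderiv_fun_neg]; rfl

theorem pd_mul [Fintype ι] {i : ι} {f h : (ι → ℝ) → ℝ} {u : ι → ℝ} (hf : DifferentiableAt ℝ f u)
    (hh : DifferentiableAt ℝ h u) :
    pd i (fun w => f w * h w) u = pd i f u * h u + f u * pd i h u := by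
  unfold pd; rw [fderiv_fun_mul hf hh]; simp; ring

theorem pd_const_mul [Fintype ι] {i : ι} {h : (ι → ℝ) → ℝ} {u : ι → ℝ} (c : ℝ)
    (hh : DifferentiableAt ℝ h u) :
    pd i (fun w => c * h w) u = c * pd i h u := by
  unfold pd; rw [fderiv_const_mul hh]; rfl

theorem contDiffAt_pd [Fintype ι] {i : ι} {f : (ι → ℝ) → ℝ} {u : ι → ℝ} (hf : ContDiffAt ℝ ∞ f u) :
    ContDiffAt ℝ ∞ (pd i f) u :=
  (hf.fderiv_right (m := ∞) (by simp)).clm_apply contDiffAt_const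

theorem pd_comm [Fintype ι] {i j : ι} {f : (ι → ℝ) → ℝ} {u : ι → ℝ} (hf : ContDiffAt ℝ ∞ f u) :
    pd i (pd j f) u = pd j (pd i f) u := by
  have hd : DifferentiableAt ℝ (fderiv ℝ f) u :=
    (hf.fderiv_right (m := ∞) (by simp)).differentiableAt (by simp)
  have key : ∀ v w : ι → ℝ, fderiv ℝ (fun x => fderiv ℝ f x v) u w
      = fderiv ℝ (fderiv ℝ f) u w v := by
    intro v w
    rw [fderiv_clm_apply hd (by fun_prop)]
    simp
  have hs := hf.isSymmSndFDerivAt (by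
    simpa using WithTop.coe_le_coe.2 (le_top : (2 : ℕ∞) ≤ ⊤))
  unfold pd
  rw [key, key]
  exact hs _ _

/-- The chain rule in coordinates. -/
theorem pd_comp [Fintype ι] {κ : Type*} [Fintype κ] [DecidableEq κ] {a : κ} {f : (ι → ℝ) → ℝ}
    {F : (κ → ℝ) → ι → ℝ} {u : κ → ℝ}
    (hf : DifferentiableAt ℝ f (F u)) (hF : ∀ k, DifferentiableAt ℝ (fun w => F w k) u) :
    pd a (fun w => f (F w)) u = ∑ k, pd k f (F u) * pd a (fun w => F w k) u := by
  have hF' : DifferentiableAt ℝ F u := differentiableAt_pi.2 hF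
  have h1 : fderiv ℝ (fun w => f (F w)) u = (fderiv ℝ f (F u)).comp (fderiv ℝ F u) :=
    fderiv_comp u hf hF'
  have h2 : ∀ k, pd a (fun w => F w k) u = fderiv ℝ F u (Pi.single a 1) k := by
    intro k
    unfold pd
    rw [fderiv_apply hF' k]; rfl
  simp_rw [h2]
  unfold pd
  rw [h1, ContinuousLinearMap.comp_apply]
  conv_lhs => rw [pi_eq_sum_univ' (fderiv ℝ F u (Pi.single a 1))]
  rw [map_sum]
  refine Finset.sum_congr rfl fun k _ => ?_
  rw [map_smul, smul_eq_mul, mul_comm]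

theorem pd_apply [Fintype ι] (a k : ι) (x : ι → ℝ) :
    pd a (fun w => w k) x = if k = a then 1 else 0 := by
  have : (fun w : ι → ℝ => w k) = (ContinuousLinearMap.proj (R := ℝ) (φ := fun _ => ℝ) k) :=
    rfl
  simp only [pd, this, ContinuousLinearMap.fderiv]
  simp [Pi.single_apply]

end CoordGeom

/-! ### Lorentzian metrics in two variables -/

namespace CoordGeom

/-- `g` is the coefficient matrix of a smooth Lorentzian metric on the open set `D` of the
plane. -/
structure IsLorentzOn (g : (Fin 2 → ℝ) → Matrix (Fin 2) (Fin 2) ℝ) (D : Set (Fin 2 → ℝ)) :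
    Prop where
  isOpen : IsOpen D
  smooth : ∀ i j, ContDiffOn ℝ ∞ (fun x => g x i j) D
  symm : ∀ x ∈ D, ∀ i j, g x i j = g x j i
  det_neg : ∀ x ∈ D, (g x).det < 0

namespace IsLorentzOn

variable {g : (Fin 2 → ℝ) → Matrix (Fin 2) (Fin 2) ℝ} {D : Set (Fin 2 → ℝ)} {x : Fin 2 → ℝ}

theorem contDiffAt (hg : IsLorentzOn g D) (hx : x ∈ D) (i j : Fin 2) :
    ContDiffAt ℝ ∞ (fun x => g x i j) x :=
  (hg.smooth i j).contDiffAt (hg.isOpen.mem_nhds hx)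

theorem contDiffAt_det (hg : IsLorentzOn g D) (hx : x ∈ D) :
    ContDiffAt ℝ ∞ (fun x => (g x).det) x := by
  simp_rw [Matrix.det_fin_two]
  have := hg.contDiffAt hx
  exact ((this 0 0).mul (this 1 1)).sub ((this 0 1).mul (this 1 0))

theorem inv_apply (A : Matrix (Fin 2) (Fin 2) ℝ) (k l : Fin 2) :
    A⁻¹ k l = A.det⁻¹ * !![A 1 1, -A 0 1; -A 1 0, A 0 0] k l := by
  rw [Matrix.inv_def, Ring.inverse_eq_inv', Matrix.adjugate_fin_two]; rfl

theorem contDiffAt_christoffel (hg : IsLorentzOn g D) (hx : x ∈ D) (k i j : Fin 2) :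
    ContDiffAt ℝ ∞ (christoffel g k i j) x := by
  have h := hg.contDiffAt hx
  have hd := (hg.contDiffAt_det hx).inv (hg.det_neg x hx).ne
  have hp := fun l i j => contDiffAt_pd (i := l) (h i j)
  have hinv : ∀ l, ContDiffAt ℝ ∞ (fun x => (g x)⁻¹ k l) x := by
    intro l
    simp_rw [inv_apply]
    refine hd.mul ?_
    fin_cases k <;> fin_cases l <;> simp <;> first | exact h _ _ | exact (h _ _).neg
  unfold christoffel
  refine contDiffAt_const.mul (ContDiffAt.sum fun l _ => (hinv l).mul ?_)
  exact ((hp _ _ _).add (hp _ _ _)).sub (hp _ _ _)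

theorem pd_symm (hg : IsLorentzOn g D) (hx : x ∈ D) (l i j : Fin 2) :
    pd l (fun x => g x i j) x = pd l (fun x => g x j i) x :=
  pd_congr_of_isOpen hg.isOpen (fun y hy => hg.symm y hy i j) hx

theorem christoffel_symm (hg : IsLorentzOn g D) (hx : x ∈ D) (k i j : Fin 2) :
    christoffel g k i j x = christoffel g k j i x := by
  unfold christoffel
  congr 1
  refine Finset.sum_congr rfl fun l _ => ?_
  rw [hg.pd_symm hx l i j]; ring

/-- The Christoffel symbols of the first kind. -/
theorem lower_christoffel (hg : IsLorentzOn g D) (hx : x ∈ D) (k i j : Fin 2) :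
    ∑ m, g x k m * christoffel g m i j x = (1 / 2) *
      (pd i (fun x => g x j k) x + pd j (fun x => g x i k) x - pd k (fun x => g x i j) x) := by
  have hd : IsUnit (g x).det := (hg.det_neg x hx).ne.isUnit
  set c : Fin 2 → ℝ := fun l =>
    pd i (fun x => g x j l) x + pd j (fun x => g x i l) x - pd l (fun x => g x i j) x with hc
  have h1 : (fun m => christoffel g m i j x) = (1 / 2 : ℝ) • ((g x)⁻¹ *ᵥ c) := by
    ext m; rfl
  have h2 : g x *ᵥ (fun m => christoffel g m i j x) = (1 / 2 : ℝ) • c := by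
    rw [h1, Matrix.mulVec_smul, Matrix.mulVec_mulVec, Matrix.mul_nonsing_inv _ hd,
      Matrix.one_mulVec]
  exact congrFun h2 k

/-- The metric is parallel for its Levi-Civita connection. -/
theorem pd_metric (hg : IsLorentzOn g D) (hx : x ∈ D) (l i j : Fin 2) :
    pd l (fun x => g x i j) x = g x i 0 * christoffel g 0 l j x + g x i 1 * christoffel g 1 l j x
      + g x j 0 * christoffel g 0 l i x + g x j 1 * christoffel g 1 l i x := by
  have h1 := hg.lower_christoffel hx i l j
  have h2 := hg.lower_christoffel hx j l i
  rw [Fin.sum_univ_two] at h1 h2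
  rw [hg.pd_symm hx l j i, hg.pd_symm hx j l i] at h1
  rw [hg.pd_symm hx j l i] at h2
  linarith

end IsLorentzOn

/-- The scalar product of two vectors with respect to a coefficient matrix. -/
def ip {ι : Type*} [Fintype ι] (G : Matrix ι ι ℝ) (v w : ι → ℝ) : ℝ := v ⬝ᵥ (G *ᵥ w)

/-- The components of a map are smooth at the point `u`. -/
def SmoothAt {ι : Type*} (F : (Fin 2 → ℝ) → ι → ℝ) (u : Fin 2 → ℝ) : Prop :=
  ∀ k, ContDiffAt ℝ ∞ (fun w => F w k) u

theorem ip_fin_two (G : Matrix (Fin 2) (Fin 2) ℝ) (v w : Fin 2 → ℝ) :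
    ip G v w = v 0 * (G 0 0 * w 0 + G 0 1 * w 1) + v 1 * (G 1 0 * w 0 + G 1 1 * w 1) := by
  simp [ip, dotProduct, Matrix.mulVec, Fin.sum_univ_two]

section SmoothAt
variable {g : (Fin 2 → ℝ) → Matrix (Fin 2) (Fin 2) ℝ} {D : Set (Fin 2 → ℝ)}
  {f V W : (Fin 2 → ℝ) → Fin 2 → ℝ} {u : Fin 2 → ℝ}

theorem SmoothAt.contDiffAt {ι : Type*} [Fintype ι] {F : (Fin 2 → ℝ) → ι → ℝ}
    (hf : SmoothAt F u) : ContDiffAt ℝ ∞ F u :=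
  contDiffAt_pi.2 hf

theorem tangent_eq_fderiv {ι : Type*} [Fintype ι] [DecidableEq ι] {F : (Fin 2 → ℝ) → ι → ℝ}
    (hF : DifferentiableAt ℝ F u) (a : Fin 2) :
    CoordGeom.tangent F a u = fderiv ℝ F u (Pi.single a 1) := by
  ext k
  unfold CoordGeom.tangent pd
  rw [fderiv_apply hF k]; rfl

theorem SmoothAt.comp {φ : (Fin 2 → ℝ) → ℝ} (hφ : ContDiffAt ℝ ∞ φ (f u)) (hf : SmoothAt f u) :
    ContDiffAt ℝ ∞ (fun w => φ (f w)) u :=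
  ContDiffAt.comp u hφ hf.contDiffAt

theorem SmoothAt.differentiableAt {ι : Type*} {F : (Fin 2 → ℝ) → ι → ℝ}
    (hf : SmoothAt F u) (k : ι) : DifferentiableAt ℝ (fun w => F w k) u :=
  (hf k).differentiableAt (by simp)

theorem SmoothAt.tangent {ι : Type*} [Fintype ι] [DecidableEq ι] {F : (Fin 2 → ℝ) → ι → ℝ}
    (hf : SmoothAt F u) (a : Fin 2) : SmoothAt (CoordGeom.tangent F a) u :=
  fun k => contDiffAt_pd (hf k)

theorem SmoothAt.covDeriv (hg : IsLorentzOn g D) (hf : SmoothAt f u) (hu : f u ∈ D)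
    (hV : SmoothAt V u) (a : Fin 2) : SmoothAt (CoordGeom.covDeriv g f V a) u := by
  intro k
  refine (contDiffAt_pd (hV k)).add (ContDiffAt.sum fun i _ => ContDiffAt.sum fun j _ => ?_)
  exact ((hf.comp (hg.contDiffAt_christoffel hu k i j)).mul (hf.tangent a i)).mul (hV j)

theorem SmoothAt.ip (hg : IsLorentzOn g D) (hf : SmoothAt f u) (hu : f u ∈ D)
    (hV : SmoothAt V u) (hW : SmoothAt W u) :
    ContDiffAt ℝ ∞ (fun w => CoordGeom.ip (g (f w)) (V w) (W w)) u := by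
  simp_rw [ip_fin_two]
  have h := fun i j => hf.comp (hg.contDiffAt hu i j)
  exact ((hV 0).mul (((h _ _).mul (hW _)).add ((h _ _).mul (hW _)))).add
    ((hV 1).mul (((h _ _).mul (hW _)).add ((h _ _).mul (hW _))))

theorem covDeriv_apply (a k : Fin 2) : covDeriv g f V a u k = pd a (fun w => V w k) u
    + (christoffel g k 0 0 (f u) * tangent f a u 0 * V u 0
      + christoffel g k 0 1 (f u) * tangent f a u 0 * V u 1
      + (christoffel g k 1 0 (f u) * tangent f a u 1 * V u 0
      + christoffel g k 1 1 (f u) * tangent f a u 1 * V u 1)) := by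
  simp [covDeriv, Fin.sum_univ_two]

/-- The Levi-Civita connection is compatible with the metric. -/
theorem pd_ip (hg : IsLorentzOn g D) (hf : SmoothAt f u) (hu : f u ∈ D)
    (hV : SmoothAt V u) (hW : SmoothAt W u) (a : Fin 2) :
    pd a (fun w => ip (g (f w)) (V w) (W w)) u
      = ip (g (f u)) (covDeriv g f V a u) (W u) + ip (g (f u)) (V u) (covDeriv g f W a u) := by
  have hg' : ∀ i j, DifferentiableAt ℝ (fun x => g x i j) (f u) := fun i j =>
    (hg.contDiffAt hu i j).differentiableAt (by simp)
  have hgf : ∀ i j, DifferentiableAt ℝ (fun w => g (f w) i j) u := fun i j =>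
    (hf.comp (hg.contDiffAt hu i j)).differentiableAt (by simp)
  have hV' := hV.differentiableAt
  have hW' := hW.differentiableAt
  have hc : ∀ i j, pd a (fun w => g (f w) i j) u = _ := fun i j =>
    pd_comp (f := fun x => g x i j) (hg' i j) hf.differentiableAt
  simp_rw [ip_fin_two, covDeriv_apply]
  rw [pd_add, pd_mul, pd_mul, pd_add, pd_add, pd_mul, pd_mul, pd_mul, pd_mul]
  any_goals repeat' (first | exact hgf _ _ | exact hV' _ | exact hW' _ |
    apply DifferentiableAt.fun_add | apply DifferentiableAt.fun_mul)
  simp only [hc, Fin.sum_univ_two, hg.pd_metric hu, hg.symm _ hu 1 0]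
  unfold tangent
  ring

/-- The Levi-Civita connection is torsion free. -/
theorem covDeriv_tangent_comm (hg : IsLorentzOn g D) (hf : SmoothAt f u) (hu : f u ∈ D)
    (a b : Fin 2) : covDeriv g f (tangent f b) a u = covDeriv g f (tangent f a) b u := by
  ext k
  have : pd a (fun w => tangent f b w k) u = pd b (fun w => tangent f a w k) u := pd_comm (hf k)
  rw [covDeriv_apply, covDeriv_apply, this, hg.christoffel_symm hu k 1 0]
  ring

end SmoothAt
end CoordGeom

/-! ### The curvature tensor in two variables -/

namespace CoordGeom

section Curvature
variable {g : (Fin 2 → ℝ) → Matrix (Fin 2) (Fin 2) ℝ} {D : Set (Fin 2 → ℝ)}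
  {f V W : (Fin 2 → ℝ) → Fin 2 → ℝ} {u : Fin 2 → ℝ}

/-- The derivative of a component of a covariant derivative, by the product and chain rules. -/
theorem pd_covDeriv (hg : IsLorentzOn g D) (hf : SmoothAt f u) (hu : f u ∈ D)
    (hV : SmoothAt V u) (a b k : Fin 2) :
    pd a (fun w => covDeriv g f V b w k) u = pd a (pd b (fun w => V w k)) u
      + ∑ i, ∑ j, ((∑ l, pd l (christoffel g k i j) (f u) * tangent f a u l)
          * tangent f b u i * V u j
        + christoffel g k i j (f u) * pd a (fun w => tangent f b w i) u * V u j
        + christoffel g k i j (f u) * tangent f b u i * pd a (fun w => V w j) u) := by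
  have hc := fun k i j => hg.contDiffAt_christoffel hu k i j
  have h1 : ∀ i j, DifferentiableAt ℝ (fun w => christoffel g k i j (f w)) u := fun i j =>
    (hf.comp (hc k i j)).differentiableAt (by simp)
  have h2 : ∀ i, DifferentiableAt ℝ (fun w => tangent f b w i) u :=
    (hf.tangent b).differentiableAt
  have h3 := hV.differentiableAt
  have h4 : DifferentiableAt ℝ (fun w => pd b (fun w => V w k) w) u :=
    (contDiffAt_pd (hV k)).differentiableAt (by simp)
  have hcc : ∀ i j, pd a (fun w => christoffel g k i j (f w)) u
      = ∑ l, pd l (christoffel g k i j) (f u) * tangent f a u l := fun i j =>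
    pd_comp ((hc k i j).differentiableAt (by simp)) hf.differentiableAt
  have h5 : ∀ i j, pd a (fun w => christoffel g k i j (f w) * tangent f b w i * V w j) u
      = (∑ l, pd l (christoffel g k i j) (f u) * tangent f a u l)
          * tangent f b u i * V u j
        + christoffel g k i j (f u) * pd a (fun w => tangent f b w i) u * V u j
        + christoffel g k i j (f u) * tangent f b u i * pd a (fun w => V w j) u := by
    intro i j
    rw [pd_mul ((h1 i j).fun_mul (h2 i)) (h3 j), pd_mul (h1 i j) (h2 i), hcc]
    ring
  have h6 : ∀ i j, DifferentiableAt ℝ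
      (fun w => christoffel g k i j (f w) * tangent f b w i * V w j) u := fun i j =>
    ((h1 i j).fun_mul (h2 i)).fun_mul (h3 j)
  simp only [covDeriv_apply]
  rw [pd_add, pd_add, pd_add, pd_add]
  · simp only [h5, Fin.sum_univ_two]
  any_goals repeat' (first | exact h6 _ _ | exact h4 | apply DifferentiableAt.fun_add)

/-- The commutator of covariant derivatives along a map is given by the curvature tensor. -/
theorem covDeriv_commutator (hg : IsLorentzOn g D) (hf : SmoothAt f u) (hu : f u ∈ D)
    (hV : SmoothAt V u) (k : Fin 2) :
    covDeriv g f (covDeriv g f V 1) 0 u k - covDeriv g f (covDeriv g f V 0) 1 u k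
      = (tangent f 0 u 0 * tangent f 1 u 1 - tangent f 0 u 1 * tangent f 1 u 0) *
        (riemann g k 0 1 0 (f u) * V u 0 + riemann g k 0 1 1 (f u) * V u 1) := by
  have hs : ∀ i, pd 1 (fun w => tangent f 0 w i) u = pd 0 (fun w => tangent f 1 w i) u :=
    fun i => pd_comm (hf i)
  have hs' : pd 1 (pd 0 (fun w => V w k)) u = pd 0 (pd 1 (fun w => V w k)) u := pd_comm (hV k)
  have hsymm : ∀ m, christoffel g m 1 0 (f u) = christoffel g m 0 1 (f u) :=
    fun m => hg.christoffel_symm hu m 1 0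
  have hsymm' : ∀ l m, pd l (christoffel g m 1 0) (f u) = pd l (christoffel g m 0 1) (f u) :=
    fun l m => pd_congr_of_isOpen hg.isOpen (fun x hx => hg.christoffel_symm hx m 1 0) hu
  rw [covDeriv_apply _ k, covDeriv_apply _ k, pd_covDeriv hg hf hu hV, pd_covDeriv hg hf hu hV]
  simp only [covDeriv_apply, riemann, Fin.sum_univ_two, hs, hs', hsymm, hsymm']
  ring

/-- The commutator of covariant derivatives is skew for the metric. -/
theorem ip_commutator_skew (hg : IsLorentzOn g D) {U : Set (Fin 2 → ℝ)} (hU : IsOpen U)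
    (hf : ∀ u ∈ U, SmoothAt f u) (hfD : ∀ u ∈ U, f u ∈ D) (hV : ∀ u ∈ U, SmoothAt V u)
    (hW : ∀ u ∈ U, SmoothAt W u) (hu : u ∈ U) :
    ip (g (f u)) (covDeriv g f (covDeriv g f V 1) 0 u - covDeriv g f (covDeriv g f V 0) 1 u) (W u)
      + ip (g (f u)) (V u)
        (covDeriv g f (covDeriv g f W 1) 0 u - covDeriv g f (covDeriv g f W 0) 1 u) = 0 := by
  have key : ∀ a b, pd a (pd b fun w => ip (g (f w)) (V w) (W w)) u
      = ip (g (f u)) (covDeriv g f (covDeriv g f V b) a u) (W u)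
        + ip (g (f u)) (covDeriv g f V b u) (covDeriv g f W a u)
        + (ip (g (f u)) (covDeriv g f V a u) (covDeriv g f W b u)
        + ip (g (f u)) (V u) (covDeriv g f (covDeriv g f W b) a u)) := by
    intro a b
    have hV' := SmoothAt.covDeriv hg (hf u hu) (hfD u hu) (hV u hu) b
    have hW' := SmoothAt.covDeriv hg (hf u hu) (hfD u hu) (hW u hu) b
    rw [pd_congr_of_isOpen hU (fun w hw => pd_ip hg (hf w hw) (hfD w hw) (hV w hw) (hW w hw) b) hu,
      pd_add, pd_ip hg (hf u hu) (hfD u hu) hV' (hW u hu),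
      pd_ip hg (hf u hu) (hfD u hu) (hV u hu) hW']
    · exact (SmoothAt.ip hg (hf u hu) (hfD u hu) hV' (hW u hu)).differentiableAt (by simp)
    · exact (SmoothAt.ip hg (hf u hu) (hfD u hu) (hV u hu) hW').differentiableAt (by simp)
  have hc := pd_comm (i := 0) (j := 1) (SmoothAt.ip hg (hf u hu) (hfD u hu) (hV u hu) (hW u hu))
  rw [key, key] at hc
  simp only [ip_fin_two, Pi.sub_apply] at hc ⊢
  linarith

/-- The curvature operator `R(∂₀, ∂₁)` is skew for the metric. -/
theorem riemann_skew (hg : IsLorentzOn g D) {x : Fin 2 → ℝ} (hx : x ∈ D) (i j : Fin 2) :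
    (∑ l, g x l j * riemann g l 0 1 i x) + ∑ l, g x i l * riemann g l 0 1 j x = 0 := by
  have hid : ∀ x : Fin 2 → ℝ, SmoothAt (fun x : Fin 2 → ℝ => x) x := fun x k =>
    contDiffAt_apply (n := ∞) ℝ ℝ k x
  have hconst : ∀ (v : Fin 2 → ℝ) (x : Fin 2 → ℝ), SmoothAt (fun _ => v) x :=
    fun v x k => contDiffAt_const
  have h := ip_commutator_skew (f := fun x => x) hg hg.isOpen (fun x _ => hid x) (fun x hx => hx)
    (fun x _ => hconst (Pi.single i 1) x) (fun x _ => hconst (Pi.single j 1) x) hx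
  have hc := fun v k => covDeriv_commutator (f := fun x => x) hg (hid x) hx (hconst v x) k
  simp only [ip_fin_two, Pi.sub_apply, hc, tangent, pd_apply] at h
  rw [Fin.sum_univ_two, Fin.sum_univ_two]
  fin_cases i <;> fin_cases j <;> simp at h ⊢ <;> linarith

/-- The curvature operator of a Lorentzian surface is `R(∂₀, ∂₁) = κ ω(∂₀, ∂₁) j`, with
`ω(∂₀, ∂₁) = -√(-det g)`. -/
theorem riemann_eq (hg : IsLorentzOn g D) {x : Fin 2 → ℝ} (hx : x ∈ D) (k i : Fin 2) :
    riemann g k 0 1 i x = -(gaussCurvature g x * Real.sqrt (-(g x).det)) *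
      paracomplex (g x) k i := by
  have hd := hg.det_neg x hx
  have hs : Real.sqrt (-(g x).det) ≠ 0 := (Real.sqrt_pos.2 (by linarith)).ne'
  have h00 := riemann_skew hg hx 0 0
  have h01 := riemann_skew hg hx 0 1
  have h11 := riemann_skew hg hx 1 1
  have hsy := hg.symm x hx 1 0
  have hp : Real.sqrt (-(g x).det) * paracomplex (g x) k i
      = !![-g x 0 1, -g x 1 1; g x 0 0, g x 0 1] k i := by
    rw [paracomplex, Matrix.smul_apply, smul_eq_mul, mul_inv_cancel_left₀ hs]
  rw [neg_mul, mul_assoc, hp, gaussCurvature, ← neg_eq_iff_eq_neg, eq_comm, div_mul_eq_mul_div,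
    div_eq_iff hd.ne]
  rw [Matrix.det_fin_two] at *
  simp only [Fin.sum_univ_two, hsy] at *
  fin_cases k <;> fin_cases i <;> simp
  · linear_combination g x 0 1 * h01 - g x 1 1 / 2 * h00
  · linear_combination g x 0 1 / 2 * h11
  · linear_combination g x 0 0 * h01 - g x 0 1 / 2 * h00
  · linear_combination g x 0 0 / 2 * h11

end Curvature
end CoordGeom

/-! ### The paracomplex structure -/

namespace CoordGeom

section Paracomplex

theorem paracomplex_mulVec_zero (G : Matrix (Fin 2) (Fin 2) ℝ) (v : Fin 2 → ℝ) :
    (paracomplex G *ᵥ v) 0 = (Real.sqrt (-G.det))⁻¹ * (-G 0 1 * v 0 + -G 1 1 * v 1) := by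
  simp [paracomplex, Matrix.mulVec, dotProduct, Fin.sum_univ_two]; ring

theorem paracomplex_mulVec_one (G : Matrix (Fin 2) (Fin 2) ℝ) (v : Fin 2 → ℝ) :
    (paracomplex G *ᵥ v) 1 = (Real.sqrt (-G.det))⁻¹ * (G 0 0 * v 0 + G 0 1 * v 1) := by
  simp [paracomplex, Matrix.mulVec, dotProduct, Fin.sum_univ_two]; ring

theorem inv_sqrt_sq {G : Matrix (Fin 2) (Fin 2) ℝ} (hG : G.det < 0) :
    (Real.sqrt (-G.det))⁻¹ * (Real.sqrt (-G.det))⁻¹ * G.det = -1 := by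
  have h : 0 < -G.det := by linarith
  have h1 := Real.mul_self_sqrt h.le
  have h2 := (Real.sqrt_pos.2 h).ne'
  field_simp
  linarith

theorem paracomplex_paracomplex {G : Matrix (Fin 2) (Fin 2) ℝ} (hG : G.det < 0)
    (hs : G 1 0 = G 0 1) (v : Fin 2 → ℝ) : paracomplex G *ᵥ (paracomplex G *ᵥ v) = v := by
  have h := inv_sqrt_sq hG
  set s := (Real.sqrt (-G.det))⁻¹ with hsdef
  rw [Matrix.det_fin_two, hs] at h
  ext k
  fin_cases k
  · simp only [Fin.zero_eta, paracomplex_mulVec_zero, paracomplex_mulVec_one, ← hsdef]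
    linear_combination -(v 0) * h
  · simp only [Fin.mk_one, paracomplex_mulVec_zero, paracomplex_mulVec_one, ← hsdef]
    linear_combination -(v 1) * h

theorem ip_paracomplex {G : Matrix (Fin 2) (Fin 2) ℝ} (hs : G 1 0 = G 0 1) (v w : Fin 2 → ℝ) :
    ip G (paracomplex G *ᵥ v) w
      = (Real.sqrt (-G.det))⁻¹ * (G.det * (v 0 * w 1 - v 1 * w 0)) := by
  rw [ip_fin_two, paracomplex_mulVec_zero, paracomplex_mulVec_one, Matrix.det_fin_two, hs]
  ring

theorem ip_comm {G : Matrix (Fin 2) (Fin 2) ℝ} (hs : G 1 0 = G 0 1) (v w : Fin 2 → ℝ) :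
    ip G v w = ip G w v := by
  rw [ip_fin_two, ip_fin_two, hs]; ring

theorem ip_paracomplex_right {G : Matrix (Fin 2) (Fin 2) ℝ} (hs : G 1 0 = G 0 1)
    (v w : Fin 2 → ℝ) : ip G v (paracomplex G *ᵥ w) = -ip G (paracomplex G *ᵥ v) w := by
  rw [ip_comm hs, ip_paracomplex hs, ip_paracomplex hs]; ring

/-- The Gram determinant of two vectors, in terms of the area form `ω = g(j·, ·)`. -/
theorem gram_eq_neg_sq {G : Matrix (Fin 2) (Fin 2) ℝ} (hG : G.det < 0) (hs : G 1 0 = G 0 1)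
    (v w : Fin 2 → ℝ) :
    ip G v v * ip G w w - ip G v w ^ 2 = -(ip G (paracomplex G *ᵥ v) w) ^ 2 := by
  rw [ip_paracomplex hs, ip_fin_two, ip_fin_two, ip_fin_two]
  have h := inv_sqrt_sq hG
  set s := (Real.sqrt (-G.det))⁻¹
  rw [Matrix.det_fin_two, hs] at h
  rw [Matrix.det_fin_two, hs]
  linear_combination ((G 0 0 * G 1 1 - G 0 1 * G 0 1) * (v 0 * w 1 - v 1 * w 0) ^ 2) * h

theorem ip_kaehlerForm (G : Matrix (Fin 2) (Fin 2) ℝ) (v w : Fin 2 → ℝ) :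
    v ⬝ᵥ (kaehlerForm G *ᵥ w) = ip G (paracomplex G *ᵥ v) w := by
  rw [ip, kaehlerForm, ← Matrix.mulVec_mulVec, Matrix.dotProduct_mulVec, Matrix.vecMul_transpose]

variable {g : (Fin 2 → ℝ) → Matrix (Fin 2) (Fin 2) ℝ} {D : Set (Fin 2 → ℝ)}
  {f V W : (Fin 2 → ℝ) → Fin 2 → ℝ} {u : Fin 2 → ℝ}

theorem IsLorentzOn.contDiffAt_inv_sqrt {x : Fin 2 → ℝ} (hg : IsLorentzOn g D) (hx : x ∈ D) :
    ContDiffAt ℝ ∞ (fun x => (Real.sqrt (-(g x).det))⁻¹) x := by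
  have h : 0 < -(g x).det := by linarith [hg.det_neg x hx]
  exact ((hg.contDiffAt_det hx).neg.sqrt h.ne').inv (Real.sqrt_pos.2 h).ne'

theorem SmoothAt.paracomplex (hg : IsLorentzOn g D) (hf : SmoothAt f u) (hu : f u ∈ D)
    (hV : SmoothAt V u) : SmoothAt (fun w => CoordGeom.paracomplex (g (f w)) *ᵥ V w) u := by
  have h := fun i j => hf.comp (hg.contDiffAt hu i j)
  have hs := hf.comp (hg.contDiffAt_inv_sqrt hu)
  intro k
  fin_cases k
  · simp only [Fin.zero_eta, paracomplex_mulVec_zero]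
    exact hs.mul (((h _ _).neg.mul (hV _)).add ((h _ _).neg.mul (hV _)))
  · simp only [Fin.mk_one, paracomplex_mulVec_one]
    exact hs.mul (((h _ _).mul (hV _)).add ((h _ _).mul (hV _)))

/-- The derivative of the coefficient `1 / √(-det g)`; it follows by differentiating
`(1 / √(-det g))² det g = -1`. -/
theorem pd_inv_sqrt (hg : IsLorentzOn g D) (hf : SmoothAt f u) (hu : f u ∈ D) (a : Fin 2) :
    pd a (fun w => (Real.sqrt (-(g (f w)).det))⁻¹) u = -(Real.sqrt (-(g (f u)).det))⁻¹ *
      ∑ i, ∑ l, christoffel g i l i (f u) * tangent f a u l := by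
  have hd := hg.det_neg _ hu
  have hs0 : (Real.sqrt (-(g (f u)).det))⁻¹ ≠ 0 :=
    inv_ne_zero (Real.sqrt_pos.2 (by linarith)).ne'
  have hsd : DifferentiableAt ℝ (fun w => (Real.sqrt (-(g (f w)).det))⁻¹) u :=
    (hf.comp (hg.contDiffAt_inv_sqrt hu)).differentiableAt (by simp)
  have hgf : ∀ i j, DifferentiableAt ℝ (fun w => g (f w) i j) u := fun i j =>
    (hf.comp (hg.contDiffAt hu i j)).differentiableAt (by simp)
  have hc : ∀ i j, pd a (fun w => g (f w) i j) u = _ := fun i j =>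
    pd_comp (f := fun x => g x i j) ((hg.contDiffAt hu i j).differentiableAt (by simp))
      hf.differentiableAt
  have hdd : DifferentiableAt ℝ (fun w => (g (f w)).det) u :=
    (hf.comp (hg.contDiffAt_det hu)).differentiableAt (by simp)
  have hdet : pd a (fun w => (g (f w)).det) u = 2 * (g (f u)).det *
      ∑ i, ∑ l, christoffel g i l i (f u) * tangent f a u l := by
    simp only [Matrix.det_fin_two]
    rw [pd_sub ((hgf _ _).fun_mul (hgf _ _)) ((hgf _ _).fun_mul (hgf _ _)),
      pd_mul (hgf _ _) (hgf _ _), pd_mul (hgf _ _) (hgf _ _)]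
    simp only [hc, Fin.sum_univ_two, hg.pd_metric hu, hg.symm _ hu 1 0]
    unfold tangent
    ring
  have hone : pd a (fun w => (Real.sqrt (-(g (f w)).det))⁻¹ * (Real.sqrt (-(g (f w)).det))⁻¹
      * (g (f w)).det) u = 0 := by
    rw [← pd_const a (-1) u]
    refine pd_congr ?_
    filter_upwards [hf.contDiffAt.continuousAt.preimage_mem_nhds (hg.isOpen.mem_nhds hu)] with w hw
    exact inv_sqrt_sq (hg.det_neg _ hw)
  rw [pd_mul (hsd.fun_mul hsd) hdd, pd_mul hsd hsd, hdet] at hone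
  have : 2 * (Real.sqrt (-(g (f u)).det))⁻¹ * (g (f u)).det ≠ 0 :=
    mul_ne_zero (mul_ne_zero two_ne_zero hs0) hd.ne
  apply mul_left_cancel₀ this
  linear_combination hone

/-- The paracomplex structure of an oriented Lorentzian surface is parallel. -/
theorem covDeriv_paracomplex (hg : IsLorentzOn g D) (hf : SmoothAt f u) (hu : f u ∈ D)
    (hV : SmoothAt V u) (a : Fin 2) :
    covDeriv g f (fun w => paracomplex (g (f w)) *ᵥ V w) a u
      = paracomplex (g (f u)) *ᵥ covDeriv g f V a u := by
  have hsd : DifferentiableAt ℝ (fun w => (Real.sqrt (-(g (f w)).det))⁻¹) u :=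
    (hf.comp (hg.contDiffAt_inv_sqrt hu)).differentiableAt (by simp)
  have hgf : ∀ i j, DifferentiableAt ℝ (fun w => g (f w) i j) u := fun i j =>
    (hf.comp (hg.contDiffAt hu i j)).differentiableAt (by simp)
  have hc : ∀ i j, pd a (fun w => g (f w) i j) u = _ := fun i j =>
    pd_comp (f := fun x => g x i j) ((hg.contDiffAt hu i j).differentiableAt (by simp))
      hf.differentiableAt
  have hV' := hV.differentiableAt
  have hs := pd_inv_sqrt hg hf hu a
  ext k
  fin_cases k
  · simp only [Fin.zero_eta, covDeriv_apply, paracomplex_mulVec_zero, paracomplex_mulVec_one]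
    rw [pd_mul, pd_add, pd_mul, pd_mul, pd_neg, pd_neg, hs]
    · simp only [hc, Fin.sum_univ_two, hg.pd_metric hu, hg.symm _ hu 1 0]
      unfold tangent
      ring
    all_goals repeat' (first | exact hgf _ _ | exact hV' _ | exact hsd | apply DifferentiableAt.fun_neg |
      apply DifferentiableAt.fun_add | apply DifferentiableAt.fun_mul)
  · simp only [Fin.mk_one, covDeriv_apply, paracomplex_mulVec_zero, paracomplex_mulVec_one]
    rw [pd_mul, pd_add, pd_mul, pd_mul, hs]
    · simp only [hc, Fin.sum_univ_two, hg.pd_metric hu, hg.symm _ hu 1 0]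
      unfold tangent
      ring
    all_goals repeat' (first | exact hgf _ _ | exact hV' _ | exact hsd | apply DifferentiableAt.fun_neg |
      apply DifferentiableAt.fun_add | apply DifferentiableAt.fun_mul)

/-- The commutator of covariant derivatives along a map is `κ f^*ω j`. -/
theorem covDeriv_commutator_eq (hg : IsLorentzOn g D) (hf : SmoothAt f u) (hu : f u ∈ D)
    (hV : SmoothAt V u) :
    covDeriv g f (covDeriv g f V 1) 0 u - covDeriv g f (covDeriv g f V 0) 1 u
      = (gaussCurvature g (f u) * ip (g (f u)) (paracomplex (g (f u)) *ᵥ tangent f 0 u)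
          (tangent f 1 u)) • (paracomplex (g (f u)) *ᵥ V u) := by
  have hd : 0 < -(g (f u)).det := by linarith [hg.det_neg _ hu]
  have h1 : (Real.sqrt (-(g (f u)).det))⁻¹ * (g (f u)).det = -Real.sqrt (-(g (f u)).det) := by
    have h1 := Real.mul_self_sqrt hd.le
    have h2 := (Real.sqrt_pos.2 hd).ne'
    field_simp
    linarith
  ext k
  rw [Pi.sub_apply, covDeriv_commutator hg hf hu hV, riemann_eq hg hu, riemann_eq hg hu,
    ip_paracomplex (hg.symm _ hu 1 0), ← mul_assoc (Real.sqrt _)⁻¹, h1]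
  simp only [Pi.smul_apply, smul_eq_mul, Matrix.mulVec, dotProduct, Fin.sum_univ_two]
  ring

end Paracomplex
end CoordGeom

/-! ### Products of Lorentzian surfaces -/

namespace CoordGeom

section Product

/-- The first two components of a vector in product coordinates. -/
def fstPart (v : Fin 2 ⊕ Fin 2 → ℝ) : Fin 2 → ℝ := v ∘ Sum.inl

/-- The last two components of a vector in product coordinates. -/
def sndPart (v : Fin 2 ⊕ Fin 2 → ℝ) : Fin 2 → ℝ := v ∘ Sum.inr

theorem ext_parts {v w : Fin 2 ⊕ Fin 2 → ℝ} (h₁ : fstPart v = fstPart w)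
    (h₂ : sndPart v = sndPart w) : v = w := by
  ext k
  rcases k with k | k
  · exact congrFun h₁ k
  · exact congrFun h₂ k

variable {ε : ℝ} {g₁ g₂ : (Fin 2 → ℝ) → Matrix (Fin 2) (Fin 2) ℝ} {D₁ D₂ : Set (Fin 2 → ℝ)}
  {F V W : (Fin 2 → ℝ) → Fin 2 ⊕ Fin 2 → ℝ} {u : Fin 2 → ℝ} {x : Fin 2 ⊕ Fin 2 → ℝ}

theorem pd_comp_inl {φ : (Fin 2 → ℝ) → ℝ} (hφ : DifferentiableAt ℝ φ (x ∘ Sum.inl)) (l : Fin 2) :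
    pd (Sum.inl l) (fun y : Fin 2 ⊕ Fin 2 → ℝ => φ (y ∘ Sum.inl)) x = pd l φ (x ∘ Sum.inl) ∧
    pd (Sum.inr l) (fun y : Fin 2 ⊕ Fin 2 → ℝ => φ (y ∘ Sum.inl)) x = 0 := by
  have h : ∀ k : Fin 2, DifferentiableAt ℝ (fun y : Fin 2 ⊕ Fin 2 → ℝ => (y ∘ Sum.inl) k) x :=
    fun k => differentiableAt_apply _ _
  constructor
  · rw [pd_comp hφ h]; simp [pd_apply]
  · rw [pd_comp hφ h]; simp [pd_apply]

theorem pd_comp_inr {φ : (Fin 2 → ℝ) → ℝ} (hφ : DifferentiableAt ℝ φ (x ∘ Sum.inr)) (l : Fin 2) :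
    pd (Sum.inr l) (fun y : Fin 2 ⊕ Fin 2 → ℝ => φ (y ∘ Sum.inr)) x = pd l φ (x ∘ Sum.inr) ∧
    pd (Sum.inl l) (fun y : Fin 2 ⊕ Fin 2 → ℝ => φ (y ∘ Sum.inr)) x = 0 := by
  have h : ∀ k : Fin 2, DifferentiableAt ℝ (fun y : Fin 2 ⊕ Fin 2 → ℝ => (y ∘ Sum.inr) k) x :=
    fun k => differentiableAt_apply _ _
  constructor
  · rw [pd_comp hφ h]; simp [pd_apply]
  · rw [pd_comp hφ h]; simp [pd_apply]

theorem inv_prodMetric (hε : ε * ε = 1) (h₁ : (g₁ (x ∘ Sum.inl)).det ≠ 0)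
    (h₂ : (g₂ (x ∘ Sum.inr)).det ≠ 0) : (prodMetric ε g₁ g₂ x)⁻¹ =
      Matrix.fromBlocks (g₁ (x ∘ Sum.inl))⁻¹ 0 0 (ε • (g₂ (x ∘ Sum.inr))⁻¹) := by
  apply Matrix.inv_eq_right_inv
  rw [prodMetric, Matrix.fromBlocks_multiply]
  simp [Matrix.mul_nonsing_inv _ h₁.isUnit, Matrix.mul_nonsing_inv _ h₂.isUnit, smul_smul, hε]

/-- The Levi-Civita connection of a product metric is the product connection. -/
theorem christoffel_prodMetric (hε : ε * ε = 1) (hg₁ : IsLorentzOn g₁ D₁)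
    (hg₂ : IsLorentzOn g₂ D₂) (hx₁ : x ∘ Sum.inl ∈ D₁) (hx₂ : x ∘ Sum.inr ∈ D₂)
    (k i j : Fin 2) :
    christoffel (prodMetric ε g₁ g₂) (.inl k) (.inl i) (.inl j) x
        = christoffel g₁ k i j (x ∘ Sum.inl) ∧
    christoffel (prodMetric ε g₁ g₂) (.inl k) (.inl i) (.inr j) x = 0 ∧
    christoffel (prodMetric ε g₁ g₂) (.inl k) (.inr i) (.inl j) x = 0 ∧
    christoffel (prodMetric ε g₁ g₂) (.inl k) (.inr i) (.inr j) x = 0 ∧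
    christoffel (prodMetric ε g₁ g₂) (.inr k) (.inl i) (.inl j) x = 0 ∧
    christoffel (prodMetric ε g₁ g₂) (.inr k) (.inl i) (.inr j) x = 0 ∧
    christoffel (prodMetric ε g₁ g₂) (.inr k) (.inr i) (.inl j) x = 0 ∧
    christoffel (prodMetric ε g₁ g₂) (.inr k) (.inr i) (.inr j) x
        = christoffel g₂ k i j (x ∘ Sum.inr) := by
  have h₁ : ∀ i j, DifferentiableAt ℝ (fun y => g₁ y i j) (x ∘ Sum.inl) :=
    fun i j => (hg₁.contDiffAt hx₁ i j).differentiableAt (by simp)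
  have h₂ : ∀ i j, DifferentiableAt ℝ (fun y => g₂ y i j) (x ∘ Sum.inr) :=
    fun i j => (hg₂.contDiffAt hx₂ i j).differentiableAt (by simp)
  have e₁ : ∀ i j, (fun y => prodMetric ε g₁ g₂ y (.inl i) (.inl j))
      = fun y => g₁ (y ∘ Sum.inl) i j := fun i j => rfl
  have e₂ : ∀ i j, (fun y => prodMetric ε g₁ g₂ y (.inr i) (.inr j))
      = fun y => ε * g₂ (y ∘ Sum.inr) i j := fun i j => rfl
  have e₃ : ∀ i j, (fun y => prodMetric ε g₁ g₂ y (.inl i) (.inr j)) = fun y => 0 :=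
    fun i j => rfl
  have e₄ : ∀ i j, (fun y => prodMetric ε g₁ g₂ y (.inr i) (.inl j)) = fun y => 0 :=
    fun i j => rfl
  have d₂ : ∀ i j, DifferentiableAt ℝ (fun y : Fin 2 ⊕ Fin 2 → ℝ => g₂ (y ∘ Sum.inr) i j) x :=
    fun i j => (h₂ i j).comp x (f := fun y : Fin 2 ⊕ Fin 2 → ℝ => y ∘ Sum.inr) (by fun_prop)
  have p₂ : ∀ l i j, pd l (fun y : Fin 2 ⊕ Fin 2 → ℝ => ε * g₂ (y ∘ Sum.inr) i j) x
      = ε * pd l (fun y : Fin 2 ⊕ Fin 2 → ℝ => g₂ (y ∘ Sum.inr) i j) x :=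
    fun l i j => pd_const_mul ε (d₂ i j)
  have q₁ := fun i j => pd_comp_inl (h₁ i j)
  have q₂ := fun i j => pd_comp_inr (h₂ i j)
  have hinv := inv_prodMetric hε (hg₁.det_neg _ hx₁).ne (hg₂.det_neg _ hx₂).ne
  have hε' : ∀ a b : ℝ, ε * a * (ε * b) = a * b := fun a b => by linear_combination a * b * hε
  refine ⟨?_, ?_, ?_, ?_, ?_, ?_, ?_, ?_⟩ <;>
  simp [christoffel, Fintype.sum_sum_type, hinv, e₁, e₂, e₃, e₄, p₂, q₁, q₂, pd_const,
    ← mul_add, ← mul_sub, hε']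

theorem fstPart_covDeriv (hε : ε * ε = 1) (hg₁ : IsLorentzOn g₁ D₁)
    (hg₂ : IsLorentzOn g₂ D₂) (hx₁ : fstPart (F u) ∈ D₁) (hx₂ : sndPart (F u) ∈ D₂)
    (a : Fin 2) : fstPart (covDeriv (prodMetric ε g₁ g₂) F V a u)
      = covDeriv g₁ (fun w => fstPart (F w)) (fun w => fstPart (V w)) a u := by
  have h := christoffel_prodMetric hε hg₁ hg₂ hx₁ hx₂
  ext k
  simp [fstPart, covDeriv, Fintype.sum_sum_type, h, tangent]

theorem sndPart_covDeriv (hε : ε * ε = 1) (hg₁ : IsLorentzOn g₁ D₁)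
    (hg₂ : IsLorentzOn g₂ D₂) (hx₁ : fstPart (F u) ∈ D₁) (hx₂ : sndPart (F u) ∈ D₂)
    (a : Fin 2) : sndPart (covDeriv (prodMetric ε g₁ g₂) F V a u)
      = covDeriv g₂ (fun w => sndPart (F w)) (fun w => sndPart (V w)) a u := by
  have h := christoffel_prodMetric hε hg₁ hg₂ hx₁ hx₂
  ext k
  simp [sndPart, covDeriv, Fintype.sum_sum_type, h, tangent]

theorem ip_prodMetric (v w : Fin 2 ⊕ Fin 2 → ℝ) : ip (prodMetric ε g₁ g₂ x) v w
    = ip (g₁ (fstPart x)) (fstPart v) (fstPart w)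
      + ε * ip (g₂ (sndPart x)) (sndPart v) (sndPart w) := by
  simp [ip, prodMetric, dotProduct, Matrix.mulVec, Fintype.sum_sum_type, fstPart, sndPart]
  ring

/-- The product paracomplex structure `J = j₁ ⊕ j₂` in product coordinates. -/
def prodJ (g₁ g₂ : (Fin 2 → ℝ) → Matrix (Fin 2) (Fin 2) ℝ) (x v : Fin 2 ⊕ Fin 2 → ℝ) :
    Fin 2 ⊕ Fin 2 → ℝ :=
  Sum.elim (paracomplex (g₁ (fstPart x)) *ᵥ fstPart v) (paracomplex (g₂ (sndPart x)) *ᵥ sndPart v)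

@[simp] theorem fstPart_prodJ (v : Fin 2 ⊕ Fin 2 → ℝ) :
    fstPart (prodJ g₁ g₂ x v) = paracomplex (g₁ (fstPart x)) *ᵥ fstPart v := rfl

@[simp] theorem sndPart_prodJ (v : Fin 2 ⊕ Fin 2 → ℝ) :
    sndPart (prodJ g₁ g₂ x v) = paracomplex (g₂ (sndPart x)) *ᵥ sndPart v := rfl

@[simp] theorem fstPart_sub (v w : Fin 2 ⊕ Fin 2 → ℝ) :
    fstPart (v - w) = fstPart v - fstPart w := rfl

@[simp] theorem sndPart_sub (v w : Fin 2 ⊕ Fin 2 → ℝ) :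
    sndPart (v - w) = sndPart v - sndPart w := rfl

@[simp] theorem fstPart_smul (c : ℝ) (v : Fin 2 ⊕ Fin 2 → ℝ) :
    fstPart (c • v) = c • fstPart v := rfl

@[simp] theorem sndPart_smul (c : ℝ) (v : Fin 2 ⊕ Fin 2 → ℝ) :
    sndPart (c • v) = c • sndPart v := rfl

theorem prodJ_smul (c : ℝ) (v : Fin 2 ⊕ Fin 2 → ℝ) :
    prodJ g₁ g₂ x (c • v) = c • prodJ g₁ g₂ x v :=
  ext_parts (by simp [Matrix.mulVec_smul]) (by simp [Matrix.mulVec_smul])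

section ip
variable {ι : Type*} [Fintype ι] (G : Matrix ι ι ℝ)

theorem ip_add_left (v v' w : ι → ℝ) : ip G (v + v') w = ip G v w + ip G v' w := by
  simp [ip, add_dotProduct]

theorem ip_sub_left (v v' w : ι → ℝ) : ip G (v - v') w = ip G v w - ip G v' w := by
  simp [ip, sub_dotProduct]

theorem ip_add_right (v w w' : ι → ℝ) : ip G v (w + w') = ip G v w + ip G v w' := by
  simp [ip, Matrix.mulVec_add, dotProduct_add]

theorem ip_smul_left (c : ℝ) (v w : ι → ℝ) : ip G (c • v) w = c * ip G v w := by
  simp [ip, smul_dotProduct]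

theorem ip_smul_right (c : ℝ) (v w : ι → ℝ) : ip G v (c • w) = c * ip G v w := by
  simp [ip, Matrix.mulVec_smul, dotProduct_smul]

end ip

theorem smoothAt_iff_parts : SmoothAt V u ↔
    SmoothAt (fun w => fstPart (V w)) u ∧ SmoothAt (fun w => sndPart (V w)) u := by
  constructor
  · exact fun h => ⟨fun k => h (.inl k), fun k => h (.inr k)⟩
  · rintro ⟨h₁, h₂⟩ (k | k)
    exacts [h₁ k, h₂ k]

theorem SmoothAt.congr {ι : Type*} {V W : (Fin 2 → ℝ) → ι → ℝ} {u : Fin 2 → ℝ}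
    (hV : SmoothAt V u) (h : W =ᶠ[𝓝 u] V) : SmoothAt W u :=
  fun k => (hV k).congr_of_eventuallyEq (h.mono fun _ hw => congrFun hw k)

variable (ε g₁ g₂ D₁ D₂ F) in
/-- `F` is a smooth parametrized surface, defined on the open set `U` of parameters, in the
product of the coordinate domains `D₁` and `D₂` with the metric `g₁ + ε g₂`. -/
structure IsProdSurface (U : Set (Fin 2 → ℝ)) : Prop where
  sign : ε * ε = 1
  fst : IsLorentzOn g₁ D₁
  snd : IsLorentzOn g₂ D₂
  isOpen : IsOpen U
  smooth : ∀ u ∈ U, SmoothAt F u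
  fst_mem : ∀ u ∈ U, fstPart (F u) ∈ D₁
  snd_mem : ∀ u ∈ U, sndPart (F u) ∈ D₂

namespace IsProdSurface
variable {U : Set (Fin 2 → ℝ)}

theorem smooth_fst (h : IsProdSurface ε g₁ g₂ D₁ D₂ F U) (hu : u ∈ U) :
    SmoothAt (fun w => fstPart (F w)) u := (smoothAt_iff_parts.1 (h.smooth u hu)).1

theorem smooth_snd (h : IsProdSurface ε g₁ g₂ D₁ D₂ F U) (hu : u ∈ U) :
    SmoothAt (fun w => sndPart (F w)) u := (smoothAt_iff_parts.1 (h.smooth u hu)).2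

theorem eventually (h : IsProdSurface ε g₁ g₂ D₁ D₂ F U) (hu : u ∈ U) : ∀ᶠ w in 𝓝 u, w ∈ U :=
  h.isOpen.mem_nhds hu

theorem fstPart_covDeriv (h : IsProdSurface ε g₁ g₂ D₁ D₂ F U) (hu : u ∈ U) (a : Fin 2) :
    fstPart (covDeriv (prodMetric ε g₁ g₂) F V a u)
      = covDeriv g₁ (fun w => fstPart (F w)) (fun w => fstPart (V w)) a u :=
  CoordGeom.fstPart_covDeriv h.sign h.fst h.snd (h.fst_mem u hu) (h.snd_mem u hu) a

theorem sndPart_covDeriv (h : IsProdSurface ε g₁ g₂ D₁ D₂ F U) (hu : u ∈ U) (a : Fin 2) :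
    sndPart (covDeriv (prodMetric ε g₁ g₂) F V a u)
      = covDeriv g₂ (fun w => sndPart (F w)) (fun w => sndPart (V w)) a u :=
  CoordGeom.sndPart_covDeriv h.sign h.fst h.snd (h.fst_mem u hu) (h.snd_mem u hu) a

theorem smoothAt_covDeriv (h : IsProdSurface ε g₁ g₂ D₁ D₂ F U) (hu : u ∈ U)
    (hV : SmoothAt V u) (a : Fin 2) : SmoothAt (covDeriv (prodMetric ε g₁ g₂) F V a) u := by
  obtain ⟨h₁, h₂⟩ := smoothAt_iff_parts.1 hV
  rw [smoothAt_iff_parts]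
  refine ⟨(SmoothAt.covDeriv h.fst (h.smooth_fst hu) (h.fst_mem u hu) h₁ a).congr ?_,
    (SmoothAt.covDeriv h.snd (h.smooth_snd hu) (h.snd_mem u hu) h₂ a).congr ?_⟩
  · filter_upwards [h.eventually hu] with _ hw using h.fstPart_covDeriv hw a
  · filter_upwards [h.eventually hu] with w hw using h.sndPart_covDeriv hw a

theorem smoothAt_prodJ (h : IsProdSurface ε g₁ g₂ D₁ D₂ F U) (hu : u ∈ U)
    (hV : SmoothAt V u) : SmoothAt (fun w => prodJ g₁ g₂ (F w) (V w)) u := by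
  obtain ⟨h₁, h₂⟩ := smoothAt_iff_parts.1 hV
  exact smoothAt_iff_parts.2
    ⟨SmoothAt.paracomplex h.fst (h.smooth_fst hu) (h.fst_mem u hu) h₁,
      SmoothAt.paracomplex h.snd (h.smooth_snd hu) (h.snd_mem u hu) h₂⟩

theorem contDiffAt_ip (h : IsProdSurface ε g₁ g₂ D₁ D₂ F U) (hu : u ∈ U)
    (hV : SmoothAt V u) (hW : SmoothAt W u) :
    ContDiffAt ℝ ∞ (fun w => ip (prodMetric ε g₁ g₂ (F w)) (V w) (W w)) u := by
  obtain ⟨h₁, h₂⟩ := smoothAt_iff_parts.1 hV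
  obtain ⟨k₁, k₂⟩ := smoothAt_iff_parts.1 hW
  simp_rw [ip_prodMetric]
  exact (SmoothAt.ip h.fst (h.smooth_fst hu) (h.fst_mem u hu) h₁ k₁).add
    (contDiffAt_const.mul (SmoothAt.ip h.snd (h.smooth_snd hu) (h.snd_mem u hu) h₂ k₂))

theorem pd_ip (h : IsProdSurface ε g₁ g₂ D₁ D₂ F U) (hu : u ∈ U)
    (hV : SmoothAt V u) (hW : SmoothAt W u) (a : Fin 2) :
    pd a (fun w => ip (prodMetric ε g₁ g₂ (F w)) (V w) (W w)) u
      = ip (prodMetric ε g₁ g₂ (F u)) (covDeriv (prodMetric ε g₁ g₂) F V a u) (W u)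
        + ip (prodMetric ε g₁ g₂ (F u)) (V u) (covDeriv (prodMetric ε g₁ g₂) F W a u) := by
  obtain ⟨h₁, h₂⟩ := smoothAt_iff_parts.1 hV
  obtain ⟨k₁, k₂⟩ := smoothAt_iff_parts.1 hW
  have d₁ := SmoothAt.ip h.fst (h.smooth_fst hu) (h.fst_mem u hu) h₁ k₁
  have d₂ := SmoothAt.ip h.snd (h.smooth_snd hu) (h.snd_mem u hu) h₂ k₂
  simp_rw [ip_prodMetric]
  rw [pd_add (d₁.differentiableAt (by simp)) ((d₂.differentiableAt (by simp)).const_mul ε),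
    pd_const_mul ε (d₂.differentiableAt (by simp)),
    CoordGeom.pd_ip h.fst (h.smooth_fst hu) (h.fst_mem u hu) h₁ k₁,
    CoordGeom.pd_ip h.snd (h.smooth_snd hu) (h.snd_mem u hu) h₂ k₂]
  simp_rw [h.fstPart_covDeriv hu, h.sndPart_covDeriv hu]
  ring

theorem covDeriv_tangent_comm (h : IsProdSurface ε g₁ g₂ D₁ D₂ F U) (hu : u ∈ U) (a b : Fin 2) :
    covDeriv (prodMetric ε g₁ g₂) F (tangent F b) a u
      = covDeriv (prodMetric ε g₁ g₂) F (tangent F a) b u := by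
  apply ext_parts
  · rw [h.fstPart_covDeriv hu, h.fstPart_covDeriv hu]
    exact CoordGeom.covDeriv_tangent_comm h.fst (h.smooth_fst hu) (h.fst_mem u hu) a b
  · rw [h.sndPart_covDeriv hu, h.sndPart_covDeriv hu]
    exact CoordGeom.covDeriv_tangent_comm h.snd (h.smooth_snd hu) (h.snd_mem u hu) a b

theorem covDeriv_prodJ (h : IsProdSurface ε g₁ g₂ D₁ D₂ F U) (hu : u ∈ U)
    (hV : SmoothAt V u) (a : Fin 2) :
    covDeriv (prodMetric ε g₁ g₂) F (fun w => prodJ g₁ g₂ (F w) (V w)) a u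
      = prodJ g₁ g₂ (F u) (covDeriv (prodMetric ε g₁ g₂) F V a u) := by
  obtain ⟨h₁, h₂⟩ := smoothAt_iff_parts.1 hV
  apply ext_parts
  · rw [h.fstPart_covDeriv hu, fstPart_prodJ, h.fstPart_covDeriv hu]
    exact covDeriv_paracomplex h.fst (h.smooth_fst hu) (h.fst_mem u hu) h₁ a
  · rw [h.sndPart_covDeriv hu, sndPart_prodJ, h.sndPart_covDeriv hu]
    exact covDeriv_paracomplex h.snd (h.smooth_snd hu) (h.snd_mem u hu) h₂ a

theorem prodJ_prodJ (h : IsProdSurface ε g₁ g₂ D₁ D₂ F U) (hu : u ∈ U) (v : Fin 2 ⊕ Fin 2 → ℝ) :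
    prodJ g₁ g₂ (F u) (prodJ g₁ g₂ (F u) v) = v :=
  ext_parts
    (paracomplex_paracomplex (h.fst.det_neg _ (h.fst_mem u hu))
      (h.fst.symm _ (h.fst_mem u hu) 1 0) _)
    (paracomplex_paracomplex (h.snd.det_neg _ (h.snd_mem u hu))
      (h.snd.symm _ (h.snd_mem u hu) 1 0) _)

theorem ip_comm (h : IsProdSurface ε g₁ g₂ D₁ D₂ F U) (hu : u ∈ U) (v w : Fin 2 ⊕ Fin 2 → ℝ) :
    ip (prodMetric ε g₁ g₂ (F u)) v w = ip (prodMetric ε g₁ g₂ (F u)) w v := by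
  rw [ip_prodMetric, ip_prodMetric, CoordGeom.ip_comm (h.fst.symm _ (h.fst_mem u hu) 1 0),
    CoordGeom.ip_comm (h.snd.symm _ (h.snd_mem u hu) 1 0)]

theorem ip_prodJ_right (h : IsProdSurface ε g₁ g₂ D₁ D₂ F U) (hu : u ∈ U)
    (v w : Fin 2 ⊕ Fin 2 → ℝ) : ip (prodMetric ε g₁ g₂ (F u)) v (prodJ g₁ g₂ (F u) w)
      = -ip (prodMetric ε g₁ g₂ (F u)) (prodJ g₁ g₂ (F u) v) w := by
  rw [ip_prodMetric, ip_prodMetric, fstPart_prodJ, sndPart_prodJ,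
    ip_paracomplex_right (h.fst.symm _ (h.fst_mem u hu) 1 0),
    ip_paracomplex_right (h.snd.symm _ (h.snd_mem u hu) 1 0), fstPart_prodJ, sndPart_prodJ]
  ring

end IsProdSurface

end Product
end CoordGeom

/-! ### Frames along Lagrangian surfaces -/

namespace CoordGeom

section Lagrangian

theorem covDeriv_congr {ι : Type*} [Fintype ι] [DecidableEq ι] {g : (ι → ℝ) → Matrix ι ι ℝ}
    {F V W : (Fin 2 → ℝ) → ι → ℝ} {u : Fin 2 → ℝ} (h : V =ᶠ[𝓝 u] W) (a : Fin 2) :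
    covDeriv g F V a u = covDeriv g F W a u := by
  ext k
  have h₁ : pd a (fun w => V w k) u = pd a (fun w => W w k) u :=
    pd_congr (h.mono fun w hw => congrFun hw k)
  simp only [covDeriv, h₁, h.self_of_nhds]

theorem covDeriv_add {ι : Type*} [Fintype ι] [DecidableEq ι] {g : (ι → ℝ) → Matrix ι ι ℝ}
    {F V W : (Fin 2 → ℝ) → ι → ℝ} {u : Fin 2 → ℝ} (hV : SmoothAt V u) (hW : SmoothAt W u)
    (a : Fin 2) :
    covDeriv g F (fun w => V w + W w) a u = covDeriv g F V a u + covDeriv g F W a u := by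
  ext k
  have h₁ : pd a (fun w => V w k + W w k) u = pd a (fun w => V w k) u + pd a (fun w => W w k) u :=
    pd_add (hV.differentiableAt k) (hW.differentiableAt k)
  simp only [covDeriv, Pi.add_apply, h₁, mul_add, Finset.sum_add_distrib]
  ring

theorem covDeriv_smul {ι : Type*} [Fintype ι] [DecidableEq ι] {g : (ι → ℝ) → Matrix ι ι ℝ}
    {F V : (Fin 2 → ℝ) → ι → ℝ} {φ : (Fin 2 → ℝ) → ℝ} {u : Fin 2 → ℝ}
    (hφ : ContDiffAt ℝ ∞ φ u) (hV : SmoothAt V u) (a : Fin 2) :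
    covDeriv g F (fun w => φ w • V w) a u = pd a φ u • V u + φ u • covDeriv g F V a u := by
  ext k
  have h₁ : pd a (fun w => φ w * V w k) u = pd a φ u * V u k + φ u * pd a (fun w => V w k) u :=
    pd_mul (hφ.differentiableAt (by simp)) (hV.differentiableAt k)
  simp only [covDeriv, Pi.smul_apply, Pi.add_apply, smul_eq_mul, h₁, mul_add, Finset.mul_sum,
    mul_left_comm _ (φ u)]
  ring

theorem SmoothAt.add {ι : Type*} {V W : (Fin 2 → ℝ) → ι → ℝ} {u : Fin 2 → ℝ}
    (hV : SmoothAt V u) (hW : SmoothAt W u) : SmoothAt (fun w => V w + W w) u :=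
  fun k => (hV k).add (hW k)

theorem SmoothAt.smul {ι : Type*} {V : (Fin 2 → ℝ) → ι → ℝ} {φ : (Fin 2 → ℝ) → ℝ} {u : Fin 2 → ℝ}
    (hφ : ContDiffAt ℝ ∞ φ u) (hV : SmoothAt V u) : SmoothAt (fun w => φ w • V w) u :=
  fun k => hφ.mul (hV k)

variable {ε : ℝ} {g₁ g₂ : (Fin 2 → ℝ) → Matrix (Fin 2) (Fin 2) ℝ} {D₁ D₂ : Set (Fin 2 → ℝ)}
  {F V W : (Fin 2 → ℝ) → Fin 2 ⊕ Fin 2 → ℝ} {u : Fin 2 → ℝ}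

theorem pullback_prodForm (a b : Fin 2) : pullback (prodForm ε g₁ g₂) F u a b =
    ip (g₁ (fstPart (F u))) (paracomplex (g₁ (fstPart (F u))) *ᵥ fstPart (tangent F a u))
      (fstPart (tangent F b u))
    + ε * ip (g₂ (sndPart (F u))) (paracomplex (g₂ (sndPart (F u))) *ᵥ sndPart (tangent F a u))
      (sndPart (tangent F b u)) := by
  rw [← ip_kaehlerForm, ← ip_kaehlerForm]
  simp [pullback, prodForm, dotProduct, Matrix.mulVec, Fintype.sum_sum_type, fstPart, sndPart]
  ring

variable (ε g₁ g₂ D₁ D₂ F) in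
/-- The parametrized surface `F` is Lagrangian, its induced metric is nondegenerate, and its mean
curvature vector is parallel in the normal bundle. -/
structure IsParallelLagrangian (U : Set (Fin 2 → ℝ)) : Prop
    extends IsProdSurface ε g₁ g₂ D₁ D₂ F U where
  lagrangian : ∀ u ∈ U, pullback (prodForm ε g₁ g₂) F u = 0
  nondeg : ∀ u ∈ U, (pullback (prodMetric ε g₁ g₂) F u).det ≠ 0
  parallel : ∀ u ∈ U, ParallelMeanCurvatureAt (prodMetric ε g₁ g₂) F u

local notation "𝐆" => prodMetric ε g₁ g₂
local notation "𝐉" => prodJ g₁ g₂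

namespace IsParallelLagrangian
variable {U : Set (Fin 2 → ℝ)}

theorem ip_prodJ_tangent (h : IsParallelLagrangian ε g₁ g₂ D₁ D₂ F U) (hu : u ∈ U) (a b : Fin 2) :
    ip (𝐆 (F u)) (𝐉 (F u) (tangent F a u)) (tangent F b u) = 0 := by
  have := congrFun (congrFun (h.lagrangian u hu) a) b
  rw [pullback_prodForm] at this
  rw [ip_prodMetric]
  exact this

theorem ip_tangent_prodJ (h : IsParallelLagrangian ε g₁ g₂ D₁ D₂ F U) (hu : u ∈ U) (a b : Fin 2) :
    ip (𝐆 (F u)) (tangent F a u) (𝐉 (F u) (tangent F b u)) = 0 := by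
  rw [h.ip_comm hu, h.ip_prodJ_tangent hu]

theorem ip_prodJ_prodJ (h : IsParallelLagrangian ε g₁ g₂ D₁ D₂ F U) (hu : u ∈ U)
    (v w : Fin 2 ⊕ Fin 2 → ℝ) :
    ip (𝐆 (F u)) (𝐉 (F u) v) (𝐉 (F u) w) = - ip (𝐆 (F u)) v w := by
  rw [h.ip_prodJ_right hu, h.prodJ_prodJ hu]

/-- The inverse of the first fundamental form. -/
theorem sum_inv_mul (h : IsParallelLagrangian ε g₁ g₂ D₁ D₂ F U) (hu : u ∈ U) (a c : Fin 2) :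
    (pullback 𝐆 F u)⁻¹ a 0 * ip (𝐆 (F u)) (tangent F 0 u) (tangent F c u)
      + (pullback 𝐆 F u)⁻¹ a 1 * ip (𝐆 (F u)) (tangent F 1 u) (tangent F c u)
      = if a = c then 1 else 0 := by
  have := congrFun (congrFun (Matrix.nonsing_inv_mul _ (h.nondeg u hu).isUnit) a) c
  rw [Matrix.mul_apply, Fin.sum_univ_two, Matrix.one_apply] at this
  exact this

theorem inv_symm (h : IsParallelLagrangian ε g₁ g₂ D₁ D₂ F U) (hu : u ∈ U) :
    (pullback 𝐆 F u)⁻¹ 1 0 = (pullback 𝐆 F u)⁻¹ 0 1 := by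
  have : pullback 𝐆 F u 1 0 = pullback 𝐆 F u 0 1 := h.ip_comm hu _ _
  simp [IsLorentzOn.inv_apply, this]

variable (ε g₁ g₂ F) in
/-- The coefficient of `∂ₐF` in the expansion of a vector in the frame `∂₀F, ∂₁F, J∂₀F, J∂₁F`. -/
def tangentCoeff (u : Fin 2 → ℝ) (v : Fin 2 ⊕ Fin 2 → ℝ) (a : Fin 2) : ℝ :=
  (pullback 𝐆 F u)⁻¹ a 0 * ip (𝐆 (F u)) v (tangent F 0 u)
    + (pullback 𝐆 F u)⁻¹ a 1 * ip (𝐆 (F u)) v (tangent F 1 u)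

variable (ε g₁ g₂ F) in
/-- The coefficient of `J∂ₐF` in the expansion of a vector in the frame
`∂₀F, ∂₁F, J∂₀F, J∂₁F`. -/
def normalCoeff (u : Fin 2 → ℝ) (v : Fin 2 ⊕ Fin 2 → ℝ) (a : Fin 2) : ℝ :=
  -((pullback 𝐆 F u)⁻¹ a 0 * ip (𝐆 (F u)) v (𝐉 (F u) (tangent F 0 u))
    + (pullback 𝐆 F u)⁻¹ a 1 * ip (𝐆 (F u)) v (𝐉 (F u) (tangent F 1 u)))

/-- The vectors `∂₀F, ∂₁F, J∂₀F, J∂₁F` form a frame along a Lagrangian surface. -/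
theorem eq_frame_sum (h : IsParallelLagrangian ε g₁ g₂ D₁ D₂ F U) (hu : u ∈ U)
    (v : Fin 2 ⊕ Fin 2 → ℝ) :
    v = tangentCoeff ε g₁ g₂ F u v 0 • tangent F 0 u + tangentCoeff ε g₁ g₂ F u v 1 • tangent F 1 u
      + (normalCoeff ε g₁ g₂ F u v 0 • 𝐉 (F u) (tangent F 0 u)
        + normalCoeff ε g₁ g₂ F u v 1 • 𝐉 (F u) (tangent F 1 u)) := by
  let L : (Fin 2 ⊕ Fin 2 → ℝ) →ₗ[ℝ] (Fin 2 ⊕ Fin 2 → ℝ) :=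
    { toFun := fun v => Sum.elim (fun b => ip (𝐆 (F u)) v (tangent F b u))
        (fun b => ip (𝐆 (F u)) v (𝐉 (F u) (tangent F b u)))
      map_add' := fun v w => by ext k; rcases k with k | k <;> simp [ip_add_left]
      map_smul' := fun c v => by ext k; rcases k with k | k <;> simp [ip_smul_left] }
  have key : ∀ y : Fin 2 ⊕ Fin 2 → ℝ,
      L (((pullback 𝐆 F u)⁻¹ 0 0 * y (.inl 0) + (pullback 𝐆 F u)⁻¹ 0 1 * y (.inl 1)) •
          tangent F 0 u
        + ((pullback 𝐆 F u)⁻¹ 1 0 * y (.inl 0) + (pullback 𝐆 F u)⁻¹ 1 1 * y (.inl 1)) •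
          tangent F 1 u
        + ((-((pullback 𝐆 F u)⁻¹ 0 0 * y (.inr 0) + (pullback 𝐆 F u)⁻¹ 0 1 * y (.inr 1))) •
          𝐉 (F u) (tangent F 0 u)
        + (-((pullback 𝐆 F u)⁻¹ 1 0 * y (.inr 0) + (pullback 𝐆 F u)⁻¹ 1 1 * y (.inr 1))) •
          𝐉 (F u) (tangent F 1 u))) = y := by
    intro y
    have h00 := h.sum_inv_mul hu 0 0
    have h01 := h.sum_inv_mul hu 0 1
    have h10 := h.sum_inv_mul hu 1 0
    have h11 := h.sum_inv_mul hu 1 1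
    have hs := h.inv_symm hu
    have hc := h.ip_comm hu (tangent F 1 u) (tangent F 0 u)
    rw [hs] at h10 h11
    rw [hc] at h00 h10
    simp only [if_true, zero_ne_one, one_ne_zero, if_false] at h00 h01 h10 h11
    ext k
    rcases k with k | k <;> fin_cases k <;>
    simp only [L, LinearMap.coe_mk, AddHom.coe_mk, ip_add_left, ip_smul_left, h.ip_prodJ_tangent hu,
      h.ip_tangent_prodJ hu, h.ip_prodJ_prodJ hu, Sum.elim_inl, Sum.elim_inr, Fin.zero_eta,
      Fin.mk_one, hc, hs]
    · linear_combination y (.inl 0) * h00 + y (.inl 1) * h10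
    · linear_combination y (.inl 0) * h01 + y (.inl 1) * h11
    · linear_combination y (.inr 0) * h00 + y (.inr 1) * h10
    · linear_combination y (.inr 0) * h01 + y (.inr 1) * h11
  have hinj : Function.Injective L :=
    LinearMap.injective_iff_surjective.2 fun y => ⟨_, key y⟩
  exact hinj (key (L v)).symm

theorem normalPart_eq (h : IsParallelLagrangian ε g₁ g₂ D₁ D₂ F U) (hu : u ∈ U)
    (v : Fin 2 ⊕ Fin 2 → ℝ) :
    normalPart 𝐆 F u v = normalCoeff ε g₁ g₂ F u v 0 • 𝐉 (F u) (tangent F 0 u)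
        + normalCoeff ε g₁ g₂ F u v 1 • 𝐉 (F u) (tangent F 1 u) := by
  have h₁ : normalPart 𝐆 F u v = v - (tangentCoeff ε g₁ g₂ F u v 0 • tangent F 0 u
      + tangentCoeff ε g₁ g₂ F u v 1 • tangent F 1 u) := by
    simp only [normalPart, Fin.sum_univ_two, ← add_smul]
    rfl
  rw [h₁, sub_eq_iff_eq_add']
  exact h.eq_frame_sum hu v

theorem ip_normalPart_prodJ (h : IsParallelLagrangian ε g₁ g₂ D₁ D₂ F U) (hu : u ∈ U)
    (v : Fin 2 ⊕ Fin 2 → ℝ) (c : Fin 2) :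
    ip (𝐆 (F u)) (normalPart 𝐆 F u v) (𝐉 (F u) (tangent F c u))
      = ip (𝐆 (F u)) v (𝐉 (F u) (tangent F c u)) := by
  rw [h.normalPart_eq hu]
  conv_rhs => rw [h.eq_frame_sum hu v]
  simp [ip_add_left, ip_smul_left, h.ip_tangent_prodJ hu]

theorem ip_normalPart_tangent (h : IsParallelLagrangian ε g₁ g₂ D₁ D₂ F U) (hu : u ∈ U)
    (v : Fin 2 ⊕ Fin 2 → ℝ) (c : Fin 2) :
    ip (𝐆 (F u)) (normalPart 𝐆 F u v) (tangent F c u) = 0 := by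
  rw [h.normalPart_eq hu]
  simp [ip_add_left, ip_smul_left, h.ip_prodJ_tangent hu]

theorem contDiffAt_inv (h : IsParallelLagrangian ε g₁ g₂ D₁ D₂ F U) (hu : u ∈ U) (a b : Fin 2) :
    ContDiffAt ℝ ∞ (fun w => (pullback 𝐆 F w)⁻¹ a b) u := by
  have hp : ∀ a b, ContDiffAt ℝ ∞ (fun w => pullback 𝐆 F w a b) u := fun a b =>
    h.contDiffAt_ip hu ((h.smooth u hu).tangent a) ((h.smooth u hu).tangent b)
  have hd : ContDiffAt ℝ ∞ (fun w => (pullback 𝐆 F w).det) u := by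
    simp_rw [Matrix.det_fin_two]
    exact ((hp _ _).mul (hp _ _)).sub ((hp _ _).mul (hp _ _))
  simp_rw [IsLorentzOn.inv_apply]
  refine (hd.inv (h.nondeg u hu)).mul ?_
  fin_cases a <;> fin_cases b <;> simp <;> first | exact hp _ _ | exact (hp _ _).neg

theorem smoothAt_prodJ_tangent (h : IsParallelLagrangian ε g₁ g₂ D₁ D₂ F U) (hu : u ∈ U)
    (a : Fin 2) : SmoothAt (fun w => 𝐉 (F w) (tangent F a w)) u :=
  h.smoothAt_prodJ hu ((h.smooth u hu).tangent a)

theorem contDiffAt_tangentCoeff (h : IsParallelLagrangian ε g₁ g₂ D₁ D₂ F U) (hu : u ∈ U)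
    (hV : SmoothAt V u) (a : Fin 2) :
    ContDiffAt ℝ ∞ (fun w => tangentCoeff ε g₁ g₂ F w (V w) a) u :=
  ((h.contDiffAt_inv hu _ _).mul (h.contDiffAt_ip hu hV ((h.smooth u hu).tangent _))).add
    ((h.contDiffAt_inv hu _ _).mul (h.contDiffAt_ip hu hV ((h.smooth u hu).tangent _)))

theorem contDiffAt_normalCoeff (h : IsParallelLagrangian ε g₁ g₂ D₁ D₂ F U) (hu : u ∈ U)
    (hV : SmoothAt V u) (a : Fin 2) :
    ContDiffAt ℝ ∞ (fun w => normalCoeff ε g₁ g₂ F w (V w) a) u :=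
  (((h.contDiffAt_inv hu _ _).mul (h.contDiffAt_ip hu hV (h.smoothAt_prodJ_tangent hu _))).add
    ((h.contDiffAt_inv hu _ _).mul
      (h.contDiffAt_ip hu hV (h.smoothAt_prodJ_tangent hu _)))).neg

theorem smoothAt_meanCurvature (h : IsParallelLagrangian ε g₁ g₂ D₁ D₂ F U) (hu : u ∈ U) :
    SmoothAt (meanCurvature 𝐆 F) u := by
  have hn : ∀ a b, SmoothAt (secondFundamentalForm 𝐆 F a b) u := by
    intro a b
    have hs := h.smoothAt_covDeriv hu ((h.smooth u hu).tangent b) a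
    refine SmoothAt.congr ((SmoothAt.smul (h.contDiffAt_normalCoeff hu hs 0)
      (h.smoothAt_prodJ_tangent hu 0)).add (SmoothAt.smul (h.contDiffAt_normalCoeff hu hs 1)
      (h.smoothAt_prodJ_tangent hu 1))) ?_
    filter_upwards [h.eventually hu] with _ hw using h.normalPart_eq hw _
  have : meanCurvature 𝐆 F = fun w => (1 / 2 : ℝ) •
      (((pullback 𝐆 F w)⁻¹ 0 0 • secondFundamentalForm 𝐆 F 0 0 w
        + (pullback 𝐆 F w)⁻¹ 0 1 • secondFundamentalForm 𝐆 F 0 1 w)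
      + ((pullback 𝐆 F w)⁻¹ 1 0 • secondFundamentalForm 𝐆 F 1 0 w
        + (pullback 𝐆 F w)⁻¹ 1 1 • secondFundamentalForm 𝐆 F 1 1 w)) := by
    ext w : 1
    simp [meanCurvature, Fin.sum_univ_two]
  rw [this]
  have hi := h.contDiffAt_inv hu
  exact SmoothAt.smul contDiffAt_const
    (((SmoothAt.smul (hi _ _) (hn _ _)).add (SmoothAt.smul (hi _ _) (hn _ _))).add
      ((SmoothAt.smul (hi _ _) (hn _ _)).add (SmoothAt.smul (hi _ _) (hn _ _))))

end IsParallelLagrangian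
end Lagrangian
end CoordGeom

/-! ### The Maslov form and the curvature -/

namespace CoordGeom

section Lagrangian

variable {ε : ℝ} {g₁ g₂ : (Fin 2 → ℝ) → Matrix (Fin 2) (Fin 2) ℝ} {D₁ D₂ : Set (Fin 2 → ℝ)}
  {F V W : (Fin 2 → ℝ) → Fin 2 ⊕ Fin 2 → ℝ} {u : Fin 2 → ℝ}

local notation "𝐆" => prodMetric ε g₁ g₂
local notation "𝐉" => prodJ g₁ g₂

theorem prodJ_zero (x : Fin 2 ⊕ Fin 2 → ℝ) : 𝐉 x 0 = 0 := by
  have := prodJ_smul (g₁ := g₁) (g₂ := g₂) (x := x) 0 0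
  simpa using this

namespace IsParallelLagrangian
variable {U : Set (Fin 2 → ℝ)}

/-- The cubic form `G(∇_{∂ₐ} ∂_bF, J∂_cF)` is symmetric in its last two arguments. -/
theorem cubic_symm (h : IsParallelLagrangian ε g₁ g₂ D₁ D₂ F U) (hu : u ∈ U) (a b c : Fin 2) :
    ip (𝐆 (F u)) (covDeriv 𝐆 F (tangent F b) a u) (𝐉 (F u) (tangent F c u))
      = ip (𝐆 (F u)) (covDeriv 𝐆 F (tangent F c) a u) (𝐉 (F u) (tangent F b u)) := by
  have h0 : pd a (fun w => ip (𝐆 (F w)) (tangent F b w) (𝐉 (F w) (tangent F c w))) u = 0 := by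
    rw [← pd_const a 0 u]
    exact pd_congr_of_isOpen h.isOpen (fun w hw => h.ip_tangent_prodJ hw b c) hu
  rw [h.pd_ip hu ((h.smooth u hu).tangent b) (h.smoothAt_prodJ_tangent hu c),
    h.covDeriv_prodJ hu ((h.smooth u hu).tangent c), h.ip_prodJ_right hu (tangent F b u),
    h.ip_comm hu (𝐉 (F u) (tangent F b u))] at h0
  linarith

theorem ip_meanCurvature_tangent (h : IsParallelLagrangian ε g₁ g₂ D₁ D₂ F U) (hu : u ∈ U)
    (c : Fin 2) : ip (𝐆 (F u)) (meanCurvature 𝐆 F u) (tangent F c u) = 0 := by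
  simp [meanCurvature, Fin.sum_univ_two, ip_add_left, ip_smul_left, secondFundamentalForm,
    -one_div, h.ip_normalPart_tangent hu]

/-- The Maslov form `2 G(H, J∂_cF)` is minus the trace of `J∂`-coefficients of `∇_{∂_c}`. -/
theorem two_mul_ip_meanCurvature (h : IsParallelLagrangian ε g₁ g₂ D₁ D₂ F U) (hu : u ∈ U)
    (c : Fin 2) : 2 * ip (𝐆 (F u)) (meanCurvature 𝐆 F u) (𝐉 (F u) (tangent F c u))
      = -(normalCoeff ε g₁ g₂ F u (covDeriv 𝐆 F (tangent F 0) c u) 0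
        + normalCoeff ε g₁ g₂ F u (covDeriv 𝐆 F (tangent F 1) c u) 1) := by
  have hC : ∀ a b, ip (𝐆 (F u)) (covDeriv 𝐆 F (tangent F b) a u) (𝐉 (F u) (tangent F c u))
      = ip (𝐆 (F u)) (covDeriv 𝐆 F (tangent F a) c u) (𝐉 (F u) (tangent F b u)) := by
    intro a b
    rw [h.cubic_symm hu, h.covDeriv_tangent_comm hu a c, h.cubic_symm hu]
  simp only [meanCurvature, Fin.sum_univ_two, ip_add_left, ip_smul_left, secondFundamentalForm,
    h.ip_normalPart_prodJ hu, hC, normalCoeff]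
  ring

/-- Along a surface with parallel mean curvature vector `H`, the derivative of the Maslov form
`2 G(H, J·)`. -/
theorem pd_ip_meanCurvature (h : IsParallelLagrangian ε g₁ g₂ D₁ D₂ F U) (hu : u ∈ U)
    (a b : Fin 2) :
    pd a (fun w => ip (𝐆 (F w)) (meanCurvature 𝐆 F w) (𝐉 (F w) (tangent F b w))) u
      = ip (𝐆 (F u)) (meanCurvature 𝐆 F u)
        (𝐉 (F u) (covDeriv 𝐆 F (tangent F b) a u)) := by
  rw [h.pd_ip hu (h.smoothAt_meanCurvature hu) (h.smoothAt_prodJ_tangent hu b),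
    h.covDeriv_prodJ hu ((h.smooth u hu).tangent b), ← h.ip_normalPart_prodJ hu,
    h.parallel u hu a]
  simp [ip]

theorem normalCoeff_add (v w : Fin 2 ⊕ Fin 2 → ℝ) (a : Fin 2) :
    normalCoeff ε g₁ g₂ F u (v + w) a
      = normalCoeff ε g₁ g₂ F u v a + normalCoeff ε g₁ g₂ F u w a := by
  simp only [normalCoeff, ip_add_left]; ring

theorem normalCoeff_sub (v w : Fin 2 ⊕ Fin 2 → ℝ) (a : Fin 2) :
    normalCoeff ε g₁ g₂ F u (v - w) a
      = normalCoeff ε g₁ g₂ F u v a - normalCoeff ε g₁ g₂ F u w a := by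
  simp only [normalCoeff, ip_sub_left]; ring

theorem normalCoeff_smul (c : ℝ) (v : Fin 2 ⊕ Fin 2 → ℝ) (a : Fin 2) :
    normalCoeff ε g₁ g₂ F u (c • v) a = c * normalCoeff ε g₁ g₂ F u v a := by
  simp only [normalCoeff, ip_smul_left]; ring

theorem normalCoeff_tangent (h : IsParallelLagrangian ε g₁ g₂ D₁ D₂ F U) (hu : u ∈ U)
    (a b : Fin 2) : normalCoeff ε g₁ g₂ F u (tangent F b u) a = 0 := by
  simp [normalCoeff, h.ip_tangent_prodJ hu]

theorem normalCoeff_prodJ (h : IsParallelLagrangian ε g₁ g₂ D₁ D₂ F U) (hu : u ∈ U)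
    (v : Fin 2 ⊕ Fin 2 → ℝ) (a : Fin 2) :
    normalCoeff ε g₁ g₂ F u (𝐉 (F u) v) a = tangentCoeff ε g₁ g₂ F u v a := by
  simp only [normalCoeff, tangentCoeff, h.ip_prodJ_prodJ hu]; ring

theorem tangentCoeff_tangent (h : IsParallelLagrangian ε g₁ g₂ D₁ D₂ F U) (hu : u ∈ U)
    (a b : Fin 2) : tangentCoeff ε g₁ g₂ F u (tangent F b u) a = if a = b then 1 else 0 := by
  simp only [tangentCoeff, h.ip_comm hu (tangent F b u), h.sum_inv_mul hu]

/-- The `J∂ₐF`-coefficient of `∇_d V`, in terms of the coefficients of `V` in the frame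
`∂₀F, ∂₁F, J∂₀F, J∂₁F`. -/
theorem normalCoeff_covDeriv (h : IsParallelLagrangian ε g₁ g₂ D₁ D₂ F U) (hu : u ∈ U)
    (hV : ∀ w ∈ U, SmoothAt V w) (a d : Fin 2) :
    normalCoeff ε g₁ g₂ F u (covDeriv 𝐆 F V d u) a
      = pd d (fun w => normalCoeff ε g₁ g₂ F w (V w) a) u
        + ∑ e, (tangentCoeff ε g₁ g₂ F u (V u) e
            * normalCoeff ε g₁ g₂ F u (covDeriv 𝐆 F (tangent F e) d u) a
          + normalCoeff ε g₁ g₂ F u (V u) e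
            * tangentCoeff ε g₁ g₂ F u (covDeriv 𝐆 F (tangent F e) d u) a) := by
  have hT := fun a => (h.smooth u hu).tangent a
  have hJ := h.smoothAt_prodJ_tangent hu
  have ht := h.contDiffAt_tangentCoeff hu (hV u hu)
  have hn := h.contDiffAt_normalCoeff hu (hV u hu)
  have hexp : V =ᶠ[𝓝 u] fun w => (tangentCoeff ε g₁ g₂ F w (V w) 0 • tangent F 0 w
      + tangentCoeff ε g₁ g₂ F w (V w) 1 • tangent F 1 w)
      + (normalCoeff ε g₁ g₂ F w (V w) 0 • 𝐉 (F w) (tangent F 0 w)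
        + normalCoeff ε g₁ g₂ F w (V w) 1 • 𝐉 (F w) (tangent F 1 w)) := by
    filter_upwards [h.eventually hu] with w hw using h.eq_frame_sum hw (V w)
  rw [covDeriv_congr hexp, covDeriv_add ((SmoothAt.smul (ht 0) (hT 0)).add
    (SmoothAt.smul (ht 1) (hT 1))) ((SmoothAt.smul (hn 0) (hJ 0)).add (SmoothAt.smul (hn 1) (hJ 1))),
    covDeriv_add (SmoothAt.smul (ht 0) (hT 0)) (SmoothAt.smul (ht 1) (hT 1)),
    covDeriv_add (SmoothAt.smul (hn 0) (hJ 0)) (SmoothAt.smul (hn 1) (hJ 1)),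
    covDeriv_smul (ht 0) (hT 0), covDeriv_smul (ht 1) (hT 1), covDeriv_smul (hn 0) (hJ 0),
    covDeriv_smul (hn 1) (hJ 1), h.covDeriv_prodJ hu (hT 0), h.covDeriv_prodJ hu (hT 1)]
  simp only [normalCoeff_add, normalCoeff_smul, h.normalCoeff_tangent hu, h.normalCoeff_prodJ hu,
    h.tangentCoeff_tangent hu, Fin.sum_univ_two]
  fin_cases a <;> simp <;> ring

/-- Along a Lagrangian surface the two factors contribute equally to the trace of the first
fundamental form, as their Gram determinants agree. -/
theorem trace_parts (h : IsParallelLagrangian ε g₁ g₂ D₁ D₂ F U) (hu : u ∈ U) :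
    ∑ a, ∑ b, (pullback 𝐆 F u)⁻¹ a b *
      ip (g₁ (fstPart (F u))) (fstPart (tangent F a u)) (fstPart (tangent F b u)) = 1 ∧
    ∑ a, ∑ b, (pullback 𝐆 F u)⁻¹ a b *
      (ε * ip (g₂ (sndPart (F u))) (sndPart (tangent F a u)) (sndPart (tangent F b u))) = 1 := by
  have hdet := h.nondeg u hu
  have hlag := congrFun (congrFun (h.lagrangian u hu) 0) 1
  rw [pullback_prodForm, Matrix.zero_apply] at hlag
  have s₁ := h.fst.symm _ (h.fst_mem u hu) 1 0
  have s₂ := h.snd.symm _ (h.snd_mem u hu) 1 0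
  have q₁ := gram_eq_neg_sq (h.fst.det_neg _ (h.fst_mem u hu)) s₁ (fstPart (tangent F 0 u))
    (fstPart (tangent F 1 u))
  have q₂ := gram_eq_neg_sq (h.snd.det_neg _ (h.snd_mem u hu)) s₂ (sndPart (tangent F 0 u))
    (sndPart (tangent F 1 u))
  have c₁ := CoordGeom.ip_comm s₁ (fstPart (tangent F 1 u)) (fstPart (tangent F 0 u))
  have c₂ := CoordGeom.ip_comm s₂ (sndPart (tangent F 1 u)) (sndPart (tangent F 0 u))
  have hp : ∀ a b, pullback 𝐆 F u a b
      = ip (g₁ (fstPart (F u))) (fstPart (tangent F a u)) (fstPart (tangent F b u))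
        + ε * ip (g₂ (sndPart (F u))) (sndPart (tangent F a u)) (sndPart (tangent F b u)) :=
    fun a b => ip_prodMetric _ _
  have hinv := mul_inv_cancel₀ hdet
  have hε := h.sign
  simp only [Fin.sum_univ_two, IsLorentzOn.inv_apply]
  set Δ := (pullback 𝐆 F u).det with hΔ
  rw [Matrix.det_fin_two] at hΔ
  simp only [hp, c₁, c₂, Matrix.of_apply, Matrix.cons_val', Matrix.cons_val_zero,
    Matrix.cons_val_one, Matrix.cons_val_fin_one] at *
  set A00 := ip (g₁ (fstPart (F u))) (fstPart (tangent F 0 u)) (fstPart (tangent F 0 u))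
  set A01 := ip (g₁ (fstPart (F u))) (fstPart (tangent F 0 u)) (fstPart (tangent F 1 u))
  set A11 := ip (g₁ (fstPart (F u))) (fstPart (tangent F 1 u)) (fstPart (tangent F 1 u))
  set B00 := ip (g₂ (sndPart (F u))) (sndPart (tangent F 0 u)) (sndPart (tangent F 0 u))
  set B01 := ip (g₂ (sndPart (F u))) (sndPart (tangent F 0 u)) (sndPart (tangent F 1 u))
  set B11 := ip (g₂ (sndPart (F u))) (sndPart (tangent F 1 u)) (sndPart (tangent F 1 u))
  set ω₁ := ip (g₁ (fstPart (F u))) (paracomplex (g₁ (fstPart (F u))) *ᵥ fstPart (tangent F 0 u))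
    (fstPart (tangent F 1 u))
  set ω₂ := ip (g₂ (sndPart (F u))) (paracomplex (g₂ (sndPart (F u))) *ᵥ sndPart (tangent F 0 u))
    (sndPart (tangent F 1 u))
  have hAB : A00 * A11 - A01 ^ 2 = (ε * B00) * (ε * B11) - (ε * B01) ^ 2 := by
    linear_combination q₁ - ε ^ 2 * q₂ - (ω₁ - ε * ω₂) * hlag
  constructor
  · linear_combination hinv + Δ⁻¹ * hAB - Δ⁻¹ * hΔ
  · linear_combination hinv - Δ⁻¹ * hAB - Δ⁻¹ * hΔ

/-- The curvature of the connection that a Lagrangian surface induces on the paracomplex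
determinant of the ambient tangent bundle is the exterior derivative of the Maslov form, which
vanishes if the mean curvature vector is parallel: `κ₁ π₁^*ω₁ + κ₂ π₂^*ω₂ = 0`. -/
theorem curvature_relation (h : IsParallelLagrangian ε g₁ g₂ D₁ D₂ F U) (hu : u ∈ U) :
    gaussCurvature g₁ (fstPart (F u)) *
      ip (g₁ (fstPart (F u))) (paracomplex (g₁ (fstPart (F u))) *ᵥ fstPart (tangent F 0 u))
        (fstPart (tangent F 1 u))
    + gaussCurvature g₂ (sndPart (F u)) *
      ip (g₂ (sndPart (F u))) (paracomplex (g₂ (sndPart (F u))) *ᵥ sndPart (tangent F 0 u))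
        (sndPart (tangent F 1 u)) = 0 := by
  set r₁ := gaussCurvature g₁ (fstPart (F u)) *
      ip (g₁ (fstPart (F u))) (paracomplex (g₁ (fstPart (F u))) *ᵥ fstPart (tangent F 0 u))
        (fstPart (tangent F 1 u)) with hr₁
  set r₂ := gaussCurvature g₂ (sndPart (F u)) *
      ip (g₂ (sndPart (F u))) (paracomplex (g₂ (sndPart (F u))) *ᵥ sndPart (tangent F 0 u))
        (sndPart (tangent F 1 u)) with hr₂
  have hT : ∀ w ∈ U, ∀ a, SmoothAt (tangent F a) w := fun w hw a => (h.smooth w hw).tangent a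
  have hDT : ∀ w ∈ U, ∀ a c, SmoothAt (covDeriv 𝐆 F (tangent F a) c) w :=
    fun w hw a c => h.smoothAt_covDeriv hw (hT w hw a) c
  -- the commutator of covariant derivatives, computed from the curvature
  have hcom : ∀ a b, ip (𝐆 (F u)) (covDeriv 𝐆 F (covDeriv 𝐆 F (tangent F a) 1) 0 u
      - covDeriv 𝐆 F (covDeriv 𝐆 F (tangent F a) 0) 1 u) (𝐉 (F u) (tangent F b u))
      = -(r₁ * ip (g₁ (fstPart (F u))) (fstPart (tangent F a u)) (fstPart (tangent F b u))
        + r₂ * (ε * ip (g₂ (sndPart (F u))) (sndPart (tangent F a u))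
          (sndPart (tangent F b u)))) := by
    intro a b
    have c₁ : fstPart (covDeriv 𝐆 F (covDeriv 𝐆 F (tangent F a) 1) 0 u
        - covDeriv 𝐆 F (covDeriv 𝐆 F (tangent F a) 0) 1 u)
        = r₁ • (paracomplex (g₁ (fstPart (F u))) *ᵥ fstPart (tangent F a u)) := by
      have hW : ∀ c, (fun w => fstPart (covDeriv 𝐆 F (tangent F a) c w)) =ᶠ[𝓝 u]
          covDeriv g₁ (fun w => fstPart (F w)) (fun w => fstPart (tangent F a w)) c := fun c => by
        filter_upwards [h.eventually hu] with w hw using h.fstPart_covDeriv hw _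
      rw [fstPart_sub, h.fstPart_covDeriv hu, h.fstPart_covDeriv hu, hr₁, covDeriv_congr (hW 1),
        covDeriv_congr (hW 0)]
      exact covDeriv_commutator_eq h.fst (h.smooth_fst hu) (h.fst_mem u hu)
          (smoothAt_iff_parts.1 (hT u hu a)).1
    have c₂ : sndPart (covDeriv 𝐆 F (covDeriv 𝐆 F (tangent F a) 1) 0 u
        - covDeriv 𝐆 F (covDeriv 𝐆 F (tangent F a) 0) 1 u)
        = r₂ • (paracomplex (g₂ (sndPart (F u))) *ᵥ sndPart (tangent F a u)) := by
      have hW : ∀ c, (fun w => sndPart (covDeriv 𝐆 F (tangent F a) c w)) =ᶠ[𝓝 u]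
          covDeriv g₂ (fun w => sndPart (F w)) (fun w => sndPart (tangent F a w)) c := fun c => by
        filter_upwards [h.eventually hu] with w hw using h.sndPart_covDeriv hw _
      rw [sndPart_sub, h.sndPart_covDeriv hu, h.sndPart_covDeriv hu, hr₂, covDeriv_congr (hW 1),
        covDeriv_congr (hW 0)]
      exact covDeriv_commutator_eq h.snd (h.smooth_snd hu) (h.snd_mem u hu)
          (smoothAt_iff_parts.1 (hT u hu a)).2
    have s₁ := h.fst.symm _ (h.fst_mem u hu) 1 0
    have s₂ := h.snd.symm _ (h.snd_mem u hu) 1 0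
    rw [ip_prodMetric, c₁, c₂, fstPart_prodJ, sndPart_prodJ, ip_smul_left, ip_smul_left,
      ip_paracomplex_right s₁, ip_paracomplex_right s₂,
      paracomplex_paracomplex (h.fst.det_neg _ (h.fst_mem u hu)) s₁,
      paracomplex_paracomplex (h.snd.det_neg _ (h.snd_mem u hu)) s₂]
    ring
  have htr : ∑ a, normalCoeff ε g₁ g₂ F u (covDeriv 𝐆 F (covDeriv 𝐆 F (tangent F a) 1) 0 u
      - covDeriv 𝐆 F (covDeriv 𝐆 F (tangent F a) 0) 1 u) a = r₁ + r₂ := by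
    obtain ⟨t₁, t₂⟩ := h.trace_parts hu
    simp only [Fin.sum_univ_two] at t₁ t₂
    simp only [Fin.sum_univ_two, normalCoeff, hcom]
    linear_combination r₁ * t₁ + r₂ * t₂
  -- the same trace, computed from the derivative of the Maslov form
  have hMaslov : ∀ d c, pd d (fun w => normalCoeff ε g₁ g₂ F w (covDeriv 𝐆 F (tangent F 0) c w) 0) u
      + pd d (fun w => normalCoeff ε g₁ g₂ F w (covDeriv 𝐆 F (tangent F 1) c w) 1) u
      = -2 * ip (𝐆 (F u)) (meanCurvature 𝐆 F u)
        (𝐉 (F u) (covDeriv 𝐆 F (tangent F c) d u)) := by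
    intro d c
    rw [← h.pd_ip_meanCurvature hu, ← pd_add, ← pd_const_mul]
    · refine pd_congr_of_isOpen h.isOpen (fun w hw => ?_) hu
      linarith [h.two_mul_ip_meanCurvature hw c]
    · exact (h.contDiffAt_ip hu (h.smoothAt_meanCurvature hu)
        (h.smoothAt_prodJ_tangent hu c)).differentiableAt (by simp)
    all_goals exact (h.contDiffAt_normalCoeff hu (hDT u hu _ _) _).differentiableAt (by simp)
  have m₁ := hMaslov 0 1
  have m₂ := hMaslov 1 0
  rw [h.covDeriv_tangent_comm hu 1 0] at m₂
  have hn := fun a d c => h.normalCoeff_covDeriv hu (fun w hw => hDT w hw a c) a d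
  simp only [Fin.sum_univ_two] at htr hn
  rw [normalCoeff_sub, normalCoeff_sub, hn, hn, hn, hn] at htr
  linarith

end IsParallelLagrangian
end Lagrangian
end CoordGeom

/-! ### Lagrangian products of curves -/

namespace CoordGeom

theorem eq_zero_or_eq_one (a : Fin 2) : a = 0 ∨ a = 1 := by
  fin_cases a <;> simp

theorem contDiffAt_deriv {E : Type*} [NormedAddCommGroup E] [NormedSpace ℝ E] {c : ℝ → E} {s : ℝ}
    (hc : ContDiffAt ℝ ∞ c s) : ContDiffAt ℝ ∞ (deriv c) s :=
  (hc.fderiv_right (m := ∞) (by simp)).clm_apply contDiffAt_const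

theorem pd_comp_coord {ι : Type*} [Fintype ι] [DecidableEq ι] {φ : ℝ → ℝ} {u : ι → ℝ} {b : ι}
    (hφ : DifferentiableAt ℝ φ (u b)) (a : ι) :
    pd a (fun w => φ (w b)) u = if b = a then deriv φ (u b) else 0 := by
  have h1 : HasFDerivAt (fun w : ι → ℝ => w b)
      (ContinuousLinearMap.proj (R := ℝ) (φ := fun _ : ι => ℝ) b) u := hasFDerivAt_apply b u
  have h := hφ.hasDerivAt.comp_hasFDerivAt u h1
  have h2 : fderiv ℝ (fun w : ι → ℝ => φ (w b)) u = _ := h.fderiv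
  simp [pd, h2, Pi.single_apply]

theorem pd_curve_comp_coord {c : ℝ → Fin 2 → ℝ} {b : Fin 2} {u : Fin 2 → ℝ}
    (hc : ContDiffAt ℝ ∞ c (u b)) (a k : Fin 2) :
    pd a (fun w => c (w b) k) u = if b = a then deriv c (u b) k else 0 := by
  have hd : DifferentiableAt ℝ c (u b) := hc.differentiableAt (by simp)
  rw [pd_comp_coord (φ := fun s => c s k) (differentiableAt_pi.1 hd k),
    deriv_pi (fun i => differentiableAt_pi.1 hd i)]

theorem tangent_of_product_curves {F : (Fin 2 → ℝ) → Fin 2 ⊕ Fin 2 → ℝ} {U : Set (Fin 2 → ℝ)}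
    (hU : IsOpen U) {c₁ c₂ : ℝ → Fin 2 → ℝ}
    (hc₁ : ∀ u ∈ U, ContDiffAt ℝ ∞ c₁ (u 0)) (hc₂ : ∀ u ∈ U, ContDiffAt ℝ ∞ c₂ (u 1))
    (hF₁ : ∀ u ∈ U, fstPart (F u) = c₁ (u 0)) (hF₂ : ∀ u ∈ U, sndPart (F u) = c₂ (u 1)) :
    ∀ u ∈ U, ∀ a, fstPart (tangent F a u) = (if 0 = a then deriv c₁ (u 0) else 0) ∧
      sndPart (tangent F a u) = (if 1 = a then deriv c₂ (u 1) else 0) := by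
  intro u hu a
  constructor
  · ext k
    have h1 : fstPart (tangent F a u) k = pd a (fun w => c₁ (w 0) k) u :=
      pd_congr_of_isOpen hU (fun w hw => congrFun (hF₁ w hw) k) hu
    rw [h1, pd_curve_comp_coord (hc₁ u hu)]
    split_ifs <;> rfl
  · ext k
    have h1 : sndPart (tangent F a u) k = pd a (fun w => c₂ (w 1) k) u :=
      pd_congr_of_isOpen hU (fun w hw => congrFun (hF₂ w hw) k) hu
    rw [h1, pd_curve_comp_coord (hc₂ u hu)]
    split_ifs <;> rfl

theorem constant_of_pd_eq_zero {ι : Type*} [Fintype ι] [DecidableEq ι] {φ : (ι → ℝ) → ℝ}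
    {U : Set (ι → ℝ)} (hU : IsOpen U) (hc : Convex ℝ U)
    (hd : ∀ u ∈ U, DifferentiableAt ℝ φ u) (h0 : ∀ u ∈ U, ∀ b, pd b φ u = 0)
    {u v : ι → ℝ} (hu : u ∈ U) (hv : v ∈ U) : φ u = φ v := by
  refine hU.is_const_of_fderiv_eq_zero hc.isPreconnected
    (fun w hw => (hd w hw).differentiableWithinAt) (fun w hw => ?_) hu hv
  apply ContinuousLinearMap.coe_injective
  refine LinearMap.pi_ext' fun b => LinearMap.ext_ring ?_
  exact h0 w hw b

section Lagrangian

variable {ε : ℝ} {g₁ g₂ : (Fin 2 → ℝ) → Matrix (Fin 2) (Fin 2) ℝ} {D₁ D₂ : Set (Fin 2 → ℝ)}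
  {F V W : (Fin 2 → ℝ) → Fin 2 ⊕ Fin 2 → ℝ} {u : Fin 2 → ℝ} {U : Set (Fin 2 → ℝ)}

local notation "𝐆" => prodMetric ε g₁ g₂
local notation "𝐉" => prodJ g₁ g₂

namespace IsParallelLagrangian

/-- If the induced metric has constant coefficients and the coordinate fields are parallel along
each other, then `∇_{∂ₐ} ∂ₐF` is a constant multiple of `J∂ₐF`. -/
theorem exists_covDeriv_tangent_eq (h : IsParallelLagrangian ε g₁ g₂ D₁ D₂ F U)
    (hconv : Convex ℝ U) {K : Matrix (Fin 2) (Fin 2) ℝ}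
    (hK : ∀ u ∈ U, ∀ a b, ip (𝐆 (F u)) (tangent F a u) (tangent F b u) = K a b)
    (hK₀ : K 0 1 = 0) (hD : ∀ u ∈ U, covDeriv 𝐆 F (tangent F 1) 0 u = 0) (a : Fin 2) :
    ∃ k : ℝ, ∀ u ∈ U, covDeriv 𝐆 F (tangent F a) a u = k • 𝐉 (F u) (tangent F a u) := by
  set ν : (Fin 2 → ℝ) → ℝ := fun u => normalCoeff ε g₁ g₂ F u (covDeriv 𝐆 F (tangent F a) a u) a
    with hν
  have hT : ∀ w ∈ U, ∀ a, SmoothAt (tangent F a) w := fun w hw a => (h.smooth w hw).tangent a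
  have hDT : ∀ w ∈ U, ∀ a c, SmoothAt (covDeriv 𝐆 F (tangent F a) c) w :=
    fun w hw a c => h.smoothAt_covDeriv hw (hT w hw a) c
  have hmixed : ∀ u ∈ U, ∀ c b, c ≠ b → covDeriv 𝐆 F (tangent F c) b u = 0 := by
    intro u hu c b hcb
    have h1 := hD u hu
    have h2 := h.covDeriv_tangent_comm hu 0 1
    rw [h1] at h2
    fin_cases c <;> fin_cases b <;> first | exact absurd rfl hcb | exact h1 | exact h2.symm
  have hz : ∀ u v, ip (𝐆 (F u)) 0 v = 0 := fun u v => by simp [ip]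
  have hcompat : ∀ u ∈ U, ∀ b, ip (𝐆 (F u)) (covDeriv 𝐆 F (tangent F a) a u) (tangent F b u)
      + ip (𝐆 (F u)) (covDeriv 𝐆 F (tangent F b) a u) (tangent F a u) = 0 := by
    intro u hu b
    rw [h.ip_comm hu (covDeriv 𝐆 F (tangent F b) a u), ← h.pd_ip hu (hT u hu a) (hT u hu b),
      ← pd_const a (K a b) u]
    exact pd_congr_of_isOpen h.isOpen (fun w hw => hK w hw a b) hu
  have htan : ∀ u ∈ U, ∀ b,
      ip (𝐆 (F u)) (covDeriv 𝐆 F (tangent F a) a u) (tangent F b u) = 0 := by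
    intro u hu b
    have := hcompat u hu b
    by_cases hb : b = a
    · subst hb; linarith
    · rwa [hmixed u hu b a hb, hz, add_zero] at this
  have hnor : ∀ u ∈ U, ∀ b, b ≠ a →
      ip (𝐆 (F u)) (covDeriv 𝐆 F (tangent F a) a u) (𝐉 (F u) (tangent F b u)) = 0 := by
    intro u hu b hb
    rw [h.cubic_symm hu, hmixed u hu b a hb, hz]
  have hinv : ∀ u ∈ U, ∀ b c, b ≠ c → (pullback 𝐆 F u)⁻¹ b c = 0 := by
    intro u hu b c hbc
    have h1 : pullback 𝐆 F u 0 1 = 0 := (hK u hu 0 1).trans hK₀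
    have h2 : pullback 𝐆 F u 1 0 = 0 := (h.ip_comm hu _ _).trans h1
    rw [IsLorentzOn.inv_apply]
    fin_cases b <;> fin_cases c <;> simp [h1, h2] at hbc ⊢
  have hν0 : ∀ u ∈ U, ∀ b c, b ≠ a →
      normalCoeff ε g₁ g₂ F u (covDeriv 𝐆 F (tangent F b) a u) c = 0 := by
    intro u hu b c hb
    rw [hmixed u hu b a hb]
    simp [normalCoeff, hz]
  have hν1 : ∀ u ∈ U, ∀ b, b ≠ a →
      normalCoeff ε g₁ g₂ F u (covDeriv 𝐆 F (tangent F a) a u) b = 0 := by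
    intro u hu b hb
    have key : ∀ f, (pullback 𝐆 F u)⁻¹ b f *
        ip (𝐆 (F u)) (covDeriv 𝐆 F (tangent F a) a u) (𝐉 (F u) (tangent F f u)) = 0 := by
      intro f
      by_cases hf : f = a
      · rw [hinv u hu b f (hf ▸ hb), zero_mul]
      · rw [hnor u hu f hf, mul_zero]
    simp [normalCoeff, key]
  have hexp : ∀ u ∈ U, covDeriv 𝐆 F (tangent F a) a u = ν u • 𝐉 (F u) (tangent F a u) := by
    intro u hu
    have ht : ∀ b, tangentCoeff ε g₁ g₂ F u (covDeriv 𝐆 F (tangent F a) a u) b = 0 := fun b => by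
      simp [tangentCoeff, htan u hu]
    have hn := hν1 u hu
    conv_lhs => rw [h.eq_frame_sum hu (covDeriv 𝐆 F (tangent F a) a u)]
    simp only [ht, zero_smul, zero_add, hν]
    obtain rfl | rfl := eq_zero_or_eq_one a
    · simp only [hn 1 (by simp), zero_smul, add_zero]
    · simp only [hn 0 (by simp), zero_smul, zero_add]
  -- `ν` is minus the component of the Maslov form along `∂ₐF`
  have hMaslov : ∀ u ∈ U, ν u
      = -2 * ip (𝐆 (F u)) (meanCurvature 𝐆 F u) (𝐉 (F u) (tangent F a u)) := by
    intro u hu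
    have h2 := h.two_mul_ip_meanCurvature hu a
    have hn := hν0 u hu
    simp only [hν]
    obtain rfl | rfl := eq_zero_or_eq_one a
    · rw [hn 1 1 (by simp)] at h2
      linarith
    · rw [hn 0 0 (by simp)] at h2
      linarith
  have hpd : ∀ u ∈ U, ∀ b, pd b ν u = 0 := by
    intro u hu b
    rw [pd_congr_of_isOpen h.isOpen hMaslov hu, pd_const_mul, h.pd_ip_meanCurvature hu]
    · by_cases hb : a = b
      · subst hb
        rw [hexp u hu, prodJ_smul, h.prodJ_prodJ hu, ip_smul_right,
          h.ip_meanCurvature_tangent hu, mul_zero, mul_zero]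
      · rw [hmixed u hu a b hb, prodJ_zero]
        simp [ip]
    · exact (h.contDiffAt_ip hu (h.smoothAt_meanCurvature hu)
        (h.smoothAt_prodJ_tangent hu a)).differentiableAt (by simp)
  rcases U.eq_empty_or_nonempty with rfl | ⟨u₀, hu₀⟩
  · exact ⟨0, fun u hu => hu.elim⟩
  · refine ⟨ν u₀, fun u hu => ?_⟩
    rw [hexp u hu, constant_of_pd_eq_zero (φ := ν) h.isOpen hconv
      (fun w hw => (h.contDiffAt_normalCoeff hw (hDT w hw a a) a).differentiableAt (by simp))
      hpd hu hu₀]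

/-- A Lagrangian product of two curves parametrized by arclength with parallel mean curvature
vector: both curves have constant curvature. -/
theorem exists_acceleration_eq (h : IsParallelLagrangian ε g₁ g₂ D₁ D₂ F U)
    (hconv : Convex ℝ U) {c₁ c₂ : ℝ → Fin 2 → ℝ} {η₁ η₂ : ℝ}
    (hc₁ : ∀ u ∈ U, ContDiffAt ℝ ∞ c₁ (u 0)) (hc₂ : ∀ u ∈ U, ContDiffAt ℝ ∞ c₂ (u 1))
    (hF₁ : ∀ u ∈ U, fstPart (F u) = c₁ (u 0)) (hF₂ : ∀ u ∈ U, sndPart (F u) = c₂ (u 1))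
    (hη₁ : ∀ u ∈ U, ip (g₁ (c₁ (u 0))) (deriv c₁ (u 0)) (deriv c₁ (u 0)) = η₁)
    (hη₂ : ∀ u ∈ U, ip (g₂ (c₂ (u 1))) (deriv c₂ (u 1)) (deriv c₂ (u 1)) = η₂) :
    ∃ k₁ k₂ : ℝ, ∀ u ∈ U,
      acceleration g₁ c₁ (u 0) = k₁ • (paracomplex (g₁ (c₁ (u 0))) *ᵥ deriv c₁ (u 0)) ∧
      acceleration g₂ c₂ (u 1) = k₂ • (paracomplex (g₂ (c₂ (u 1))) *ᵥ deriv c₂ (u 1)) := by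
  have htan := tangent_of_product_curves h.isOpen hc₁ hc₂ hF₁ hF₂
  have hpart₁ : ∀ u ∈ U, ∀ a b, fstPart (covDeriv 𝐆 F (tangent F a) b u)
      = if 0 = a then (if 0 = b then acceleration g₁ c₁ (u 0) else 0) else 0 := by
    intro u hu a b
    have hV : (fun w => fstPart (tangent F a w)) =ᶠ[𝓝 u]
        fun w => if 0 = a then deriv c₁ (w 0) else 0 := by
      filter_upwards [h.eventually hu] with w hw using (htan w hw a).1
    have ht : tangent (fun w => fstPart (F w)) b u = fstPart (tangent F b u) := rfl
    rw [h.fstPart_covDeriv hu, covDeriv_congr hV]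
    ext k
    simp only [covDeriv, ht, (htan u hu b).1, hF₁ u hu]
    by_cases ha : 0 = a
    · have hp := pd_curve_comp_coord (contDiffAt_deriv (hc₁ u hu)) b k
      by_cases hb : 0 = b
      · simp only [if_pos ha, if_pos hb, hp, acceleration]
      · simp only [if_pos ha, if_neg hb, hp, Pi.zero_apply, mul_zero, zero_mul,
          Finset.sum_const_zero, add_zero]
    · simp only [if_neg ha, Pi.zero_apply, mul_zero, Finset.sum_const_zero, add_zero, pd_const]
  have hpart₂ : ∀ u ∈ U, ∀ a b, sndPart (covDeriv 𝐆 F (tangent F a) b u)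
      = if 1 = a then (if 1 = b then acceleration g₂ c₂ (u 1) else 0) else 0 := by
    intro u hu a b
    have hV : (fun w => sndPart (tangent F a w)) =ᶠ[𝓝 u]
        fun w => if 1 = a then deriv c₂ (w 1) else 0 := by
      filter_upwards [h.eventually hu] with w hw using (htan w hw a).2
    have ht : tangent (fun w => sndPart (F w)) b u = sndPart (tangent F b u) := rfl
    rw [h.sndPart_covDeriv hu, covDeriv_congr hV]
    ext k
    simp only [covDeriv, ht, (htan u hu b).2, hF₂ u hu]
    by_cases ha : 1 = a
    · have hp := pd_curve_comp_coord (contDiffAt_deriv (hc₂ u hu)) b k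
      by_cases hb : 1 = b
      · simp only [if_pos ha, if_pos hb, hp, acceleration]
      · simp only [if_pos ha, if_neg hb, hp, Pi.zero_apply, mul_zero, zero_mul,
          Finset.sum_const_zero, add_zero]
    · simp only [if_neg ha, Pi.zero_apply, mul_zero, Finset.sum_const_zero, add_zero, pd_const]
  have hK : ∀ u ∈ U, ∀ a b, ip (𝐆 (F u)) (tangent F a u) (tangent F b u)
      = !![η₁, 0; 0, ε * η₂] a b := by
    intro u hu a b
    rw [ip_prodMetric, (htan u hu a).1, (htan u hu a).2, (htan u hu b).1, (htan u hu b).2,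
      hF₁ u hu, hF₂ u hu]
    have e₁ := hη₁ u hu
    have e₂ := hη₂ u hu
    obtain rfl | rfl := eq_zero_or_eq_one a <;> obtain rfl | rfl := eq_zero_or_eq_one b <;>
      simp [e₁, e₂] <;> simp [ip]
  have hD : ∀ u ∈ U, covDeriv 𝐆 F (tangent F 1) 0 u = 0 := fun u hu =>
    ext_parts (by rw [hpart₁ u hu]; simp; rfl) (by rw [hpart₂ u hu]; simp; rfl)
  obtain ⟨k₁, hk₁⟩ := h.exists_covDeriv_tangent_eq hconv hK (by simp) hD 0
  obtain ⟨k₂, hk₂⟩ := h.exists_covDeriv_tangent_eq hconv hK (by simp) hD 1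
  refine ⟨k₁, k₂, fun u hu => ⟨?_, ?_⟩⟩
  · have := congrArg fstPart (hk₁ u hu)
    rw [hpart₁ u hu, fstPart_smul, fstPart_prodJ, (htan u hu 0).1, hF₁ u hu] at this
    simpa using this
  · have := congrArg sndPart (hk₂ u hu)
    rw [hpart₂ u hu, sndPart_smul, sndPart_prodJ, (htan u hu 1).2, hF₂ u hu] at this
    simpa using this

end IsParallelLagrangian
end Lagrangian
end CoordGeom

/-! ### Local isometries -/

namespace CoordGeom

section CoordinateChange

theorem deriv_component {ι : Type*} [Fintype ι] {c : ℝ → ι → ℝ} {s : ℝ}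
    (hc : DifferentiableAt ℝ c s) (k : ι) : deriv (fun t => c t k) s = deriv c s k := by
  rw [deriv_pi fun i => differentiableAt_pi.1 hc i]

/-- The chain rule along a curve, in coordinates. -/
theorem deriv_comp_curve {ι : Type*} [Fintype ι] [DecidableEq ι] {φ : (ι → ℝ) → ℝ} {c : ℝ → ι → ℝ}
    {s : ℝ} (hφ : DifferentiableAt ℝ φ (c s)) (hc : DifferentiableAt ℝ c s) :
    deriv (fun t => φ (c t)) s = ∑ i, deriv c s i * pd i φ (c s) := by
  have h1 : HasDerivAt (fun t => φ (c t)) (fderiv ℝ φ (c s) (deriv c s)) s :=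
    hφ.hasFDerivAt.comp_hasDerivAt s hc.hasDerivAt
  rw [h1.deriv]
  conv_lhs => rw [pi_eq_sum_univ' (deriv c s)]
  rw [map_sum]
  refine Finset.sum_congr rfl fun k _ => ?_
  rw [map_smul, smul_eq_mul]
  rfl

variable {g g' : (Fin 2 → ℝ) → Matrix (Fin 2) (Fin 2) ℝ} {D D' : Set (Fin 2 → ℝ)}
  {τ : (Fin 2 → ℝ) → Fin 2 → ℝ} {x : Fin 2 → ℝ}

variable (g g' D D' τ) in
/-- The map `τ` is a smooth local isometry from the metric `g` on `D` to the metric `g'`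
on `D'`. -/
structure IsLocalIsometry : Prop where
  dom : IsLorentzOn g D
  cod : IsLorentzOn g' D'
  smooth : ∀ x ∈ D, SmoothAt τ x
  mapsTo : ∀ x ∈ D, τ x ∈ D'
  isom : ∀ x ∈ D, ∀ i j, g x i j = ip (g' (τ x)) (tangent τ i x) (tangent τ j x)

namespace IsLocalIsometry

theorem ip_eq (h : IsLocalIsometry g g' D D' τ) (hx : x ∈ D) (v w : Fin 2 → ℝ) :
    ip (g' (τ x)) (v 0 • tangent τ 0 x + v 1 • tangent τ 1 x)
      (w 0 • tangent τ 0 x + w 1 • tangent τ 1 x) = ip (g x) v w := by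
  rw [ip_fin_two (g x)]
  simp only [ip_add_left, ip_smul_left, ip_add_right, ip_smul_right, h.isom x hx]
  ring

theorem det_eq (h : IsLocalIsometry g g' D D' τ) (hx : x ∈ D) : (g x).det = (g' (τ x)).det *
    (tangent τ 0 x 0 * tangent τ 1 x 1 - tangent τ 0 x 1 * tangent τ 1 x 0) ^ 2 := by
  rw [Matrix.det_fin_two, Matrix.det_fin_two]
  simp only [h.isom x hx, ip_fin_two]
  ring

theorem eq_of_ip_tangent_eq (h : IsLocalIsometry g g' D D' τ) (hx : x ∈ D) {v w : Fin 2 → ℝ}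
    (hvw : ∀ l, ip (g' (τ x)) v (tangent τ l x) = ip (g' (τ x)) w (tangent τ l x)) : v = w := by
  have hd := (h.dom.det_neg x hx).ne
  rw [h.det_eq hx] at hd
  have hd' : (g' (τ x)).det ≠ 0 := left_ne_zero_of_mul hd
  have hΔ : tangent τ 0 x 0 * tangent τ 1 x 1 - tangent τ 0 x 1 * tangent τ 1 x 0 ≠ 0 :=
    fun h0 => hd (by rw [h0]; ring)
  have h0 := hvw 0
  have h1 := hvw 1
  simp only [ip_fin_two] at h0 h1
  set Δ := tangent τ 0 x 0 * tangent τ 1 x 1 - tangent τ 0 x 1 * tangent τ 1 x 0 with hΔdef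
  rw [Matrix.det_fin_two] at hd'
  set d := g' (τ x) 0 0 * g' (τ x) 1 1 - g' (τ x) 0 1 * g' (τ x) 1 0 with hddef
  -- solve the linear system by Cramer's rule
  have hA : (v 0 - w 0) * g' (τ x) 0 0 + (v 1 - w 1) * g' (τ x) 1 0 = 0 := by
    apply (mul_eq_zero.1 (_ : Δ * _ = 0)).resolve_left hΔ
    rw [hΔdef]
    linear_combination (tangent τ 1 x 1) * h0 - (tangent τ 0 x 1) * h1
  have hB : (v 0 - w 0) * g' (τ x) 0 1 + (v 1 - w 1) * g' (τ x) 1 1 = 0 := by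
    apply (mul_eq_zero.1 (_ : Δ * _ = 0)).resolve_left hΔ
    rw [hΔdef]
    linear_combination (tangent τ 0 x 0) * h1 - (tangent τ 1 x 0) * h0
  have hv0 : v 0 - w 0 = 0 := by
    apply (mul_eq_zero.1 (_ : d * _ = 0)).resolve_left hd'
    rw [hddef]
    linear_combination g' (τ x) 1 1 * hA - g' (τ x) 1 0 * hB
  have hv1 : v 1 - w 1 = 0 := by
    apply (mul_eq_zero.1 (_ : d * _ = 0)).resolve_left hd'
    rw [hddef]
    linear_combination g' (τ x) 0 0 * hB - g' (τ x) 0 1 * hA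
  ext k
  obtain rfl | rfl := eq_zero_or_eq_one k <;> linarith

/-- The transformation rule of the Christoffel symbols: both sides satisfy the Koszul formula. -/
theorem covDeriv_tangent (h : IsLocalIsometry g g' D D' τ) (hx : x ∈ D) (i j : Fin 2) :
    covDeriv g' τ (tangent τ j) i x
      = christoffel g 0 i j x • tangent τ 0 x + christoffel g 1 i j x • tangent τ 1 x := by
  have hpd : ∀ l a b, pd l (fun y => g y a b) x
      = ip (g' (τ x)) (covDeriv g' τ (tangent τ a) l x) (tangent τ b x)
        + ip (g' (τ x)) (covDeriv g' τ (tangent τ b) l x) (tangent τ a x) := by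
    intro l a b
    rw [CoordGeom.ip_comm (h.cod.symm _ (h.mapsTo x hx) 1 0) (covDeriv g' τ (tangent τ b) l x),
      ← pd_ip h.cod (h.smooth x hx) (h.mapsTo x hx) ((h.smooth x hx).tangent a)
      ((h.smooth x hx).tangent b)]
    exact pd_congr_of_isOpen h.dom.isOpen (fun y hy => h.isom y hy a b) hx
  refine h.eq_of_ip_tangent_eq hx fun l => ?_
  have hL := h.dom.lower_christoffel hx l i j
  have hcomm := fun a b => covDeriv_tangent_comm h.cod (h.smooth x hx) (h.mapsTo x hx) a b
  rw [hpd, hpd, hpd, hcomm j l, hcomm i l, hcomm j i, Fin.sum_univ_two] at hL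
  rw [ip_add_left, ip_smul_left, ip_smul_left, ← h.isom x hx, ← h.isom x hx,
    h.dom.symm x hx 0 l, h.dom.symm x hx 1 l]
  linarith

theorem deriv_comp (h : IsLocalIsometry g g' D D' τ) {c : ℝ → Fin 2 → ℝ} {s : ℝ}
    (hc : DifferentiableAt ℝ c s) (hs : c s ∈ D) :
    deriv (fun t => τ (c t)) s
      = deriv c s 0 • tangent τ 0 (c s) + deriv c s 1 • tangent τ 1 (c s) := by
  have hτ : DifferentiableAt ℝ τ (c s) := (h.smooth _ hs).contDiffAt.differentiableAt (by simp)
  have hτc : DifferentiableAt ℝ (fun t => τ (c t)) s := hτ.comp s hc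
  ext k
  rw [← deriv_component hτc, deriv_comp_curve ((h.smooth _ hs).differentiableAt k) hc,
    Fin.sum_univ_two]
  rfl

/-- The covariant acceleration of a curve does not depend on the coordinates. -/
theorem acceleration_comp (h : IsLocalIsometry g g' D D' τ) {c : ℝ → Fin 2 → ℝ} {s : ℝ}
    (hc : ContDiffAt ℝ ∞ c s) (hs : c s ∈ D) :
    acceleration g' (fun t => τ (c t)) s
      = acceleration g c s 0 • tangent τ 0 (c s) + acceleration g c s 1 • tangent τ 1 (c s) := by
  have hd : DifferentiableAt ℝ c s := hc.differentiableAt (by simp)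
  have hd' : DifferentiableAt ℝ (deriv c) s := (contDiffAt_deriv hc).differentiableAt (by simp)
  have hev : deriv (fun t => τ (c t)) =ᶠ[𝓝 s]
      fun t => deriv c t 0 • tangent τ 0 (c t) + deriv c t 1 • tangent τ 1 (c t) := by
    have h1 : ∀ᶠ t in 𝓝 s, ContDiffAt ℝ 1 c t := (hc.of_le (by simp)).eventually (by simp)
    filter_upwards [h1, hd.continuousAt.preimage_mem_nhds (h.dom.isOpen.mem_nhds hs)] with t ht ht'
    exact h.deriv_comp (ht.differentiableAt (by simp)) ht'
  have hT : ∀ i k, DifferentiableAt ℝ (fun y => tangent τ i y k) (c s) := fun i k =>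
    ((h.smooth _ hs).tangent i).differentiableAt k
  have hTc : ∀ i k, DifferentiableAt ℝ (fun t => tangent τ i (c t) k) s := fun i k =>
    (hT i k).comp s hd
  have hdc : ∀ i, DifferentiableAt ℝ (fun t => deriv c t i) s := differentiableAt_pi.1 hd'
  have hsec : ∀ k, deriv (deriv (fun t => τ (c t))) s k
      = deriv (deriv c) s 0 * tangent τ 0 (c s) k + deriv (deriv c) s 1 * tangent τ 1 (c s) k
      + ∑ i, ∑ j, deriv c s i * deriv c s j * pd i (fun y => tangent τ j y k) (c s) := by
    intro k
    have hR : DifferentiableAt ℝ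
        (fun t => deriv c t 0 • tangent τ 0 (c t) + deriv c t 1 • tangent τ 1 (c t)) s :=
      differentiableAt_pi.2 fun k =>
        ((hdc 0).fun_mul (hTc 0 k)).fun_add ((hdc 1).fun_mul (hTc 1 k))
    rw [hev.deriv_eq, ← deriv_component hR]
    simp only [Pi.add_apply, Pi.smul_apply, smul_eq_mul]
    rw [deriv_fun_add ((hdc 0).fun_mul (hTc 0 k)) ((hdc 1).fun_mul (hTc 1 k)),
      deriv_fun_mul (hdc 0) (hTc 0 k), deriv_fun_mul (hdc 1) (hTc 1 k),
      deriv_comp_curve (hT 0 k) hd, deriv_comp_curve (hT 1 k) hd, deriv_component hd',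
      deriv_component hd']
    simp only [Fin.sum_univ_two]
    ring
  ext k
  have e := fun i j => congrFun (h.covDeriv_tangent hs i j) k
  simp only [covDeriv_apply, Pi.add_apply, Pi.smul_apply, smul_eq_mul] at e
  simp only [acceleration, hsec, h.deriv_comp hd hs, Fin.sum_univ_two, Pi.add_apply, Pi.smul_apply,
    smul_eq_mul]
  linear_combination deriv c s 0 * deriv c s 0 * e 0 0 + deriv c s 0 * deriv c s 1 * e 0 1
    + deriv c s 1 * deriv c s 0 * e 1 0 + deriv c s 1 * deriv c s 1 * e 1 1

/-- An orientation preserving local isometry intertwines the paracomplex structures. -/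
theorem paracomplex_mulVec (h : IsLocalIsometry g g' D D' τ) (hx : x ∈ D)
    (hpos : 0 < tangent τ 0 x 0 * tangent τ 1 x 1 - tangent τ 0 x 1 * tangent τ 1 x 0)
    (v : Fin 2 → ℝ) :
    paracomplex (g' (τ x)) *ᵥ (v 0 • tangent τ 0 x + v 1 • tangent τ 1 x)
      = (paracomplex (g x) *ᵥ v) 0 • tangent τ 0 x + (paracomplex (g x) *ᵥ v) 1 • tangent τ 1 x := by
  have hdet := h.det_eq hx
  have hd' := h.cod.det_neg _ (h.mapsTo x hx)
  set Δ := tangent τ 0 x 0 * tangent τ 1 x 1 - tangent τ 0 x 1 * tangent τ 1 x 0 with hΔ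
  have hs : Real.sqrt (-(g x).det) = Real.sqrt (-(g' (τ x)).det) * Δ := by
    rw [hdet, ← neg_mul, Real.sqrt_mul (by linarith), Real.sqrt_sq hpos.le]
  have hΔi : Δ * Δ⁻¹ = 1 := mul_inv_cancel₀ hpos.ne'
  have hsy := h.cod.symm _ (h.mapsTo x hx) 1 0
  set σ := (Real.sqrt (-(g' (τ x)).det))⁻¹ with hσ
  ext k
  simp only [Pi.add_apply, Pi.smul_apply, smul_eq_mul, paracomplex_mulVec_zero,
    paracomplex_mulVec_one, hs, mul_inv, ← hσ, h.isom x hx, ip_fin_two, hsy]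
  obtain rfl | rfl := eq_zero_or_eq_one k
  · rw [paracomplex_mulVec_zero, ← hσ]
    simp only [Pi.add_apply, Pi.smul_apply, smul_eq_mul]
    rw [hΔ] at hΔi
    linear_combination (-σ * (-g' (τ x) 0 1 * (v 0 * tangent τ 0 x 0 + v 1 * tangent τ 1 x 0) +
      -g' (τ x) 1 1 * (v 0 * tangent τ 0 x 1 + v 1 * tangent τ 1 x 1))) * hΔi
  · rw [paracomplex_mulVec_one, ← hσ]
    simp only [Pi.add_apply, Pi.smul_apply, smul_eq_mul]
    rw [hΔ] at hΔi
    linear_combination (-σ * (g' (τ x) 0 0 * (v 0 * tangent τ 0 x 0 + v 1 * tangent τ 1 x 0) +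
      g' (τ x) 0 1 * (v 0 * tangent τ 0 x 1 + v 1 * tangent τ 1 x 1))) * hΔi

end IsLocalIsometry
end CoordinateChange
end CoordGeom

/-! ### Charts of Lorentzian surfaces -/

namespace LorentzSurface
open CoordGeom

section Charts

variable {M : Type*} [TopologicalSpace M]

theorem coord_point {e : OpenPartialHomeomorph M Plane} {u : Fin 2 → ℝ} (hu : u ∈ coordDomain e) :
    coord e (point e u) = u := by
  rw [coord, point, e.right_inv hu]

theorem point_coord {e : OpenPartialHomeomorph M Plane} {x : M} (hx : x ∈ e.source) :
    point e (coord e x) = x := by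
  simp [coord, point, e.left_inv hx]

theorem point_mem_source {e : OpenPartialHomeomorph M Plane} {u : Fin 2 → ℝ}
    (hu : u ∈ coordDomain e) : point e u ∈ e.source :=
  e.map_target hu

theorem coord_mem_coordDomain {e : OpenPartialHomeomorph M Plane} {x : M} (hx : x ∈ e.source) :
    coord e x ∈ coordDomain e :=
  e.map_source hx

theorem isOpen_coordDomain (e : OpenPartialHomeomorph M Plane) : IsOpen (coordDomain e) :=
  e.open_target.preimage (PiLp.continuous_toLp 2 _)

variable [ChartedSpace Plane M]

theorem contMDiffAt_coord {e : OpenPartialHomeomorph M Plane}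
    (he : e ∈ IsManifold.maximalAtlas (𝓡 2) ∞ M) {x : M} (hx : x ∈ e.source) :
    ContMDiffAt (𝓡 2) 𝓘(ℝ, Fin 2 → ℝ) ∞ (coord e) x :=
  ((PiLp.continuousLinearEquiv 2 ℝ (fun _ : Fin 2 => ℝ)).contDiff.contMDiff.contMDiffAt).comp x
    (contMDiffAt_of_mem_maximalAtlas he hx)

theorem contMDiffAt_point {e : OpenPartialHomeomorph M Plane}
    (he : e ∈ IsManifold.maximalAtlas (𝓡 2) ∞ M) {u : Fin 2 → ℝ} (hu : u ∈ coordDomain e) :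
    ContMDiffAt 𝓘(ℝ, Fin 2 → ℝ) (𝓡 2) ∞ (point e) u :=
  ContMDiffAt.comp u (contMDiffAt_symm_of_mem_maximalAtlas he hu)
    ((PiLp.continuousLinearEquiv 2 ℝ (fun _ : Fin 2 => ℝ)).symm.contDiff.contMDiff.contMDiffAt)

/-- The differential of the parametrization `point e` has the coordinate vectors as columns. -/
theorem mfderiv_point {e : OpenPartialHomeomorph M Plane}
    (he : e ∈ IsManifold.maximalAtlas (𝓡 2) ∞ M) {u : Fin 2 → ℝ} (hu : u ∈ coordDomain e)
    (v : Fin 2 → ℝ) :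
    mfderiv 𝓘(ℝ, Fin 2 → ℝ) (𝓡 2) (point e) u v
      = (v 0 • (coordVector e 0 u : Plane) + v 1 • (coordVector e 1 u : Plane) : Plane) := by
  have h1 : MDifferentiableAt (𝓡 2) (𝓡 2) e.symm (WithLp.toLp 2 u) :=
    (contMDiffAt_symm_of_mem_maximalAtlas he hu).mdifferentiableAt (by simp)
  have h2 : HasMFDerivAt 𝓘(ℝ, Fin 2 → ℝ) (𝓡 2) (fun u : Fin 2 → ℝ => WithLp.toLp 2 u) u
      ((PiLp.continuousLinearEquiv 2 ℝ (fun _ : Fin 2 => ℝ)).symm : (Fin 2 → ℝ) →L[ℝ] Plane) :=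
    ((PiLp.continuousLinearEquiv 2 ℝ (fun _ : Fin 2 => ℝ)).symm.hasFDerivAt).hasMFDerivAt
  have h3 := (h1.hasMFDerivAt.comp u h2).mfderiv
  have h4 : (e.symm ∘ fun u : Fin 2 → ℝ => WithLp.toLp 2 u) = point e := rfl
  rw [h4] at h3
  rw [h3]
  have h5 : ∀ L : Plane →L[ℝ] Plane, L (WithLp.toLp 2 v)
      = v 0 • L (EuclideanSpace.single 0 (1 : ℝ)) + v 1 • L (EuclideanSpace.single 1 (1 : ℝ)) := by
    intro L
    rw [← map_smul, ← map_smul, ← map_add]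
    congr 1
    ext k
    obtain rfl | rfl := eq_zero_or_eq_one k <;> simp
  exact h5 (mfderiv (𝓡 2) (𝓡 2) e.symm (WithLp.toLp 2 u))

/-- Every tangent vector is a combination of the coordinate vectors. -/
theorem exists_eq_sum_coordVector {e : OpenPartialHomeomorph M Plane}
    (he : e ∈ IsManifold.maximalAtlas (𝓡 2) ∞ M) {u : Fin 2 → ℝ} (hu : u ∈ coordDomain e)
    (v : TangentSpace (𝓡 2) (point e u)) :
    ∃ w : Fin 2 → ℝ, v = w 0 • coordVector e 0 u + w 1 • coordVector e 1 u := by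
  have hx := point_mem_source hu
  have h1 : MDifferentiableAt (𝓡 2) 𝓘(ℝ, Fin 2 → ℝ) (coord e) (point e u) :=
    (contMDiffAt_coord he hx).mdifferentiableAt (by simp)
  have h2 : ∀ y, y = u → HasMFDerivAt 𝓘(ℝ, Fin 2 → ℝ) (𝓡 2) (point e) y
      (mfderiv 𝓘(ℝ, Fin 2 → ℝ) (𝓡 2) (point e) u : (Fin 2 → ℝ) →L[ℝ] Plane) := by
    rintro _ rfl
    exact ((contMDiffAt_point he hu).mdifferentiableAt (by simp)).hasMFDerivAt
  have h3 := (h2 _ (coord_point hu)).comp _ h1.hasMFDerivAt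
  have h4 : point e ∘ coord e =ᶠ[𝓝 (point e u)] id := by
    filter_upwards [e.open_source.mem_nhds hx] with y hy using point_coord hy
  have h5 := hasMFDerivAt_unique h3 ((hasMFDerivAt_id (I := 𝓡 2) (point e u)).congr_of_eventuallyEq h4)
  have h6 := DFunLike.congr_fun h5 v
  refine ⟨mfderiv (𝓡 2) 𝓘(ℝ, Fin 2 → ℝ) (coord e) (point e u) v, ?_⟩
  refine Eq.trans ?_ (mfderiv_point he hu _)
  exact h6.symm

variable [IsManifold (𝓡 2) ∞ M]

theorem mem_maximalAtlas {e : OpenPartialHomeomorph M Plane} (he : e ∈ atlas Plane M) :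
    e ∈ IsManifold.maximalAtlas (𝓡 2) ∞ M :=
  IsManifold.subset_maximalAtlas he

theorem det_neg_of_indefinite {A : Matrix (Fin 2) (Fin 2) ℝ} (hs : A 1 0 = A 0 1)
    {v w : Fin 2 → ℝ} (hv : 0 < ip A v v) (hw : ip A w w < 0) : A.det < 0 := by
  rw [ip_fin_two, hs] at hv hw
  rw [Matrix.det_fin_two, hs]
  by_contra! hd
  have h0 : A 0 0 = 0 := by
    rcases lt_trichotomy (A 0 0) 0 with h | h | h
    · nlinarith [sq_nonneg (A 0 0 * v 0 + A 0 1 * v 1), mul_nonneg hd (sq_nonneg (v 1))]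
    · exact h
    · nlinarith [sq_nonneg (A 0 0 * w 0 + A 0 1 * w 1), mul_nonneg hd (sq_nonneg (w 1))]
  have h01 : A 0 1 = 0 := by
    rw [h0] at hd
    nlinarith
  rw [h0, h01] at hv hw
  have h11 : 0 < A 1 1 := by
    by_contra! h
    nlinarith [mul_nonneg (neg_nonneg.2 h) (sq_nonneg (v 1))]
  nlinarith [mul_nonneg h11.le (sq_nonneg (w 1))]

theorem LorentzMetric.isLorentzOn (g : LorentzMetric M) {e : OpenPartialHomeomorph M Plane}
    (he : e ∈ atlas Plane M) : IsLorentzOn (g.components e) (coordDomain e) where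
  isOpen := isOpen_coordDomain e
  smooth := g.smooth e he
  symm := fun u _ i j => g.symm _ _ _
  det_neg := fun u hu => by
    obtain ⟨v, hv⟩ := g.exists_pos (point e u)
    obtain ⟨w, hw⟩ := g.exists_neg (point e u)
    obtain ⟨a, ha⟩ := exists_eq_sum_coordVector (mem_maximalAtlas he) hu v
    obtain ⟨b, hb⟩ := exists_eq_sum_coordVector (mem_maximalAtlas he) hu w
    have key : ∀ a : Fin 2 → ℝ, g.inner (point e u) (a 0 • coordVector e 0 u + a 1 • coordVector e 1 u)
        (a 0 • coordVector e 0 u + a 1 • coordVector e 1 u) = ip (g.components e u) a a := by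
      intro a
      rw [ip_fin_two]
      simp only [map_add, map_smul, LinearMap.add_apply, LinearMap.smul_apply, smul_eq_mul,
        LorentzMetric.components, Matrix.of_apply]
      ring
    refine det_neg_of_indefinite (g.symm _ _ _) (v := a) (w := b) ?_ ?_
    · rw [← key, ← ha]; exact hv
    · rw [← key, ← hb]; exact hw

end Charts
end LorentzSurface

/-! ### Transition maps and local expressions -/

namespace LorentzSurface
open CoordGeom

section Transition

variable {M : Type*} [TopologicalSpace M]

/-- The transition map from the coordinates of `e` to those of `e'`. -/
def transition (e e' : OpenPartialHomeomorph M Plane) (u : Fin 2 → ℝ) : Fin 2 → ℝ :=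
  coord e' (point e u)

/-- The domain of the transition map from the coordinates of `e` to those of `e'`. -/
def transitionDomain (e e' : OpenPartialHomeomorph M Plane) : Set (Fin 2 → ℝ) :=
  {u | WithLp.toLp 2 u ∈ (e.symm.trans e').source}

theorem mem_transitionDomain {e e' : OpenPartialHomeomorph M Plane} {u : Fin 2 → ℝ} :
    u ∈ transitionDomain e e' ↔ u ∈ coordDomain e ∧ point e u ∈ e'.source := by
  simp [transitionDomain, coordDomain, point]

theorem isOpen_transitionDomain (e e' : OpenPartialHomeomorph M Plane) :
    IsOpen (transitionDomain e e') :=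
  (e.symm.trans e').open_source.preimage (PiLp.continuous_toLp 2 _)

theorem LorentzMetric.inner_congr [ChartedSpace Plane M] (g : LorentzMetric M) {x y : M}
    (h : x = y) (v w : Plane) : g.inner x v w = g.inner y v w := by
  subst h; rfl

variable [ChartedSpace Plane M] [IsManifold (𝓡 2) ∞ M]

theorem smoothAt_transition {e e' : OpenPartialHomeomorph M Plane} (he : e ∈ atlas Plane M)
    (he' : e' ∈ atlas Plane M) {u : Fin 2 → ℝ} (hu : u ∈ transitionDomain e e') :
    SmoothAt (transition e e') u := by
  obtain ⟨h1, h2⟩ := mem_transitionDomain.1 hu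
  have h := (contMDiffAt_coord (mem_maximalAtlas he') h2).comp u
    (contMDiffAt_point (mem_maximalAtlas he) h1)
  exact contDiffAt_pi.1 (contMDiffAt_iff_contDiffAt.1 h)

theorem coordVector_eq_sum {e e' : OpenPartialHomeomorph M Plane} (he : e ∈ atlas Plane M)
    (he' : e' ∈ atlas Plane M) {u : Fin 2 → ℝ} (hu : u ∈ transitionDomain e e') (i : Fin 2) :
    (coordVector e i u : Plane)
      = (tangent (transition e e') i u 0 • (coordVector e' 0 (transition e e' u) : Plane)
        + tangent (transition e e') i u 1 • (coordVector e' 1 (transition e e' u) : Plane) :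
          Plane) := by
  obtain ⟨h1, h2⟩ := mem_transitionDomain.1 hu
  have hτ : DifferentiableAt ℝ (transition e e') u :=
    (smoothAt_transition he he' hu).contDiffAt.differentiableAt (by simp)
  have hmem : transition e e' u ∈ coordDomain e' := coord_mem_coordDomain h2
  have h3 : HasMFDerivAt 𝓘(ℝ, Fin 2 → ℝ) (𝓡 2) (point e') (transition e e' u) _ :=
    ((contMDiffAt_point (mem_maximalAtlas he') hmem).mdifferentiableAt (by simp)).hasMFDerivAt
  have h4 := h3.comp u hτ.hasFDerivAt.hasMFDerivAt
  have h5 : point e' ∘ transition e e' =ᶠ[𝓝 u] point e := by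
    filter_upwards [(isOpen_transitionDomain e e').mem_nhds hu] with w hw
    exact point_coord (mem_transitionDomain.1 hw).2
  have h6 := (h4.congr_of_eventuallyEq h5.symm).mfderiv
  have h7 := DFunLike.congr_fun h6 (Pi.single i (1 : ℝ) : Fin 2 → ℝ)
  have h8 := mfderiv_point (mem_maximalAtlas he) h1 (Pi.single i 1)
  have h9 := mfderiv_point (mem_maximalAtlas he') hmem (tangent (transition e e') i u)
  rw [tangent_eq_fderiv hτ] at h9 ⊢
  have h10 : (coordVector e i u : Plane) = ((Pi.single i 1 : Fin 2 → ℝ) 0 • (coordVector e 0 u : Plane)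
      + (Pi.single i 1 : Fin 2 → ℝ) 1 • (coordVector e 1 u : Plane) : Plane) := by
    obtain rfl | rfl := eq_zero_or_eq_one i <;> simp
  exact h10.trans (h8.symm.trans (h7.trans h9))

/-- Transition maps are isometries for the components of a metric. -/
theorem LorentzMetric.isLocalIsometry_transition (g : LorentzMetric M)
    {e e' : OpenPartialHomeomorph M Plane} (he : e ∈ atlas Plane M) (he' : e' ∈ atlas Plane M) :
    IsLocalIsometry (g.components e) (g.components e') (transitionDomain e e') (coordDomain e')
      (transition e e') where
  dom :=
    { isOpen := isOpen_transitionDomain e e'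
      smooth := fun i j => ((g.isLorentzOn he).smooth i j).mono
        fun _ hu => (mem_transitionDomain.1 hu).1
      symm := fun u hu => (g.isLorentzOn he).symm u (mem_transitionDomain.1 hu).1
      det_neg := fun u hu => (g.isLorentzOn he).det_neg u (mem_transitionDomain.1 hu).1 }
  cod := g.isLorentzOn he'
  smooth := fun _ hu => smoothAt_transition he he' hu
  mapsTo := fun _ hu => coord_mem_coordDomain (mem_transitionDomain.1 hu).2
  isom := fun u hu i j => by
    have hx : point e u = point e' (transition e e' u) :=
      (point_coord (mem_transitionDomain.1 hu).2).symm
    have h1 : g.components e u i j = g.inner (point e' (transition e e' u))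
        (coordVector e i u : Plane) (coordVector e j u : Plane) := g.inner_congr hx _ _
    rw [h1, coordVector_eq_sum he he' hu i, coordVector_eq_sum he he' hu j, ip_fin_two]
    have key : ∀ (B : LinearMap.BilinForm ℝ Plane) (a b : Fin 2 → ℝ) (v w : Plane),
        B (a 0 • v + a 1 • w) (b 0 • v + b 1 • w)
          = a 0 * (B v v * b 0 + B v w * b 1) + a 1 * (B w v * b 0 + B w w * b 1) := by
      intro B a b v w
      simp only [map_add, map_smul, LinearMap.add_apply, LinearMap.smul_apply, smul_eq_mul]
      ring
    exact key _ _ _ _ _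

/-- In an oriented atlas the transition maps have positive Jacobian determinant. -/
theorem transition_det_pos (hM : IsOrientedAtlas M) {e e' : OpenPartialHomeomorph M Plane}
    (he : e ∈ atlas Plane M) (he' : e' ∈ atlas Plane M) {u : Fin 2 → ℝ}
    (hu : u ∈ transitionDomain e e') :
    0 < tangent (transition e e') 0 u 0 * tangent (transition e e') 1 u 1
      - tangent (transition e e') 0 u 1 * tangent (transition e e') 1 u 0 := by
  have h := hM e he e' he' (WithLp.toLp 2 u) hu
  have hτ : DifferentiableAt ℝ (transition e e') u :=
    (smoothAt_transition he he' hu).contDiffAt.differentiableAt (by simp)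
  let L := PiLp.continuousLinearEquiv 2 ℝ (fun _ : Fin 2 => ℝ)
  have h1 : HasFDerivAt (e' ∘ e.symm)
      ((L.symm : (Fin 2 → ℝ) →L[ℝ] Plane).comp
        ((fderiv ℝ (transition e e') u).comp (L : Plane →L[ℝ] (Fin 2 → ℝ)))) (WithLp.toLp 2 u) := by
    have a1 : HasFDerivAt (fun y : Plane => L y) (L : Plane →L[ℝ] (Fin 2 → ℝ)) (WithLp.toLp 2 u) :=
      L.hasFDerivAt
    have a2 : HasFDerivAt (transition e e') (fderiv ℝ (transition e e') u)
      (L (WithLp.toLp 2 u)) := hτ.hasFDerivAt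
    exact (L.symm.hasFDerivAt.comp _ (a2.comp _ a1))
  rw [h1.fderiv] at h
  have h2 : ((L.symm : (Fin 2 → ℝ) →L[ℝ] Plane).comp
      ((fderiv ℝ (transition e e') u).comp (L : Plane →L[ℝ] (Fin 2 → ℝ)))).det
      = LinearMap.det ((fderiv ℝ (transition e e') u : (Fin 2 → ℝ) →L[ℝ] (Fin 2 → ℝ)) :
        (Fin 2 → ℝ) →ₗ[ℝ] (Fin 2 → ℝ)) :=
    LinearMap.det_conj _ L.symm.toLinearEquiv
  rw [h2, ← LinearMap.det_toMatrix', Matrix.det_fin_two] at h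
  simp only [LinearMap.toMatrix'_apply] at h
  rw [tangent_eq_fderiv hτ, tangent_eq_fderiv hτ]
  simp only [ContinuousLinearMap.coe_coe] at h
  linarith

end Transition

section LocalExpr

variable {M₁ M₂ S : Type*} [TopologicalSpace M₁] [TopologicalSpace M₂] [TopologicalSpace S]

/-- The set of coordinate values at which the local expression of `Φ` is defined. -/
def localDomain (Φ : S → M₁ × M₂) (e : OpenPartialHomeomorph S Plane)
    (e₁ : OpenPartialHomeomorph M₁ Plane) (e₂ : OpenPartialHomeomorph M₂ Plane) :
    Set (Fin 2 → ℝ) :=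
  {u | u ∈ coordDomain e ∧ (Φ (point e u)).1 ∈ e₁.source ∧ (Φ (point e u)).2 ∈ e₂.source}

theorem isOpen_localDomain {Φ : S → M₁ × M₂} (hΦ : Continuous Φ) (e : OpenPartialHomeomorph S Plane)
    (e₁ : OpenPartialHomeomorph M₁ Plane) (e₂ : OpenPartialHomeomorph M₂ Plane) :
    IsOpen (localDomain Φ e e₁ e₂) := by
  have h : ContinuousOn (point e) (coordDomain e) :=
    e.continuousOn_symm.comp (PiLp.continuous_toLp 2 _).continuousOn fun _ hu => hu
  have := (hΦ.comp_continuousOn h).isOpen_inter_preimage (isOpen_coordDomain e)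
    (e₁.open_source.prod e₂.open_source)
  exact this

variable [ChartedSpace Plane M₁] [IsManifold (𝓡 2) ∞ M₁] [ChartedSpace Plane M₂]
  [IsManifold (𝓡 2) ∞ M₂] [ChartedSpace Plane S]

theorem isParallelLagrangian_localExpr {ε : ℝ} (hε : ε = 1 ∨ ε = -1) {g₁ : LorentzMetric M₁}
    {g₂ : LorentzMetric M₂} {Φ : S → M₁ × M₂}
    (hΦ : ContMDiff (𝓡 2) ((𝓡 2).prod (𝓡 2)) ∞ Φ) (hlag : IsLagrangian ε g₁ g₂ Φ)
    (hnondeg : IsNondegenerate ε g₁ g₂ Φ) (hpar : HasParallelMeanCurvature ε g₁ g₂ Φ)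
    {e : OpenPartialHomeomorph S Plane} (he : e ∈ IsManifold.maximalAtlas (𝓡 2) ∞ S)
    {e₁ : OpenPartialHomeomorph M₁ Plane} (he₁ : e₁ ∈ atlas Plane M₁)
    {e₂ : OpenPartialHomeomorph M₂ Plane} (he₂ : e₂ ∈ atlas Plane M₂) :
    IsParallelLagrangian ε (g₁.components e₁) (g₂.components e₂) (coordDomain e₁) (coordDomain e₂)
      (localExpr Φ e e₁ e₂) (localDomain Φ e e₁ e₂) where
  sign := by rcases hε with rfl | rfl <;> norm_num
  fst := g₁.isLorentzOn he₁
  snd := g₂.isLorentzOn he₂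
  isOpen := isOpen_localDomain hΦ.continuous e e₁ e₂
  smooth := fun u hu => by
    have hp := contMDiffAt_point he hu.1
    have h1 := hΦ.contMDiffAt.comp u hp
    rw [smoothAt_iff_parts]
    constructor
    · have := (contMDiffAt_coord (mem_maximalAtlas he₁) hu.2.1).comp u
        (contMDiffAt_fst.comp u h1)
      exact contDiffAt_pi.1 (contMDiffAt_iff_contDiffAt.1 this)
    · have := (contMDiffAt_coord (mem_maximalAtlas he₂) hu.2.2).comp u
        (contMDiffAt_snd.comp u h1)
      exact contDiffAt_pi.1 (contMDiffAt_iff_contDiffAt.1 this)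
  fst_mem := fun u hu => coord_mem_coordDomain hu.2.1
  snd_mem := fun u hu => coord_mem_coordDomain hu.2.2
  lagrangian := fun u hu => by
    have := hlag e he e₁ he₁ e₂ he₂ (point e u) (point_mem_source hu.1) hu.2.1 hu.2.2
    rwa [coord_point hu.1] at this
  nondeg := fun u hu => by
    have := hnondeg e he e₁ he₁ e₂ he₂ (point e u) (point_mem_source hu.1) hu.2.1 hu.2.2
    rwa [coord_point hu.1] at this
  parallel := fun u hu => by
    have := hpar e he e₁ he₁ e₂ he₂ (point e u) (point_mem_source hu.1) hu.2.1 hu.2.2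
    rwa [coord_point hu.1] at this

end LocalExpr
end LorentzSurface

/-! ### Degeneracy of the projections -/

namespace CoordGeom

/-- The Jacobian determinant of a map between open sets of the plane. -/
def jacobian (f : (Fin 2 → ℝ) → Fin 2 → ℝ) (u : Fin 2 → ℝ) : ℝ :=
  tangent f 0 u 0 * tangent f 1 u 1 - tangent f 0 u 1 * tangent f 1 u 0

theorem tangent_congr {ι : Type*} {f f' : (Fin 2 → ℝ) → ι → ℝ} {u : Fin 2 → ℝ}
    (h : f =ᶠ[𝓝 u] f') (a : Fin 2) : tangent f a u = tangent f' a u :=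
  funext fun k => pd_congr (h.mono fun _ hw => congrFun hw k)

theorem jacobian_congr {f f' : (Fin 2 → ℝ) → Fin 2 → ℝ} {u : Fin 2 → ℝ} (h : f =ᶠ[𝓝 u] f') :
    jacobian f u = jacobian f' u := by
  rw [jacobian, jacobian, tangent_congr h, tangent_congr h]

theorem SmoothAt.contDiffAt_jacobian {f : (Fin 2 → ℝ) → Fin 2 → ℝ} {u : Fin 2 → ℝ}
    (hf : SmoothAt f u) : ContDiffAt ℝ ∞ (jacobian f) u :=
  (((hf.tangent 0) 0).mul ((hf.tangent 1) 1)).sub (((hf.tangent 0) 1).mul ((hf.tangent 1) 0))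

theorem jacobian_comp {τ f : (Fin 2 → ℝ) → Fin 2 → ℝ} {u : Fin 2 → ℝ} (hτ : SmoothAt τ (f u))
    (hf : SmoothAt f u) : jacobian (fun w => τ (f w)) u = jacobian τ (f u) * jacobian f u := by
  have h : ∀ a k, tangent (fun w => τ (f w)) a u k
      = tangent f a u 0 * tangent τ 0 (f u) k + tangent f a u 1 * tangent τ 1 (f u) k := by
    intro a k
    have := pd_comp (a := a) (f := fun x => τ x k) (hτ.differentiableAt k) hf.differentiableAt
    rw [Fin.sum_univ_two] at this
    have h2 : tangent (fun w => τ (f w)) a u k = pd a (fun w => τ (f w) k) u := rfl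
    rw [h2, this]
    unfold tangent
    ring
  simp only [jacobian, h]
  ring

theorem fderiv_eq_sum_tangent {f : (Fin 2 → ℝ) → Fin 2 → ℝ} {u : Fin 2 → ℝ}
    (hf : DifferentiableAt ℝ f u) (v : Fin 2 → ℝ) :
    fderiv ℝ f u v = v 0 • tangent f 0 u + v 1 • tangent f 1 u := by
  rw [tangent_eq_fderiv hf, tangent_eq_fderiv hf, ← map_smul, ← map_smul, ← map_add]
  congr 1
  ext k
  obtain rfl | rfl := eq_zero_or_eq_one k <;> simp

theorem bijective_fderiv_of_jacobian_ne_zero {f : (Fin 2 → ℝ) → Fin 2 → ℝ} {u : Fin 2 → ℝ}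
    (hf : DifferentiableAt ℝ f u) (h : jacobian f u ≠ 0) : Function.Bijective (fderiv ℝ f u) := by
  have hinj : Function.Injective (fderiv ℝ f u) := by
    rw [injective_iff_map_eq_zero]
    intro v hv
    rw [fderiv_eq_sum_tangent hf] at hv
    have h0 := congrFun hv 0
    have h1 := congrFun hv 1
    simp only [Pi.add_apply, Pi.smul_apply, smul_eq_mul, Pi.zero_apply] at h0 h1
    ext k
    suffices hk : jacobian f u * v k = 0 from (mul_eq_zero.1 hk).resolve_left h
    obtain rfl | rfl := eq_zero_or_eq_one k
    · rw [jacobian]; linear_combination tangent f 1 u 1 * h0 - tangent f 1 u 0 * h1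
    · rw [jacobian]; linear_combination tangent f 0 u 0 * h1 - tangent f 0 u 1 * h0
  exact ⟨hinj, LinearMap.injective_iff_surjective.1 hinj⟩

/-- A map with nonzero Jacobian determinant sends neighbourhoods to sets of positive area. -/
theorem volume_image_pos_of_jacobian_ne_zero {f : (Fin 2 → ℝ) → Fin 2 → ℝ} {u : Fin 2 → ℝ}
    (hf : SmoothAt f u) (h : jacobian f u ≠ 0) {W : Set (Fin 2 → ℝ)} (hW : W ∈ 𝓝 u) :
    0 < MeasureTheory.volume (f '' W) := by
  have hs : HasStrictFDerivAt f (fderiv ℝ f u) u := hf.contDiffAt.hasStrictFDerivAt (by simp)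
  have hsurj := (bijective_fderiv_of_jacobian_ne_zero hs.differentiableAt h).surjective
  have := hs.map_nhds_eq_of_surj (LinearMap.range_eq_top.2 hsurj)
  refine MeasureTheory.Measure.measure_pos_of_mem_nhds _ (x := f u) ?_
  rw [← this]
  exact Filter.image_mem_map hW

section Lagrangian

variable {ε : ℝ} {g₁ g₂ : (Fin 2 → ℝ) → Matrix (Fin 2) (Fin 2) ℝ} {D₁ D₂ : Set (Fin 2 → ℝ)}
  {F : (Fin 2 → ℝ) → Fin 2 ⊕ Fin 2 → ℝ} {u : Fin 2 → ℝ} {U : Set (Fin 2 → ℝ)}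

theorem IsLorentzOn.kaehler_eq_zero_iff {g : (Fin 2 → ℝ) → Matrix (Fin 2) (Fin 2) ℝ}
    {D : Set (Fin 2 → ℝ)} (hg : IsLorentzOn g D) {x : Fin 2 → ℝ} (hx : x ∈ D) (v w : Fin 2 → ℝ) :
    ip (g x) (paracomplex (g x) *ᵥ v) w = 0 ↔ v 0 * w 1 - v 1 * w 0 = 0 := by
  have hd := hg.det_neg x hx
  rw [ip_paracomplex (hg.symm x hx 1 0)]
  have h1 : (Real.sqrt (-(g x).det))⁻¹ ≠ 0 := inv_ne_zero (Real.sqrt_pos.2 (by linarith)).ne'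
  simp [h1, hd.ne]

namespace IsParallelLagrangian

theorem kaehler_add_eq_zero (h : IsParallelLagrangian ε g₁ g₂ D₁ D₂ F U) (hu : u ∈ U) :
    ip (g₁ (fstPart (F u))) (paracomplex (g₁ (fstPart (F u))) *ᵥ fstPart (tangent F 0 u))
      (fstPart (tangent F 1 u))
    + ε * ip (g₂ (sndPart (F u))) (paracomplex (g₂ (sndPart (F u))) *ᵥ sndPart (tangent F 0 u))
      (sndPart (tangent F 1 u)) = 0 := by
  rw [← pullback_prodForm, h.lagrangian u hu, Matrix.zero_apply]

/-- The two projections of a Lagrangian surface degenerate at the same points. -/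
theorem jacobian_fst_eq_zero_iff (h : IsParallelLagrangian ε g₁ g₂ D₁ D₂ F U) (hu : u ∈ U) :
    jacobian (fun w => fstPart (F w)) u = 0 ↔ jacobian (fun w => sndPart (F w)) u = 0 := by
  have h0 := h.kaehler_add_eq_zero hu
  have hε : ε ≠ 0 := fun h0 => by simpa [h0] using h.sign
  refine (h.fst.kaehler_eq_zero_iff (h.fst_mem u hu) (fstPart (tangent F 0 u))
    (fstPart (tangent F 1 u))).symm.trans (Iff.trans ?_
    (h.snd.kaehler_eq_zero_iff (h.snd_mem u hu) (sndPart (tangent F 0 u))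
    (sndPart (tangent F 1 u))))
  constructor <;> intro h1
  · rw [h1, zero_add] at h0
    exact (mul_eq_zero.1 h0).resolve_left hε
  · rwa [h1, mul_zero, add_zero] at h0

/-- Where the projections to the factors are local diffeomorphisms, they match the curvatures
up to the sign `ε`. -/
theorem gaussCurvature_eq (h : IsParallelLagrangian ε g₁ g₂ D₁ D₂ F U) (hu : u ∈ U)
    (hne : jacobian (fun w => fstPart (F w)) u ≠ 0) :
    gaussCurvature g₂ (sndPart (F u)) = ε * gaussCurvature g₁ (fstPart (F u)) := by
  have h0 := h.kaehler_add_eq_zero hu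
  have h1 := h.curvature_relation hu
  have h2 : ip (g₂ (sndPart (F u))) (paracomplex (g₂ (sndPart (F u))) *ᵥ sndPart (tangent F 0 u))
      (sndPart (tangent F 1 u)) ≠ 0 := fun h2 => hne ((h.jacobian_fst_eq_zero_iff hu).2
        ((h.snd.kaehler_eq_zero_iff (h.snd_mem u hu) _ _).1 h2))
  rw [eq_neg_of_add_eq_zero_left h0] at h1
  apply mul_right_cancel₀ h2
  linear_combination h1

end IsParallelLagrangian
end Lagrangian
end CoordGeom

namespace LorentzSurface
open CoordGeom

variable {M₁ M₂ S : Type*} [TopologicalSpace M₁] [TopologicalSpace M₂] [TopologicalSpace S]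
  [ChartedSpace Plane M₁] [IsManifold (𝓡 2) ∞ M₁] [ChartedSpace Plane M₂]
  [IsManifold (𝓡 2) ∞ M₂] [ChartedSpace Plane S]
  {ε : ℝ} {g₁ : LorentzMetric M₁} {g₂ : LorentzMetric M₂} {Φ : S → M₁ × M₂}
  {e : OpenPartialHomeomorph S Plane} {e₁ : OpenPartialHomeomorph M₁ Plane}
  {e₂ : OpenPartialHomeomorph M₂ Plane} {u : Fin 2 → ℝ}

/-- The curvatures of the factors match at points where the projections to the factors are local
diffeomorphisms. -/
theorem curvature_snd_eq (hM₁ : IsOrientedAtlas M₁) (hε : ε = 1 ∨ ε = -1)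
    (hΦ : ContMDiff (𝓡 2) ((𝓡 2).prod (𝓡 2)) ∞ Φ) (hlag : IsLagrangian ε g₁ g₂ Φ)
    (hnondeg : IsNondegenerate ε g₁ g₂ Φ) (hpar : HasParallelMeanCurvature ε g₁ g₂ Φ)
    (he : e ∈ IsManifold.maximalAtlas (𝓡 2) ∞ S) (he₁ : e₁ ∈ atlas Plane M₁)
    (he₂ : e₂ ∈ atlas Plane M₂) (hu : u ∈ localDomain Φ e e₁ e₂)
    (hne : jacobian (fun w => fstPart (localExpr Φ e e₁ e₂ w)) u ≠ 0) :
    g₂.curvature (Φ (point e u)).2 = ε * g₁.curvature (Φ (point e u)).1 := by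
  -- the curvatures are defined by means of the preferred charts at the two points
  set e₁' := chartAt Plane (Φ (point e u)).1 with he₁'
  set e₂' := chartAt Plane (Φ (point e u)).2 with he₂'
  have hu' : u ∈ localDomain Φ e e₁' e₂' :=
    ⟨hu.1, mem_chart_source _ _, mem_chart_source _ _⟩
  have h := isParallelLagrangian_localExpr hε hΦ hlag hnondeg hpar he he₁ he₂
  have h' := isParallelLagrangian_localExpr hε hΦ hlag hnondeg hpar he (chart_mem_atlas Plane _)
    (chart_mem_atlas Plane _) (e₁ := e₁') (e₂ := e₂')
  refine h'.gaussCurvature_eq hu' ?_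
  have hev : (fun w => fstPart (localExpr Φ e e₁' e₂' w)) =ᶠ[𝓝 u]
      fun w => transition e₁ e₁' (fstPart (localExpr Φ e e₁ e₂ w)) := by
    filter_upwards [h.eventually hu] with w hw
    exact congrArg (coord e₁') (point_coord hw.2.1).symm
  have hmem : fstPart (localExpr Φ e e₁ e₂ u) ∈ transitionDomain e₁ e₁' := by
    refine mem_transitionDomain.2 ⟨coord_mem_coordDomain hu.2.1, ?_⟩
    have : point e₁ (fstPart (localExpr Φ e e₁ e₂ u)) = (Φ (point e u)).1 := point_coord hu.2.1
    rw [this]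
    exact mem_chart_source _ _
  rw [jacobian_congr hev, jacobian_comp
    (smoothAt_transition he₁ (chart_mem_atlas Plane _) hmem) (h.smooth_fst hu)]
  exact mul_ne_zero (transition_det_pos hM₁ he₁ (chart_mem_atlas Plane _) hmem).ne' hne

/-- If the projections to the factors were local diffeomorphisms somewhere, both factors would be
flat on open sets. -/
theorem jacobian_fst_localExpr_eq_zero (hM₁ : IsOrientedAtlas M₁) (hε : ε = 1 ∨ ε = -1)
    (hcurv : (g₁.NonFlatAE ∧ g₂.NonFlatAE ∧
        ∀ (x : M₁) (y : M₂), g₁.curvature x ≠ 0 → g₂.curvature y ≠ 0 →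
          ε * g₁.curvature x * g₂.curvature y < 0) ∨
      (g₁.IsFlat ∧ g₂.NonFlatAE) ∨ (g₂.IsFlat ∧ g₁.NonFlatAE))
    (hΦ : ContMDiff (𝓡 2) ((𝓡 2).prod (𝓡 2)) ∞ Φ) (hlag : IsLagrangian ε g₁ g₂ Φ)
    (hnondeg : IsNondegenerate ε g₁ g₂ Φ) (hpar : HasParallelMeanCurvature ε g₁ g₂ Φ)
    (he : e ∈ IsManifold.maximalAtlas (𝓡 2) ∞ S) (he₁ : e₁ ∈ atlas Plane M₁)
    (he₂ : e₂ ∈ atlas Plane M₂) (hu : u ∈ localDomain Φ e e₁ e₂) :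
    jacobian (fun w => fstPart (localExpr Φ e e₁ e₂ w)) u = 0 := by
  by_contra hne
  have h := isParallelLagrangian_localExpr hε hΦ hlag hnondeg hpar he he₁ he₂
  set F := localExpr Φ e e₁ e₂ with hF
  have hne₂ : jacobian (fun w => sndPart (F w)) u ≠ 0 :=
    fun h0 => hne ((h.jacobian_fst_eq_zero_iff hu).2 h0)
  set W : Set (Fin 2 → ℝ) :=
    {w | w ∈ localDomain Φ e e₁ e₂ ∧ jacobian (fun w => fstPart (F w)) w ≠ 0} with hWdef
  have hW : W ∈ 𝓝 u :=
    (h.eventually hu).and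
      ((h.smooth_fst hu).contDiffAt_jacobian.continuousAt.eventually_ne hne)
  have hε2 : ε * ε = 1 := by rcases hε with rfl | rfl <;> norm_num
  have hflat : ∀ w ∈ W, g₁.curvature (Φ (point e w)).1 = 0 ∧
      g₂.curvature (Φ (point e w)).2 = 0 := by
    intro w hw
    have h1 := curvature_snd_eq hM₁ hε hΦ hlag hnondeg hpar he he₁ he₂ hw.1 hw.2
    set κ₁ := g₁.curvature (Φ (point e w)).1 with hκ₁
    set κ₂ := g₂.curvature (Φ (point e w)).2 with hκ₂
    have h2 : κ₁ = ε * κ₂ := by rw [h1, ← mul_assoc, hε2, one_mul]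
    rcases hcurv with ⟨_, _, hs⟩ | ⟨hf, _⟩ | ⟨hf, _⟩
    · by_cases h0 : κ₁ = 0
      · exact ⟨h0, by rw [h1, h0, mul_zero]⟩
      · have h0' : κ₂ ≠ 0 := fun h0' => h0 (by rw [h2, h0', mul_zero])
        have := hs _ _ h0 h0'
        rw [← hκ₁, ← hκ₂, h2, ← mul_assoc, hε2, one_mul] at this
        exact absurd this (mul_self_nonneg κ₂).not_gt
    · have h0 : κ₁ = 0 := hf _
      exact ⟨h0, by rw [h1, h0, mul_zero]⟩
    · have h0 : κ₂ = 0 := hf _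
      exact ⟨by rw [h2, h0, mul_zero], h0⟩
  have key : g₁.NonFlatAE ∨ g₂.NonFlatAE := by tauto
  rcases key with hn | hn
  · refine (volume_image_pos_of_jacobian_ne_zero (h.smooth_fst hu) hne hW).ne'
      (MeasureTheory.measure_mono_null ?_ (hn e₁ he₁))
    rintro _ ⟨w, hw, rfl⟩
    exact ⟨(Φ (point e w)).1, ⟨hw.1.2.1, (hflat w hw).1⟩, rfl⟩
  · refine (volume_image_pos_of_jacobian_ne_zero (h.smooth_snd hu) hne₂ hW).ne'
      (MeasureTheory.measure_mono_null ?_ (hn e₂ he₂))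
    rintro _ ⟨w, hw, rfl⟩
    exact ⟨(Φ (point e w)).2, ⟨hw.1.2.2, (hflat w hw).2⟩, rfl⟩

end LorentzSurface

/-! ### Product coordinates -/

section PartialDiffeomorph

/-- The restriction of a partial diffeomorphism to an open subset of its source. -/
def PartialDiffeomorph.restrict {E F H K M N : Type*} [NormedAddCommGroup E] [NormedSpace ℝ E]
    [NormedAddCommGroup F] [NormedSpace ℝ F] [TopologicalSpace H] [TopologicalSpace K]
    {I : ModelWithCorners ℝ E H} {J : ModelWithCorners ℝ F K} [TopologicalSpace M]
    [ChartedSpace H M] [TopologicalSpace N] [ChartedSpace K N] {n : WithTop ℕ∞}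
    (P : PartialDiffeomorph I J M N n) (V : Set M) (hV : IsOpen V) (hVP : V ⊆ P.source) :
    PartialDiffeomorph I J M N n where
  toFun := P
  invFun := P.invFun
  source := V
  target := P.target ∩ P.invFun ⁻¹' V
  map_source' := fun x hx => ⟨P.map_source' (hVP hx), by
    have h : P.invFun (P.toFun x) = x := P.left_inv' (hVP hx)
    rw [Set.mem_preimage, h]
    exact hx⟩
  map_target' := fun _ hy => hy.2
  left_inv' := fun _ hx => P.left_inv' (hVP hx)
  right_inv' := fun _ hy => P.right_inv' hy.1
  open_source := hV
  open_target := P.contMDiffOn_invFun.continuousOn.isOpen_inter_preimage P.open_target hV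
  contMDiffOn_toFun := P.contMDiffOn_toFun.mono hVP
  contMDiffOn_invFun := P.contMDiffOn_invFun.mono Set.inter_subset_left

/-- The product of two partial diffeomorphisms of the line. -/
def PartialDiffeomorph.prodReal (φ₁ φ₂ : PartialDiffeomorph 𝓘(ℝ, ℝ) 𝓘(ℝ, ℝ) ℝ ℝ ∞) :
    PartialDiffeomorph 𝓘(ℝ, ℝ × ℝ) 𝓘(ℝ, ℝ × ℝ) (ℝ × ℝ) (ℝ × ℝ) ∞ where
  toPartialEquiv := φ₁.toPartialEquiv.prod φ₂.toPartialEquiv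
  open_source := φ₁.open_source.prod φ₂.open_source
  open_target := φ₁.open_target.prod φ₂.open_target
  contMDiffOn_toFun := contMDiffOn_iff_contDiffOn.2
    ((contMDiffOn_iff_contDiffOn.1 φ₁.contMDiffOn_toFun).prodMap
      (contMDiffOn_iff_contDiffOn.1 φ₂.contMDiffOn_toFun))
  contMDiffOn_invFun := contMDiffOn_iff_contDiffOn.2
    ((contMDiffOn_iff_contDiffOn.1 φ₁.contMDiffOn_invFun).prodMap
      (contMDiffOn_iff_contDiffOn.1 φ₂.contMDiffOn_invFun))

/-- The inverse function theorem. -/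
theorem ContDiffOn.exists_partialDiffeomorph {E F : Type*} [NormedAddCommGroup E] [NormedSpace ℝ E]
    [CompleteSpace E] [NormedAddCommGroup F] [NormedSpace ℝ F] [CompleteSpace F] {f : E → F}
    {U : Set E} (hf : ContDiffOn ℝ ∞ f U) (hU : IsOpen U) {a : E} (ha : a ∈ U)
    (hbij : Function.Bijective (fderiv ℝ f a)) :
    ∃ R : PartialDiffeomorph 𝓘(ℝ, E) 𝓘(ℝ, F) E F ∞,
      a ∈ R.source ∧ R.source ⊆ U ∧ ∀ x, R x = f x := by
  have hat : ∀ x ∈ U, ContDiffAt ℝ ∞ f x := fun x hx => hf.contDiffAt (hU.mem_nhds hx)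
  obtain ⟨f', hf'⟩ : ∃ f' : E ≃L[ℝ] F, (f' : E →L[ℝ] F) = fderiv ℝ f a :=
    ⟨ContinuousLinearEquiv.ofBijective (fderiv ℝ f a) (LinearMap.ker_eq_bot.2 hbij.1)
      (LinearMap.range_eq_top.2 hbij.2), by ext; rfl⟩
  have hd : HasFDerivAt f (f' : E →L[ℝ] F) a := by
    rw [hf']; exact ((hat a ha).differentiableAt (by simp)).hasFDerivAt
  set H := (hat a ha).toOpenPartialHomeomorph f hd (by simp) with hH
  have haH : a ∈ H.source := (hat a ha).mem_toOpenPartialHomeomorph_source hd (by simp)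
  -- the points where the derivative is still invertible
  set V : Set E := U ∩ fderiv ℝ f ⁻¹' Set.range ((↑) : (E ≃L[ℝ] F) → E →L[ℝ] F) with hV
  have hVo : IsOpen V := (hf.continuousOn_fderiv_of_isOpen hU (by simp)).isOpen_inter_preimage hU
    ContinuousLinearEquiv.isOpen
  set H' := H.restrOpen V hVo with hH'
  refine ⟨⟨H'.toPartialEquiv, H'.open_source, H'.open_target, ?_, ?_⟩, ⟨haH, ha, f', hf'⟩,
    fun x hx => hx.2.1, fun x => rfl⟩
  · exact contMDiffOn_iff_contDiffOn.2 (hf.mono fun x hx => hx.2.1)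
  · refine contMDiffOn_iff_contDiffOn.2 fun y hy => ContDiffAt.contDiffWithinAt ?_
    have hx : H'.symm y ∈ H'.source := H'.map_target hy
    obtain ⟨f'', hf''⟩ := hx.2.2
    refine H'.contDiffAt_symm hy (f₀' := f'') ?_ (hat _ hx.2.1)
    rw [hf'']
    exact ((hat _ hx.2.1).differentiableAt (by simp)).hasFDerivAt

end PartialDiffeomorph

theorem exists_square_subset {V : Set (ℝ × ℝ)} (hV : IsOpen V) (h0 : (0, 0) ∈ V) :
    ∃ δ > 0, Set.Ioo (-δ) δ ×ˢ Set.Ioo (-δ) δ ⊆ V := by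
  obtain ⟨δ, hδ, h⟩ := Metric.isOpen_iff.1 hV _ h0
  refine ⟨δ, hδ, fun x hx => h ?_⟩
  rw [← ball_prod_same, Real.ball_eq_Ioo]
  simpa using hx

namespace CoordGeom

theorem exists_fderiv_eq_zero_of_jacobian_eq_zero {f : (Fin 2 → ℝ) → Fin 2 → ℝ} {u : Fin 2 → ℝ}
    (hf : DifferentiableAt ℝ f u) (h : jacobian f u = 0) : ∃ v ≠ 0, fderiv ℝ f u v = 0 := by
  have hdet : (!![tangent f 0 u 0, tangent f 1 u 0; tangent f 0 u 1, tangent f 1 u 1] :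
      Matrix (Fin 2) (Fin 2) ℝ).det = 0 := by
    rw [Matrix.det_fin_two_of, ← h, jacobian]; ring
  obtain ⟨v, hv, hv0⟩ := Matrix.exists_mulVec_eq_zero_iff.2 hdet
  refine ⟨v, hv, ?_⟩
  rw [fderiv_eq_sum_tangent hf]
  ext k
  have h0 := congrFun hv0 k
  obtain rfl | rfl := eq_zero_or_eq_one k
  · simp [Matrix.mulVec, dotProduct] at h0
    simp only [Pi.add_apply, Pi.smul_apply, smul_eq_mul, Pi.zero_apply]
    linarith
  · simp [Matrix.mulVec, dotProduct] at h0
    simp only [Pi.add_apply, Pi.smul_apply, smul_eq_mul, Pi.zero_apply]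
    linarith

/-- A component with nonzero differential of a map of rank at most one has the same level curves
as the map. -/
theorem fderiv_eq_zero_of_component {f : (Fin 2 → ℝ) → Fin 2 → ℝ} {u : Fin 2 → ℝ}
    (hf : DifferentiableAt ℝ f u) (h : jacobian f u = 0) {i : Fin 2}
    (hi : fderiv ℝ (fun w => f w i) u ≠ 0) {v : Fin 2 → ℝ}
    (hv : fderiv ℝ (fun w => f w i) u v = 0) : fderiv ℝ f u v = 0 := by
  have hcomp : ∀ k w, fderiv ℝ f u w k = w 0 * tangent f 0 u k + w 1 * tangent f 1 u k :=
    fun k w => congrFun (fderiv_eq_sum_tangent hf w) k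
  have hi' : ∀ w, fderiv ℝ (fun w => f w i) u w = fderiv ℝ f u w i := fun w => by
    rw [fderiv_apply hf i]; rfl
  have hjac : ∀ k l, tangent f 0 u k * tangent f 1 u l = tangent f 0 u l * tangent f 1 u k := by
    intro k l
    rw [jacobian] at h
    obtain rfl | rfl := eq_zero_or_eq_one k <;> obtain rfl | rfl := eq_zero_or_eq_one l <;>
      linarith
  rw [hi', hcomp] at hv
  ext k
  rw [hcomp, Pi.zero_apply]
  by_cases h0 : tangent f 0 u i = 0
  · have h1 : tangent f 1 u i ≠ 0 := fun h1 => hi <| by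
      ext1 w
      rw [hi', hcomp, h0, h1]
      simp
    apply mul_left_cancel₀ h1
    linear_combination tangent f 1 u k * hv + v 0 * hjac k i
  · apply mul_left_cancel₀ h0
    linear_combination tangent f 0 u k * hv + v 1 * hjac i k

/-- If the differential of `f` vanishes on the kernel of that of `α`, then `f` is constant along
the level curves of `α`. -/
theorem eq_of_level_curve {E F : Type*} [NormedAddCommGroup E] [NormedSpace ℝ E]
    [NormedAddCommGroup F] [NormedSpace ℝ F] {f : E → F} {α : E → ℝ} {U : Set E}
    (hf : ∀ u ∈ U, DifferentiableAt ℝ f u) (hα : ∀ u ∈ U, DifferentiableAt ℝ α u)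
    (hker : ∀ u ∈ U, ∀ v, fderiv ℝ α u v = 0 → fderiv ℝ f u v = 0)
    {γ : ℝ → E} {δ k : ℝ} (hγ : ∀ t ∈ Set.Ioo (-δ) δ, DifferentiableAt ℝ γ t)
    (hγU : ∀ t ∈ Set.Ioo (-δ) δ, γ t ∈ U) (hk : ∀ t ∈ Set.Ioo (-δ) δ, α (γ t) = k)
    {s t : ℝ} (hs : s ∈ Set.Ioo (-δ) δ) (ht : t ∈ Set.Ioo (-δ) δ) : f (γ s) = f (γ t) := by
  refine isOpen_Ioo.is_const_of_deriv_eq_zero (f := fun t => f (γ t)) isPreconnected_Ioo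
    (fun t ht => ((hf _ (hγU t ht)).comp t (hγ t ht)).differentiableWithinAt) (fun t ht => ?_) hs ht
  have h1 := (hf _ (hγU t ht)).hasFDerivAt.comp_hasDerivAt t (hγ t ht).hasDerivAt
  have h2 := (hα _ (hγU t ht)).hasFDerivAt.comp_hasDerivAt t (hγ t ht).hasDerivAt
  have h3 : HasDerivAt (fun t => α (γ t)) 0 t := by
    refine (hasDerivAt_const t k).congr_of_eventuallyEq ?_
    filter_upwards [isOpen_Ioo.mem_nhds ht] with w hw using hk w hw
  have h4 : deriv (fun t => f (γ t)) t = _ := h1.deriv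
  rw [h4]
  exact hker _ (hγU t ht) _ (h2.unique h3)

/-- If two maps have rank at most one and their differentials have transversal kernels, then there
are coordinates in which each map depends on one of the variables only. -/
theorem exists_product_coordinates {f₁ f₂ : (Fin 2 → ℝ) → Fin 2 → ℝ} {U : Set (Fin 2 → ℝ)}
    (hU : IsOpen U) (hf₁ : ∀ u ∈ U, SmoothAt f₁ u) (hf₂ : ∀ u ∈ U, SmoothAt f₂ u)
    (h₁ : ∀ u ∈ U, jacobian f₁ u = 0) (h₂ : ∀ u ∈ U, jacobian f₂ u = 0) {u₀ : Fin 2 → ℝ}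
    (hu₀ : u₀ ∈ U) (hker : ∀ v, fderiv ℝ f₁ u₀ v = 0 → fderiv ℝ f₂ u₀ v = 0 → v = 0) :
    ∃ δ > 0, ∃ R : PartialDiffeomorph 𝓘(ℝ, ℝ × ℝ) 𝓘(ℝ, Fin 2 → ℝ) (ℝ × ℝ) (Fin 2 → ℝ) ∞,
      R.source = Set.Ioo (-δ) δ ×ˢ Set.Ioo (-δ) δ ∧ R (0, 0) = u₀ ∧ (∀ x ∈ R.source, R x ∈ U) ∧
      ∀ x ∈ R.source, f₁ (R x) = f₁ (R (x.1, 0)) ∧ f₂ (R x) = f₂ (R (0, x.2)) := by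
  have hd₁ : ∀ u ∈ U, DifferentiableAt ℝ f₁ u :=
    fun u hu => (hf₁ u hu).contDiffAt.differentiableAt (by simp)
  have hd₂ : ∀ u ∈ U, DifferentiableAt ℝ f₂ u :=
    fun u hu => (hf₂ u hu).contDiffAt.differentiableAt (by simp)
  have hcomp : ∀ {f : (Fin 2 → ℝ) → Fin 2 → ℝ}, DifferentiableAt ℝ f u₀ →
      fderiv ℝ f u₀ ≠ 0 → ∃ i, fderiv ℝ (fun w => f w i) u₀ ≠ 0 := by
    intro f hf hne
    by_contra! h0
    refine hne (ContinuousLinearMap.ext fun v => funext fun i => ?_)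
    have := DFunLike.congr_fun (h0 i) v
    rwa [fderiv_apply hf i] at this
  obtain ⟨i, hi⟩ : ∃ i, fderiv ℝ (fun w => f₁ w i) u₀ ≠ 0 := by
    refine hcomp (hd₁ u₀ hu₀) fun h0 => ?_
    obtain ⟨v, hv, hv0⟩ := exists_fderiv_eq_zero_of_jacobian_eq_zero (hd₂ u₀ hu₀) (h₂ u₀ hu₀)
    exact hv (hker v (by rw [h0]; rfl) hv0)
  obtain ⟨j, hj⟩ : ∃ j, fderiv ℝ (fun w => f₂ w j) u₀ ≠ 0 := by
    refine hcomp (hd₂ u₀ hu₀) fun h0 => ?_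
    obtain ⟨v, hv, hv0⟩ := exists_fderiv_eq_zero_of_jacobian_eq_zero (hd₁ u₀ hu₀) (h₁ u₀ hu₀)
    exact hv (hker v hv0 (by rw [h0]; rfl))
  set α : (Fin 2 → ℝ) → ℝ := fun w => f₁ w i - f₁ u₀ i with hα
  set β : (Fin 2 → ℝ) → ℝ := fun w => f₂ w j - f₂ u₀ j with hβ
  have hαd : ∀ u, fderiv ℝ α u = fderiv ℝ (fun w => f₁ w i) u := fun u => fderiv_sub_const _
  have hβd : ∀ u, fderiv ℝ β u = fderiv ℝ (fun w => f₂ w j) u := fun u => fderiv_sub_const _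
  have hαs : ContDiffOn ℝ ∞ α U := fun u hu =>
    ((hf₁ u hu i).sub contDiffAt_const).contDiffWithinAt
  have hβs : ContDiffOn ℝ ∞ β U := fun u hu =>
    ((hf₂ u hu j).sub contDiffAt_const).contDiffWithinAt
  have hαdiff : ∀ u ∈ U, DifferentiableAt ℝ α u := fun u hu =>
    (hαs.contDiffAt (hU.mem_nhds hu)).differentiableAt (by simp)
  have hβdiff : ∀ u ∈ U, DifferentiableAt ℝ β u := fun u hu =>
    (hβs.contDiffAt (hU.mem_nhds hu)).differentiableAt (by simp)
  set V : Set (Fin 2 → ℝ) := (U ∩ fderiv ℝ α ⁻¹' {0}ᶜ) ∩ (U ∩ fderiv ℝ β ⁻¹' {0}ᶜ) with hV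
  have hVo : IsOpen V :=
    ((hαs.continuousOn_fderiv_of_isOpen hU (by simp)).isOpen_inter_preimage hU
      isOpen_compl_singleton).inter
    ((hβs.continuousOn_fderiv_of_isOpen hU (by simp)).isOpen_inter_preimage hU
      isOpen_compl_singleton)
  have hVU : ∀ u ∈ V, u ∈ U := fun u hu => hu.1.1
  have hu₀V : u₀ ∈ V :=
    ⟨⟨hu₀, fun h0 => hi ((hαd u₀).symm.trans h0)⟩, ⟨hu₀, fun h0 => hj ((hβd u₀).symm.trans h0)⟩⟩
  have hkα : ∀ u ∈ V, ∀ v, fderiv ℝ α u v = 0 → fderiv ℝ f₁ u v = 0 := by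
    intro u hu v hv
    rw [hαd] at hv
    exact fderiv_eq_zero_of_component (hd₁ u (hVU u hu)) (h₁ u (hVU u hu))
      (fun h0 => hu.1.2 ((hαd u).trans h0)) hv
  have hkβ : ∀ u ∈ V, ∀ v, fderiv ℝ β u v = 0 → fderiv ℝ f₂ u v = 0 := by
    intro u hu v hv
    rw [hβd] at hv
    exact fderiv_eq_zero_of_component (hd₂ u (hVU u hu)) (h₂ u (hVU u hu))
      (fun h0 => hu.2.2 ((hβd u).trans h0)) hv
  have hψ : ContDiffOn ℝ ∞ (fun u => (α u, β u)) V :=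
    (hαs.prodMk hβs).mono hVU
  have hψd : fderiv ℝ (fun u => (α u, β u)) u₀ = (fderiv ℝ α u₀).prod (fderiv ℝ β u₀) :=
    (hαdiff u₀ hu₀).fderiv_prodMk (hβdiff u₀ hu₀)
  have hinj : Function.Injective (fderiv ℝ (fun u => (α u, β u)) u₀) := by
    rw [hψd, injective_iff_map_eq_zero]
    intro v hv
    have hv' := Prod.ext_iff.1 hv
    exact hker v (hkα u₀ hu₀V v hv'.1) (hkβ u₀ hu₀V v hv'.2)
  have hbij : Function.Bijective (fderiv ℝ (fun u => (α u, β u)) u₀) :=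
    ⟨hinj, (LinearMap.injective_iff_surjective_of_finrank_eq_finrank
      (f := (fderiv ℝ (fun u => (α u, β u)) u₀ : (Fin 2 → ℝ) →ₗ[ℝ] ℝ × ℝ)) (by simp)).1 hinj⟩
  obtain ⟨Q, hu₀Q, hQV, hQ⟩ := hψ.exists_partialDiffeomorph hVo hu₀V hbij
  have hQ0 : Q u₀ = (0, 0) := by rw [hQ]; simp [hα, hβ]
  obtain ⟨δ, hδ, hsq⟩ := exists_square_subset Q.open_target
    (by rw [← hQ0]; exact Q.map_source' hu₀Q)
  set R := Q.symm.restrict (Set.Ioo (-δ) δ ×ˢ Set.Ioo (-δ) δ) (isOpen_Ioo.prod isOpen_Ioo) hsq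
    with hR
  have hRV : ∀ x ∈ Set.Ioo (-δ) δ ×ˢ Set.Ioo (-δ) δ, R x ∈ V := fun x hx =>
    hQV (Q.map_target' (hsq hx))
  have hαβ : ∀ x ∈ Set.Ioo (-δ) δ ×ˢ Set.Ioo (-δ) δ, (α (R x), β (R x)) = x := fun x hx => by
    rw [← hQ (R x)]
    exact Q.right_inv' (hsq hx)
  have hRd : ∀ x ∈ Set.Ioo (-δ) δ ×ˢ Set.Ioo (-δ) δ, DifferentiableAt ℝ R x := fun x hx =>
    ((contMDiffOn_iff_contDiffOn.1 R.contMDiffOn_toFun).contDiffAt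
      (R.open_source.mem_nhds hx)).differentiableAt (by simp)
  have h0 : (0 : ℝ) ∈ Set.Ioo (-δ) δ := ⟨by linarith, hδ⟩
  refine ⟨δ, hδ, R, rfl, ?_, fun x hx => hVU _ (hRV x hx), fun x hx => ⟨?_, ?_⟩⟩
  · have : R (0, 0) = Q.invFun (Q u₀) := by rw [hQ0]; rfl
    rw [this]
    exact Q.left_inv' hu₀Q
  · refine eq_of_level_curve (α := α) (U := V) (γ := fun t => R (x.1, t)) (k := x.1)
      (fun u hu => hd₁ u (hVU u hu)) (fun u hu => hαdiff u (hVU u hu)) hkα (fun t ht => ?_)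
      (fun t ht => hRV _ ⟨hx.1, ht⟩) (fun t ht => ?_) hx.2 h0
    · exact (hRd (x.1, t) ⟨hx.1, ht⟩).comp t (f := fun t => (x.1, t)) (by fun_prop)
    · exact congrArg Prod.fst (hαβ (x.1, t) ⟨hx.1, ht⟩)
  · refine eq_of_level_curve (α := β) (U := V) (γ := fun t => R (t, x.2)) (k := x.2)
      (fun u hu => hd₂ u (hVU u hu)) (fun u hu => hβdiff u (hVU u hu)) hkβ (fun t ht => ?_)
      (fun t ht => hRV _ ⟨ht, hx.2⟩) (fun t ht => ?_) hx.1 h0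
    · exact (hRd (t, x.2) ⟨ht, hx.2⟩).comp t (f := fun t => (t, x.2)) (by fun_prop)
    · exact congrArg Prod.snd (hαβ (t, x.2) ⟨ht, hx.2⟩)

end CoordGeom

/-! ### Parametrization by arclength -/

namespace CoordGeom

theorem exists_smooth_primitive {ρ : ℝ → ℝ} {δ : ℝ} (hδ : 0 < δ)
    (hρ : ContDiffOn ℝ ∞ ρ (Set.Ioo (-δ) δ)) :
    ∃ σ : ℝ → ℝ, σ 0 = 0 ∧ ContDiffOn ℝ ∞ σ (Set.Ioo (-δ) δ) ∧
      ∀ s ∈ Set.Ioo (-δ) δ, HasDerivAt σ (ρ s) s := by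
  have h0 : (0 : ℝ) ∈ Set.Ioo (-δ) δ := ⟨by linarith, hδ⟩
  have hd : ∀ s ∈ Set.Ioo (-δ) δ, HasDerivAt (fun s => ∫ x in (0 : ℝ)..s, ρ x) (ρ s) s := by
    intro s hs
    refine intervalIntegral.integral_hasDerivAt_right ?_ ?_
      (hρ.continuousOn.continuousAt (isOpen_Ioo.mem_nhds hs))
    · exact (hρ.continuousOn.mono (Set.ordConnected_Ioo.uIcc_subset h0 hs)).intervalIntegrable
    · exact hρ.continuousOn.stronglyMeasurableAtFilter isOpen_Ioo s hs
  refine ⟨fun s => ∫ x in (0 : ℝ)..s, ρ x, intervalIntegral.integral_same, ?_, hd⟩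
  refine (contDiffOn_infty_iff_deriv_of_isOpen isOpen_Ioo).2
    ⟨fun s hs => (hd s hs).differentiableAt.differentiableWithinAt, ?_⟩
  exact hρ.congr fun s hs => (hd s hs).deriv

/-- A curve without null tangent vectors can be parametrized by arclength. -/
theorem IsLorentzOn.exists_arclength_parameter {g : (Fin 2 → ℝ) → Matrix (Fin 2) (Fin 2) ℝ}
    {D : Set (Fin 2 → ℝ)} (hg : IsLorentzOn g D) {c : ℝ → Fin 2 → ℝ} {δ : ℝ} (hδ : 0 < δ)
    (hc : ContDiffOn ℝ ∞ c (Set.Ioo (-δ) δ)) (hcD : ∀ s ∈ Set.Ioo (-δ) δ, c s ∈ D)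
    (hq : ∀ s ∈ Set.Ioo (-δ) δ, ip (g (c s)) (deriv c s) (deriv c s) ≠ 0) :
    ∃ η : ℝ, (η = 1 ∨ η = -1) ∧ ∃ φ : PartialDiffeomorph 𝓘(ℝ, ℝ) 𝓘(ℝ, ℝ) ℝ ℝ ∞,
      0 ∈ φ.source ∧ φ 0 = 0 ∧ ∀ s ∈ φ.source, φ s ∈ Set.Ioo (-δ) δ ∧
        ip (g (c (φ s))) (deriv (fun t => c (φ t)) s) (deriv (fun t => c (φ t)) s) = η := by
  have h0 : (0 : ℝ) ∈ Set.Ioo (-δ) δ := ⟨by linarith, hδ⟩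
  have hcat : ∀ s ∈ Set.Ioo (-δ) δ, ContDiffAt ℝ ∞ c s := fun s hs =>
    hc.contDiffAt (isOpen_Ioo.mem_nhds hs)
  set q : ℝ → ℝ := fun s => ip (g (c s)) (deriv c s) (deriv c s) with hqdef
  have hqs : ContDiffOn ℝ ∞ q (Set.Ioo (-δ) δ) := by
    intro s hs
    refine ContDiffAt.contDiffWithinAt ?_
    have h1 : ∀ i j, ContDiffAt ℝ ∞ (fun s => g (c s) i j) s := fun i j =>
      (hg.contDiffAt (hcD s hs) i j).comp s (hcat s hs)
    have h2 : ∀ i, ContDiffAt ℝ ∞ (fun s => deriv c s i) s :=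
      contDiffAt_pi.1 (contDiffAt_deriv (hcat s hs))
    have h3 := ((h2 0).mul (((h1 0 0).mul (h2 0)).add ((h1 0 1).mul (h2 1)))).add
      ((h2 1).mul (((h1 1 0).mul (h2 0)).add ((h1 1 1).mul (h2 1))))
    exact h3.congr_of_eventuallyEq (Filter.Eventually.of_forall fun t => ip_fin_two _ _ _)
  obtain ⟨η, hη, hη0⟩ : ∃ η : ℝ, (η = 1 ∨ η = -1) ∧ 0 < η * q 0 := by
    rcases lt_or_gt_of_ne (hq 0 h0) with h | h
    · exact ⟨-1, Or.inr rfl, by simpa using h⟩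
    · exact ⟨1, Or.inl rfl, by simpa using h⟩
  have hη2 : η * η = 1 := by rcases hη with rfl | rfl <;> norm_num
  have hρ : ContDiffOn ℝ ∞ (fun s => Real.sqrt |q s|) (Set.Ioo (-δ) δ) := fun s hs => by
    have h1 : ContDiffAt ℝ ∞ (fun s => |q s|) s :=
      ContDiffAt.comp s (g := fun x : ℝ => |x|) (contDiffAt_abs (hq s hs))
        (hqs.contDiffAt (isOpen_Ioo.mem_nhds hs))
    exact (h1.sqrt (abs_ne_zero.2 (hq s hs))).contDiffWithinAt
  obtain ⟨σ, hσ0, hσs, hσd⟩ := exists_smooth_primitive hδ hρ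
  set V : Set ℝ := Set.Ioo (-δ) δ ∩ (fun s => η * q s) ⁻¹' Set.Ioi 0 with hV
  have hVo : IsOpen V := (continuousOn_const.mul hqs.continuousOn).isOpen_inter_preimage isOpen_Ioo
    isOpen_Ioi
  have hσ' : fderiv ℝ σ 0 = ContinuousLinearMap.toSpanSingleton ℝ (Real.sqrt |q 0|) :=
    (hσd 0 h0).hasFDerivAt.fderiv
  have hρ0 : Real.sqrt |q 0| ≠ 0 := (Real.sqrt_pos.2 (abs_pos.2 (hq 0 h0))).ne'
  have hbij : Function.Bijective (fderiv ℝ σ 0) := by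
    rw [hσ']
    refine ⟨fun a b hab => ?_, fun y => ⟨y / Real.sqrt |q 0|, ?_⟩⟩
    · simpa [hρ0] using hab
    · simp [hρ0]
  obtain ⟨Q, h0Q, hQV, hQ⟩ := (hσs.mono Set.inter_subset_left).exists_partialDiffeomorph hVo
    (a := 0) ⟨h0, hη0⟩ hbij
  have hQ0 : Q 0 = 0 := by rw [hQ, hσ0]
  refine ⟨η, hη, Q.symm, ?_, ?_, fun s hs => ?_⟩
  · have := Q.map_source' h0Q
    rwa [show Q.toFun 0 = 0 from hQ0] at this
  · have := Q.left_inv' h0Q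
    rwa [show Q.toFun 0 = 0 from hQ0] at this
  · have hx : Q.symm s ∈ V := hQV (Q.map_target' hs)
    have hφd : DifferentiableAt ℝ Q.symm s := ((contMDiffOn_iff_contDiffOn.1
      Q.symm.contMDiffOn_toFun).contDiffAt (Q.symm.open_source.mem_nhds hs)).differentiableAt
        (by simp)
    refine ⟨hx.1, ?_⟩
    have h1 : HasDerivAt (fun t => σ (Q.symm t)) _ s := (hσd _ hx.1).comp s hφd.hasDerivAt
    have h2 : HasDerivAt (fun t => σ (Q.symm t)) 1 s := by
      refine (hasDerivAt_id s).congr_of_eventuallyEq ?_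
      filter_upwards [Q.symm.open_source.mem_nhds hs] with w hw
      rw [← hQ]
      exact Q.right_inv' hw
    have h3 := h1.unique h2
    have h4 : HasDerivAt (fun t => c (Q.symm t)) _ s :=
      ((hcat _ hx.1).differentiableAt (by simp)).hasDerivAt.scomp s hφd.hasDerivAt
    rw [h4.deriv, ip_smul_left, ip_smul_right]
    have h5 : Real.sqrt |q (Q.symm s)| * Real.sqrt |q (Q.symm s)| = η * q (Q.symm s) := by
      rw [Real.mul_self_sqrt (abs_nonneg _)]
      have hpos : 0 < η * q (Q.symm s) := hx.2
      rcases hη with rfl | rfl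
      · rw [one_mul] at hpos ⊢; exact abs_of_pos hpos
      · rw [abs_of_neg (by linarith)]; ring
    change _ * (_ * q (Q.symm s)) = η
    set d := deriv Q.symm.toFun s
    set ρ := Real.sqrt |q (Q.symm s)|
    have h6 : d * (d * q (Q.symm s)) = η * (ρ * d) * (ρ * d) := by
      linear_combination (-η * d ^ 2) * h5 - d ^ 2 * q (Q.symm s) * hη2
    exact h6.trans (by rw [h3]; ring)

end CoordGeom

/-! ### Local products of curves -/

namespace LorentzSurface
open CoordGeom

section Patch

variable {M₁ M₂ S : Type*} [TopologicalSpace M₁] [TopologicalSpace M₂] [TopologicalSpace S]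
  [ChartedSpace Plane S]

/-- The parametrization of a surface given by a smooth chart. -/
def pointDiffeo {e : OpenPartialHomeomorph S Plane} (he : e ∈ IsManifold.maximalAtlas (𝓡 2) ∞ S) :
    PartialDiffeomorph 𝓘(ℝ, Fin 2 → ℝ) (𝓡 2) (Fin 2 → ℝ) S ∞ where
  toFun := point e
  invFun := coord e
  source := coordDomain e
  target := e.source
  map_source' := fun _ hu => point_mem_source hu
  map_target' := fun _ hx => coord_mem_coordDomain hx
  left_inv' := fun _ hu => coord_point hu
  right_inv' := fun _ hx => point_coord hx
  open_source := isOpen_coordDomain e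
  open_target := e.open_source
  contMDiffOn_toFun := fun _ hu => (contMDiffAt_point he hu).contMDiffWithinAt
  contMDiffOn_invFun := fun _ hx => (contMDiffAt_coord he hx).contMDiffWithinAt

/-- The chart inverse to a local parametrization. -/
def patchChart (P : PartialDiffeomorph 𝓘(ℝ, ℝ × ℝ) (𝓡 2) (ℝ × ℝ) S ∞) :
    OpenPartialHomeomorph S Plane :=
  P.symm.toOpenPartialHomeomorph.trans
    ((ContinuousLinearEquiv.finTwoArrow ℝ ℝ).symm.trans
      (PiLp.continuousLinearEquiv 2 ℝ (fun _ : Fin 2 => ℝ)).symm).toHomeomorph.toOpenPartialHomeomorph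

variable {P : PartialDiffeomorph 𝓘(ℝ, ℝ × ℝ) (𝓡 2) (ℝ × ℝ) S ∞}

theorem mem_coordDomain_patchChart {u : Fin 2 → ℝ} :
    u ∈ coordDomain (patchChart P) ↔ (u 0, u 1) ∈ P.source := by
  refine ⟨fun h => h.2, fun h => ⟨trivial, h⟩⟩

theorem patchChart_mem_maximalAtlas [IsManifold (𝓡 2) ∞ S] :
    patchChart P ∈ IsManifold.maximalAtlas (𝓡 2) ∞ S := by
  let L : (ℝ × ℝ) ≃L[ℝ] Plane := (ContinuousLinearEquiv.finTwoArrow ℝ ℝ).symm.trans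
      (PiLp.continuousLinearEquiv 2 ℝ (fun _ : Fin 2 => ℝ)).symm
  apply OpenPartialHomeomorph.mem_maximalAtlas_of_contMDiffOn
  · exact L.contDiff.contMDiff.comp_contMDiffOn
      (P.contMDiffOn_invFun.mono fun x hx => hx.1)
  · exact P.contMDiffOn_toFun.comp (L.symm.contDiff.contMDiff.contMDiffOn) fun x hx => hx.2

/-- In the parametrization `P` of `S` by a square, `Φ` is the product of the curves whose
coordinates in the charts `e₁` and `e₂` are `c₁` and `c₂`. -/
structure IsProductPatch (Φ : S → M₁ × M₂) (e₁ : OpenPartialHomeomorph M₁ Plane)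
    (e₂ : OpenPartialHomeomorph M₂ Plane)
    (P : PartialDiffeomorph 𝓘(ℝ, ℝ × ℝ) (𝓡 2) (ℝ × ℝ) S ∞) (δ : ℝ) (c₁ c₂ : ℝ → Fin 2 → ℝ) :
    Prop where
  pos : 0 < δ
  source_eq : P.source = Set.Ioo (-δ) δ ×ˢ Set.Ioo (-δ) δ
  smooth_fst : ContDiffOn ℝ ∞ c₁ (Set.Ioo (-δ) δ)
  smooth_snd : ContDiffOn ℝ ∞ c₂ (Set.Ioo (-δ) δ)
  fst_mem : ∀ x ∈ P.source, (Φ (P x)).1 ∈ e₁.source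
  snd_mem : ∀ x ∈ P.source, (Φ (P x)).2 ∈ e₂.source
  fst_eq : ∀ x ∈ P.source, coord e₁ (Φ (P x)).1 = c₁ x.1
  snd_eq : ∀ x ∈ P.source, coord e₂ (Φ (P x)).2 = c₂ x.2

namespace IsProductPatch

variable {Φ : S → M₁ × M₂} {e₁ : OpenPartialHomeomorph M₁ Plane}
  {e₂ : OpenPartialHomeomorph M₂ Plane} {δ : ℝ} {c₁ c₂ : ℝ → Fin 2 → ℝ}

theorem zero_mem (h : IsProductPatch Φ e₁ e₂ P δ c₁ c₂) : (0 : ℝ) ∈ Set.Ioo (-δ) δ :=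
  ⟨by linarith [h.pos], h.pos⟩

theorem mem_source (h : IsProductPatch Φ e₁ e₂ P δ c₁ c₂) {s t : ℝ} (hs : s ∈ Set.Ioo (-δ) δ)
    (ht : t ∈ Set.Ioo (-δ) δ) : (s, t) ∈ P.source := by
  rw [h.source_eq]; exact ⟨hs, ht⟩

theorem curve_fst_mem (h : IsProductPatch Φ e₁ e₂ P δ c₁ c₂) {s : ℝ} (hs : s ∈ Set.Ioo (-δ) δ) :
    c₁ s ∈ coordDomain e₁ := by
  have := h.mem_source hs h.zero_mem
  rw [← h.fst_eq _ this]
  exact coord_mem_coordDomain (h.fst_mem _ this)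

theorem curve_snd_mem (h : IsProductPatch Φ e₁ e₂ P δ c₁ c₂) {t : ℝ} (ht : t ∈ Set.Ioo (-δ) δ) :
    c₂ t ∈ coordDomain e₂ := by
  have := h.mem_source h.zero_mem ht
  rw [← h.snd_eq _ this]
  exact coord_mem_coordDomain (h.snd_mem _ this)

theorem mem_localDomain_iff (h : IsProductPatch Φ e₁ e₂ P δ c₁ c₂) {u : Fin 2 → ℝ} :
    u ∈ localDomain Φ (patchChart P) e₁ e₂ ↔
      u 0 ∈ Set.Ioo (-δ) δ ∧ u 1 ∈ Set.Ioo (-δ) δ := by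
  have key : (u 0, u 1) ∈ P.source ↔ u 0 ∈ Set.Ioo (-δ) δ ∧ u 1 ∈ Set.Ioo (-δ) δ := by
    rw [h.source_eq]; rfl
  rw [← key]
  exact ⟨fun hu => mem_coordDomain_patchChart.1 hu.1,
    fun hu => ⟨mem_coordDomain_patchChart.2 hu, h.fst_mem _ hu, h.snd_mem _ hu⟩⟩

theorem convex_localDomain (h : IsProductPatch Φ e₁ e₂ P δ c₁ c₂) :
    Convex ℝ (localDomain Φ (patchChart P) e₁ e₂) := by
  have : localDomain Φ (patchChart P) e₁ e₂ = Set.pi Set.univ fun _ : Fin 2 => Set.Ioo (-δ) δ := by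
    ext u
    rw [h.mem_localDomain_iff, Set.mem_univ_pi, Fin.forall_fin_two]
  rw [this]
  exact convex_pi fun _ _ => convex_Ioo _ _

theorem fstPart_localExpr (h : IsProductPatch Φ e₁ e₂ P δ c₁ c₂) {u : Fin 2 → ℝ}
    (hu : u ∈ localDomain Φ (patchChart P) e₁ e₂) :
    fstPart (localExpr Φ (patchChart P) e₁ e₂ u) = c₁ (u 0) :=
  h.fst_eq (u 0, u 1) (mem_coordDomain_patchChart.1 hu.1)

theorem sndPart_localExpr (h : IsProductPatch Φ e₁ e₂ P δ c₁ c₂) {u : Fin 2 → ℝ}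
    (hu : u ∈ localDomain Φ (patchChart P) e₁ e₂) :
    sndPart (localExpr Φ (patchChart P) e₁ e₂ u) = c₂ (u 1) :=
  h.snd_eq (u 0, u 1) (mem_coordDomain_patchChart.1 hu.1)

theorem contDiffAt_fst (h : IsProductPatch Φ e₁ e₂ P δ c₁ c₂) {u : Fin 2 → ℝ}
    (hu : u ∈ localDomain Φ (patchChart P) e₁ e₂) : ContDiffAt ℝ ∞ c₁ (u 0) :=
  h.smooth_fst.contDiffAt (isOpen_Ioo.mem_nhds (h.mem_localDomain_iff.1 hu).1)

theorem contDiffAt_snd (h : IsProductPatch Φ e₁ e₂ P δ c₁ c₂) {u : Fin 2 → ℝ}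
    (hu : u ∈ localDomain Φ (patchChart P) e₁ e₂) : ContDiffAt ℝ ∞ c₂ (u 1) :=
  h.smooth_snd.contDiffAt (isOpen_Ioo.mem_nhds (h.mem_localDomain_iff.1 hu).2)

/-- Both curves may be reparametrized. -/
theorem reparametrize (h : IsProductPatch Φ e₁ e₂ P δ c₁ c₂)
    {φ₁ φ₂ : PartialDiffeomorph 𝓘(ℝ, ℝ) 𝓘(ℝ, ℝ) ℝ ℝ ∞} (h₁ : 0 ∈ φ₁.source) (h₁' : φ₁ 0 = 0)
    (h₂ : 0 ∈ φ₂.source) (h₂' : φ₂ 0 = 0) (hm₁ : ∀ s ∈ φ₁.source, φ₁ s ∈ Set.Ioo (-δ) δ)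
    (hm₂ : ∀ s ∈ φ₂.source, φ₂ s ∈ Set.Ioo (-δ) δ) :
    ∃ δ' > 0, ∃ P' : PartialDiffeomorph 𝓘(ℝ, ℝ × ℝ) (𝓡 2) (ℝ × ℝ) S ∞,
      IsProductPatch Φ e₁ e₂ P' δ' (fun s => c₁ (φ₁ s)) (fun s => c₂ (φ₂ s)) ∧
      P' (0, 0) = P (0, 0) ∧ Set.Ioo (-δ') δ' ⊆ φ₁.source ∧ Set.Ioo (-δ') δ' ⊆ φ₂.source := by
  obtain ⟨δ', hδ', hsq⟩ := exists_square_subset (φ₁.open_source.prod φ₂.open_source)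
    (Set.mk_mem_prod h₁ h₂)
  have h0 : (0 : ℝ) ∈ Set.Ioo (-δ') δ' := ⟨by linarith, hδ'⟩
  have hs₁ : Set.Ioo (-δ') δ' ⊆ φ₁.source := fun s hs => (hsq (Set.mk_mem_prod hs h0)).1
  have hs₂ : Set.Ioo (-δ') δ' ⊆ φ₂.source := fun s hs => (hsq (Set.mk_mem_prod h0 hs)).2
  set P₀ := (φ₁.prodReal φ₂).trans P with hP₀
  have hsub : Set.Ioo (-δ') δ' ×ˢ Set.Ioo (-δ') δ' ⊆ P₀.source := by
    intro x hx
    refine ⟨⟨hs₁ hx.1, hs₂ hx.2⟩, ?_⟩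
    exact h.mem_source (hm₁ _ (hs₁ hx.1)) (hm₂ _ (hs₂ hx.2))
  set P' := P₀.restrict _ (isOpen_Ioo.prod isOpen_Ioo) hsub with hP'
  have hval : ∀ x, P' x = P (φ₁ x.1, φ₂ x.2) := fun x => rfl
  have hmem : ∀ x ∈ P'.source, (φ₁ x.1, φ₂ x.2) ∈ P.source := fun x hx =>
    h.mem_source (hm₁ _ (hs₁ hx.1)) (hm₂ _ (hs₂ hx.2))
  refine ⟨δ', hδ', P', ⟨hδ', rfl, ?_, ?_, ?_, ?_, ?_, ?_⟩, ?_, hs₁, hs₂⟩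
  · exact h.smooth_fst.comp ((contMDiffOn_iff_contDiffOn.1 φ₁.contMDiffOn_toFun).mono hs₁)
      fun s hs => hm₁ s (hs₁ hs)
  · exact h.smooth_snd.comp ((contMDiffOn_iff_contDiffOn.1 φ₂.contMDiffOn_toFun).mono hs₂)
      fun s hs => hm₂ s (hs₂ hs)
  · exact fun x hx => h.fst_mem _ (hmem x hx)
  · exact fun x hx => h.snd_mem _ (hmem x hx)
  · exact fun x hx => h.fst_eq _ (hmem x hx)
  · exact fun x hx => h.snd_eq _ (hmem x hx)
  · rw [hval, h₁', h₂']

variable [ChartedSpace Plane M₁] [ChartedSpace Plane M₂]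
  {ε : ℝ} {g₁ : LorentzMetric M₁} {g₂ : LorentzMetric M₂}

/-- If the induced metric is nondegenerate, then the curves are nowhere null. -/
theorem ip_deriv_ne_zero (h : IsProductPatch Φ e₁ e₂ P δ c₁ c₂)
    (hF : IsParallelLagrangian ε (g₁.components e₁) (g₂.components e₂) (coordDomain e₁)
      (coordDomain e₂) (localExpr Φ (patchChart P) e₁ e₂) (localDomain Φ (patchChart P) e₁ e₂)) :
    (∀ s ∈ Set.Ioo (-δ) δ, ip (g₁.components e₁ (c₁ s)) (deriv c₁ s) (deriv c₁ s) ≠ 0) ∧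
      ∀ t ∈ Set.Ioo (-δ) δ, ip (g₂.components e₂ (c₂ t)) (deriv c₂ t) (deriv c₂ t) ≠ 0 := by
  have key : ∀ s ∈ Set.Ioo (-δ) δ, ∀ t ∈ Set.Ioo (-δ) δ,
      ip (g₁.components e₁ (c₁ s)) (deriv c₁ s) (deriv c₁ s) *
        (ε * ip (g₂.components e₂ (c₂ t)) (deriv c₂ t) (deriv c₂ t)) ≠ 0 := by
    intro s hs t ht
    have hu : ![s, t] ∈ localDomain Φ (patchChart P) e₁ e₂ := h.mem_localDomain_iff.2 ⟨hs, ht⟩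
    have htan := tangent_of_product_curves hF.isOpen (fun u hu => h.contDiffAt_fst hu)
      (fun u hu => h.contDiffAt_snd hu) (fun u hu => h.fstPart_localExpr hu)
      (fun u hu => h.sndPart_localExpr hu) _ hu
    have hn := hF.nondeg _ hu
    have hp : ∀ a b, pullback (prodMetric ε (g₁.components e₁) (g₂.components e₂))
        (localExpr Φ (patchChart P) e₁ e₂) ![s, t] a b
        = ip (prodMetric ε (g₁.components e₁) (g₂.components e₂)
          (localExpr Φ (patchChart P) e₁ e₂ ![s, t])) (tangent _ a _) (tangent _ b _) :=
      fun a b => rfl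
    have hz : ∀ (A : Matrix (Fin 2) (Fin 2) ℝ) (v : Fin 2 → ℝ), ip A 0 v = 0 ∧ ip A v 0 = 0 :=
      fun A v => by simp [ip]
    rw [Matrix.det_fin_two] at hn
    simp only [hp, ip_prodMetric, (htan _).1, (htan _).2, h.fstPart_localExpr hu,
      h.sndPart_localExpr hu] at hn
    simpa [hz] using hn
  exact ⟨fun s hs => left_ne_zero_of_mul (key s hs 0 h.zero_mem),
    fun t ht => right_ne_zero_of_mul (right_ne_zero_of_mul (key 0 h.zero_mem t ht))⟩

end IsProductPatch
end Patch

section Curves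

variable {M : Type*} [TopologicalSpace M] [ChartedSpace Plane M] [IsManifold (𝓡 2) ∞ M]

/-- Constancy of the curvature of a curve may be checked in a single chart. -/
theorem LorentzMetric.isConstantCurvatureCurve_point (g : LorentzMetric M)
    (hM : IsOrientedAtlas M) {e : OpenPartialHomeomorph M Plane} (he : e ∈ atlas Plane M)
    {c : ℝ → Fin 2 → ℝ} {I : Set ℝ} (hI : IsOpen I) (hc : ContDiffOn ℝ ∞ c I)
    (hcD : ∀ s ∈ I, c s ∈ coordDomain e) {η k : ℝ} (hη : η = 1 ∨ η = -1)
    (hunit : ∀ s ∈ I, ip (g.components e (c s)) (deriv c s) (deriv c s) = η)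
    (hacc : ∀ s ∈ I, acceleration (g.components e) c s
      = k • (paracomplex (g.components e (c s)) *ᵥ deriv c s)) :
    g.IsConstantCurvatureCurve (fun s => point e (c s)) I := by
  refine ⟨fun s hs => ?_, η, k, hη, fun s hs e' he' hse' => ?_⟩
  · exact ((contMDiffAt_point (mem_maximalAtlas he) (hcD s hs)).comp s
      (hc.contDiffAt (hI.mem_nhds hs)).contMDiffAt).contMDiffWithinAt
  · have hτ := g.isLocalIsometry_transition he he'
    have hcs : c s ∈ transitionDomain e e' := mem_transitionDomain.2 ⟨hcD s hs, hse'⟩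
    have hcat : ContDiffAt ℝ ∞ c s := hc.contDiffAt (hI.mem_nhds hs)
    have hcomp : (coord e' ∘ fun s => point e (c s)) = fun t => transition e e' (c t) := rfl
    have hpt : coord e' (point e (c s)) = transition e e' (c s) := rfl
    rw [hcomp, hpt, hτ.deriv_comp (hcat.differentiableAt (by simp)) hcs,
      hτ.acceleration_comp hcat hcs, hτ.paracomplex_mulVec hcs (transition_det_pos hM he he' hcs),
      hacc s hs]
    refine ⟨(hτ.ip_eq hcs _ _).trans (hunit s hs), ?_⟩
    simp only [Pi.smul_apply, smul_eq_mul, smul_add, mul_smul]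

end Curves
end LorentzSurface

/-! ### Local structure of the surfaces -/

namespace LorentzSurface
open CoordGeom

section Assembly

variable {M₁ M₂ S : Type*} [TopologicalSpace M₁] [TopologicalSpace M₂] [TopologicalSpace S]
  [ChartedSpace Plane M₁] [ChartedSpace Plane M₂] [ChartedSpace Plane S]
  {ε : ℝ} {g₁ : LorentzMetric M₁} {g₂ : LorentzMetric M₂} {Φ : S → M₁ × M₂}
  {e : OpenPartialHomeomorph S Plane} {e₁ : OpenPartialHomeomorph M₁ Plane}
  {e₂ : OpenPartialHomeomorph M₂ Plane}

/-- If both projections of a nondegenerate surface have rank at most one, then the surface is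
locally a product of curves. -/
theorem exists_isProductPatch [IsManifold (𝓡 2) ∞ S]
    (he : e ∈ IsManifold.maximalAtlas (𝓡 2) ∞ S)
    (h : IsParallelLagrangian ε (g₁.components e₁) (g₂.components e₂) (coordDomain e₁)
      (coordDomain e₂) (localExpr Φ e e₁ e₂) (localDomain Φ e e₁ e₂))
    (hjac : ∀ u ∈ localDomain Φ e e₁ e₂,
      jacobian (fun w => fstPart (localExpr Φ e e₁ e₂ w)) u = 0)
    {p : S} (hp : p ∈ e.source) (hp₁ : (Φ p).1 ∈ e₁.source) (hp₂ : (Φ p).2 ∈ e₂.source) :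
    ∃ (δ : ℝ) (P : PartialDiffeomorph 𝓘(ℝ, ℝ × ℝ) (𝓡 2) (ℝ × ℝ) S ∞) (c₁ c₂ : ℝ → Fin 2 → ℝ),
      IsProductPatch Φ e₁ e₂ P δ c₁ c₂ ∧ P (0, 0) = p := by
  set F := localExpr Φ e e₁ e₂ with hF
  have hpp : point e (coord e p) = p := point_coord hp
  have hu₀ : coord e p ∈ localDomain Φ e e₁ e₂ :=
    ⟨coord_mem_coordDomain hp, by rwa [hpp], by rwa [hpp]⟩
  have hd₁ := (h.smooth_fst hu₀).contDiffAt.differentiableAt (by simp)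
  have hd₂ := (h.smooth_snd hu₀).contDiffAt.differentiableAt (by simp)
  -- a nondegenerate surface is immersed
  have hker : ∀ v, fderiv ℝ (fun w => fstPart (F w)) (coord e p) v = 0 →
      fderiv ℝ (fun w => sndPart (F w)) (coord e p) v = 0 → v = 0 := by
    intro v hv₁ hv₂
    rw [fderiv_eq_sum_tangent hd₁] at hv₁
    rw [fderiv_eq_sum_tangent hd₂] at hv₂
    have hv : v 0 • tangent F 0 (coord e p) + v 1 • tangent F 1 (coord e p) = 0 :=
      ext_parts hv₁ hv₂
    by_contra hne
    refine h.nondeg _ hu₀ (Matrix.exists_mulVec_eq_zero_iff.1 ⟨v, hne, ?_⟩)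
    ext a
    have h1 : (pullback (prodMetric ε (g₁.components e₁) (g₂.components e₂)) F (coord e p) *ᵥ v) a
        = ip (prodMetric ε (g₁.components e₁) (g₂.components e₂) (F (coord e p)))
          (tangent F a (coord e p))
          (v 0 • tangent F 0 (coord e p) + v 1 • tangent F 1 (coord e p)) := by
      rw [ip_add_right, ip_smul_right, ip_smul_right]
      simp only [Matrix.mulVec, dotProduct, Fin.sum_univ_two]
      rw [mul_comm, mul_comm _ (v 1)]
      rfl
    rw [h1, hv]
    simp [ip]
  obtain ⟨δ, hδ, R, hRs, hR0, hRU, hRf⟩ := exists_product_coordinates h.isOpen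
    (fun u hu => h.smooth_fst hu) (fun u hu => h.smooth_snd hu) hjac
    (fun u hu => (h.jacobian_fst_eq_zero_iff hu).1 (hjac u hu)) hu₀ hker
  have h0 : (0 : ℝ) ∈ Set.Ioo (-δ) δ := ⟨by linarith, hδ⟩
  have hRsm : ContDiffOn ℝ ∞ R R.source := contMDiffOn_iff_contDiffOn.1 R.contMDiffOn_toFun
  set P := (R.trans (pointDiffeo he)).restrict R.source R.open_source
    fun x hx => ⟨hx, (hRU x hx).1⟩ with hP
  have hPval : ∀ x, P x = point e (R x) := fun x => rfl
  have hfs : ContDiffOn ℝ ∞ (fun w => fstPart (F w)) (localDomain Φ e e₁ e₂) := fun u hu =>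
    (h.smooth_fst hu).contDiffAt.contDiffWithinAt
  have hss : ContDiffOn ℝ ∞ (fun w => sndPart (F w)) (localDomain Φ e e₁ e₂) := fun u hu =>
    (h.smooth_snd hu).contDiffAt.contDiffWithinAt
  refine ⟨δ, P, fun s => fstPart (F (R (s, 0))), fun t => sndPart (F (R (0, t))),
    ⟨hδ, hRs, ?_, ?_, fun x hx => (hRU x hx).2.1, fun x hx => (hRU x hx).2.2,
      fun x hx => (hRf x hx).1, fun x hx => (hRf x hx).2⟩, ?_⟩
  · have hm : Set.MapsTo (fun s : ℝ => (s, (0 : ℝ))) (Set.Ioo (-δ) δ) R.source := fun s hs => by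
      rw [hRs]; exact ⟨hs, h0⟩
    exact hfs.comp (hRsm.comp (by fun_prop) hm) fun s hs => hRU _ (hm hs)
  · have hm : Set.MapsTo (fun s : ℝ => ((0 : ℝ), s)) (Set.Ioo (-δ) δ) R.source := fun s hs => by
      rw [hRs]; exact ⟨h0, hs⟩
    exact hss.comp (hRsm.comp (by fun_prop) hm) fun s hs => hRU _ (hm hs)
  · rw [hPval, hR0, hpp]

end Assembly
end LorentzSurface

end

open CoordGeom LorentzSurface in
theorem theorem2
    {M₁ M₂ S : Type*}
    [TopologicalSpace M₁] [ChartedSpace (EuclideanSpace ℝ (Fin 2)) M₁] [IsManifold (𝓡 2) ∞ M₁]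
    [TopologicalSpace M₂] [ChartedSpace (EuclideanSpace ℝ (Fin 2)) M₂] [IsManifold (𝓡 2) ∞ M₂]
    [TopologicalSpace S] [ChartedSpace (EuclideanSpace ℝ (Fin 2)) S] [IsManifold (𝓡 2) ∞ S]
    (hM₁ : LorentzSurface.IsOrientedAtlas M₁) (hM₂ : LorentzSurface.IsOrientedAtlas M₂)
    (g₁ : LorentzSurface.LorentzMetric M₁) (g₂ : LorentzSurface.LorentzMetric M₂)
    (ε : ℝ) (hε : ε = 1 ∨ ε = -1)
    (hcurv :
      (g₁.NonFlatAE ∧ g₂.NonFlatAE ∧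
        ∀ (x : M₁) (y : M₂), g₁.curvature x ≠ 0 → g₂.curvature y ≠ 0 →
          ε * g₁.curvature x * g₂.curvature y < 0) ∨
      (g₁.IsFlat ∧ g₂.NonFlatAE) ∨
      (g₂.IsFlat ∧ g₁.NonFlatAE))
    (Φ : S → M₁ × M₂)
    (hΦ : ContMDiff (𝓡 2) ((𝓡 2).prod (𝓡 2)) ∞ Φ)
    (himm : ∀ p : S, Function.Injective (mfderiv (𝓡 2) ((𝓡 2).prod (𝓡 2)) Φ p))
    (hlag : LorentzSurface.IsLagrangian ε g₁ g₂ Φ)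
    (hnondeg : LorentzSurface.IsNondegenerate ε g₁ g₂ Φ)
    (hpar : LorentzSurface.HasParallelMeanCurvature ε g₁ g₂ Φ) :
    LorentzSurface.IsLocallyProductOfCurves g₁ g₂ Φ := by
  intro p
  set e := chartAt Plane p with he
  set e₁ := chartAt Plane (Φ p).1 with he₁
  set e₂ := chartAt Plane (Φ p).2 with he₂
  have hm₁ : e₁ ∈ atlas Plane M₁ := chart_mem_atlas Plane _
  have hm₂ : e₂ ∈ atlas Plane M₂ := chart_mem_atlas Plane _
  have hm : e ∈ IsManifold.maximalAtlas (𝓡 2) ∞ S := mem_maximalAtlas (chart_mem_atlas Plane _)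
  have hloc := fun (e : OpenPartialHomeomorph S Plane)
      (he : e ∈ IsManifold.maximalAtlas (𝓡 2) ∞ S) =>
    isParallelLagrangian_localExpr hε hΦ hlag hnondeg hpar he hm₁ hm₂
  obtain ⟨δ₀, P₀, c₁, c₂, h₀, hP₀⟩ := exists_isProductPatch hm (hloc e hm)
    (fun u hu => jacobian_fst_localExpr_eq_zero hM₁ hε hcurv hΦ hlag hnondeg hpar hm hm₁ hm₂ hu)
    (mem_chart_source _ p) (mem_chart_source _ _) (mem_chart_source _ _)
  obtain ⟨hq₁, hq₂⟩ := h₀.ip_deriv_ne_zero (hloc _ patchChart_mem_maximalAtlas)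
  obtain ⟨η₁, hη₁, φ₁, h1, h1', hφ₁⟩ := (g₁.isLorentzOn hm₁).exists_arclength_parameter h₀.pos
    h₀.smooth_fst (fun s hs => h₀.curve_fst_mem hs) hq₁
  obtain ⟨η₂, hη₂, φ₂, h2, h2', hφ₂⟩ := (g₂.isLorentzOn hm₂).exists_arclength_parameter h₀.pos
    h₀.smooth_snd (fun s hs => h₀.curve_snd_mem hs) hq₂
  obtain ⟨δ, hδ, P, h, hP, hs₁, hs₂⟩ := h₀.reparametrize h1 h1' h2 h2'
    (fun s hs => (hφ₁ s hs).1) (fun s hs => (hφ₂ s hs).1)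
  -- the inverse of `P` is a smooth chart of `S`, in which the hypotheses on `Φ` hold as well
  obtain ⟨k₁, k₂, hk⟩ := (hloc _ (patchChart_mem_maximalAtlas (P := P))).exists_acceleration_eq
    h.convex_localDomain (fun u hu => h.contDiffAt_fst hu) (fun u hu => h.contDiffAt_snd hu)
    (fun u hu => h.fstPart_localExpr hu) (fun u hu => h.sndPart_localExpr hu)
    (fun u hu => (hφ₁ _ (hs₁ (h.mem_localDomain_iff.1 hu).1)).2)
    (fun u hu => (hφ₂ _ (hs₂ (h.mem_localDomain_iff.1 hu).2)).2)
  refine ⟨δ, hδ, P, fun s => point e₁ (c₁ (φ₁ s)), fun t => point e₂ (c₂ (φ₂ t)), h.source_eq,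
    hP.trans hP₀, ?_, ?_, fun s hs t ht => ?_⟩
  · exact g₁.isConstantCurvatureCurve_point hM₁ hm₁ isOpen_Ioo h.smooth_fst
      (fun s hs => h.curve_fst_mem hs) hη₁ (fun s hs => (hφ₁ s (hs₁ hs)).2)
      fun s hs => (hk ![s, 0] (h.mem_localDomain_iff.2 ⟨hs, h.zero_mem⟩)).1
  · exact g₂.isConstantCurvatureCurve_point hM₂ hm₂ isOpen_Ioo h.smooth_snd
      (fun s hs => h.curve_snd_mem hs) hη₂ (fun s hs => (hφ₂ s (hs₂ hs)).2)
      fun s hs => (hk ![0, s] (h.mem_localDomain_iff.2 ⟨h.zero_mem, hs⟩)).2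
  · have hst := h.mem_source hs ht
    refine Prod.ext ?_ ?_
    · exact (point_coord (h.fst_mem _ hst)).symm.trans (congrArg (point e₁) (h.fst_eq _ hst))
    · exact (point_coord (h.snd_mem _ hst)).symm.trans (congrArg (point e₂) (h.snd_eq _ hst))
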